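/- Let $\Sigma$ be a finite non-empty alphabet, let $\star\notin\Sigma$ be a wildcard symbol, and let $\delta$ be a function that assigns a number in $\mathbb N=\{0,1,2,\dots\}$ to each pair of a string over $\Sigma$ and a string over $\Sigma\cup\{\star\}$. Call $\delta$ *character-wise wildcard-compatible* if $\delta(x,y)=\sum_{j=1}^{L}\delta(x[j],y[j])$ for all $L\ge 0$, $x\in\Sigma^L$, $y\in(\Sigma\cup\{\star\})^L$, and $\delta(e,\star)=0$ for all $e\in\Sigma$. An instance of **$\delta$-Multi Strings** consists of $k\ge 1$ strings $s_1,\dots,s_k\in(\Sigma\cup\{\star\})^L$, bounds $d_1,\dots,d_k,D_1,\dots,D_k\in\mathbb N$, the distance function $\delta$ and a bit $b\in\{0,1\}$. A string $y\in\Sigma^L$ is *feasible* if $d_i\le\delta(y,s_i)\le D_i$ for all $i$. To *solve* the instance means either to report correctly that no feasible string exists, or to find a feasible $y$ that minimizes $b\cdot\sum_{i=1}^k\delta(y,s_i)$ among all feasible strings. Instances and solutions are represented succinctly. The $j$-th column of the input is $(s_1[j],\dots,s_k[j])$. The input strings are given by the number of columns of each type $\mathbf e\in(\Sigma\cup\{\star\})^k$,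 and an output string $y$ is given by the numbers, for each type $\mathbf e$ and each letter $f\in\Sigma$, of positions $j$ at which the column has type $\mathbf e$ and $y[j]=f$. The input also contains $k$, $|\Sigma|$, $L$, $b$, all $d_i$ and $D_i$, and the table of the values $\delta(e,f)$ for $e\in\Sigma$, $f\in\Sigma\cup\{\star\}$. **Theorem.** Let $K=\max\{|\Sigma|,\,k,\,\max_{e,f\in\Sigma}\delta(e,f)\}$. There is an algorithm (a single one for all $\Sigma$, $k$, $L$ and all character-wise wildcard-compatible $\delta$) that solves every instance of $\delta$-Multi Strings in time $K^{O(k^2)}\,O(\log L)$; here $\log L$ is read as $\lfloor\log_2 L\rfloor+1$ (as $1$ for $L=0$). Time is the number of steps of a random access machine that performs one arithmetic operation, comparison or memory access on integers of $O\big(k^2\log K+\log (L+2)+\log(1+\max_i\max\{d_i,D_i\})\big)$ bits per step. -/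

import Mathlib

/-! ### The machine model: a word RAM with a step count

A machine has signed integer registers and finitely many (as many as the program text names)
random-access arrays.  All values that occur during a run, addresses included, have to fit into a
machine word, i.e. have absolute value at most `B`; every operation on words costs one step. -/

namespace WordRAM

/-- Word operations; comparisons return `0` or `1`, division by zero returns `0`. -/
inductive Op
  | add | sub | mul | div | mod | lt | eq

def Op.apply : Op → ℤ → ℤ → ℤ
  | .add, x, y => x + y
  | .sub, x, y => x - y
  | .mul, x, y => x * y
  | .div, x, y => x / y
  | .mod, x, y => x % y
  | .lt, x, y => if x < y then 1 else 0
  | .eq, x, y => if x = y then 1 else 0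

/-- Expressions: constants, registers, array cells with a computed address, and operations. -/
inductive Expr
  | lit (n : ℤ)
  | reg (r : ℕ)
  | cell (a : ℕ) (addr : Expr)
  | bin (o : Op) (e₁ e₂ : Expr)

structure State where
  reg : ℕ → ℤ
  arr : ℕ → ℤ → ℤ

def State.setReg (s : State) (r : ℕ) (v : ℤ) : State :=
  { s with reg := Function.update s.reg r v }

def State.setCell (s : State) (a : ℕ) (addr v : ℤ) : State :=
  { s with arr := Function.update s.arr a (Function.update (s.arr a) addr v) }

namespace Expr

def eval (s : State) : Expr → ℤ
  | lit n => n
  | reg r => s.reg r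
  | cell a addr => s.arr a (eval s addr)
  | bin o e₁ e₂ => o.apply (eval s e₁) (eval s e₂)

/-- Every value computed while evaluating the expression fits into a machine word. -/
def Fits (B : ℕ) (s : State) : Expr → Prop
  | lit n => |n| ≤ (B : ℤ)
  | reg r => |s.reg r| ≤ (B : ℤ)
  | cell a addr => Fits B s addr ∧ |s.arr a (eval s addr)| ≤ (B : ℤ)
  | bin o e₁ e₂ => Fits B s e₁ ∧ Fits B s e₂ ∧ |o.apply (eval s e₁) (eval s e₂)| ≤ (B : ℤ)

/-- Number of steps of an evaluation: one per constant, access or operation. -/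
def cost : Expr → ℕ
  | lit _ => 1
  | reg _ => 1
  | cell _ addr => cost addr + 1
  | bin _ e₁ e₂ => cost e₁ + cost e₂ + 1

end Expr

inductive Program
  | skip
  | setReg (r : ℕ) (e : Expr)
  | setCell (a : ℕ) (addr e : Expr)
  | seq (p q : Program)
  | cond (e : Expr) (p q : Program)
  | loop (e : Expr) (p : Program)

/-- `Runs B p s t s'`: started in state `s`, the program `p` halts in state `s'` after exactly `t`
steps, and every value it computes is at most `B` in absolute value.  `cond` and `loop` test
whether their expression is nonzero.  A computation that exceeds the word bound has no run. -/
inductive Runs (B : ℕ) : Program → State → ℕ → State → Prop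
  | skip (s : State) : Runs B .skip s 1 s
  | setReg (s : State) (r : ℕ) (e : Expr) (he : e.Fits B s) :
      Runs B (.setReg r e) s (e.cost + 1) (s.setReg r (e.eval s))
  | setCell (s : State) (a : ℕ) (addr e : Expr) (ha : addr.Fits B s) (he : e.Fits B s) :
      Runs B (.setCell a addr e) s (addr.cost + e.cost + 1)
        (s.setCell a (addr.eval s) (e.eval s))
  | seq {p q : Program} {s s' s'' : State} {t t' : ℕ} (hp : Runs B p s t s')
      (hq : Runs B q s' t' s'') : Runs B (.seq p q) s (t + t') s''
  | condTrue {e : Expr} {p q : Program} {s s' : State} {t : ℕ} (he : e.Fits B s)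
      (h : e.eval s ≠ 0) (hp : Runs B p s t s') : Runs B (.cond e p q) s (e.cost + 1 + t) s'
  | condFalse {e : Expr} {p q : Program} {s s' : State} {t : ℕ} (he : e.Fits B s)
      (h : e.eval s = 0) (hq : Runs B q s t s') : Runs B (.cond e p q) s (e.cost + 1 + t) s'
  | loopExit {e : Expr} {p : Program} {s : State} (he : e.Fits B s) (h : e.eval s = 0) :
      Runs B (.loop e p) s (e.cost + 1) s
  | loopStep {e : Expr} {p : Program} {s s' s'' : State} {t t' : ℕ} (he : e.Fits B s)
      (h : e.eval s ≠ 0) (hp : Runs B p s t s') (hl : Runs B (.loop e p) s' t' s'') :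
      Runs B (.loop e p) s (e.cost + 1 + t + t') s''

/-- The contents of an array that holds the vector `v` at addresses `0, …, n - 1` and zeros
elsewhere. -/
def vecArray {n : ℕ} (v : Fin n → ℤ) : ℤ → ℤ :=
  fun a => if h : 0 ≤ a ∧ a.toNat < n then v ⟨a.toNat, h.2⟩ else 0

end WordRAM

/-! ### The problem `δ`-Multi Strings -/

/-- `δ` is a distance between strings over `Σ` and strings over `Σ ∪ {⋆}`; the wildcard `⋆` is
`none`. -/
def IsCharacterwiseWildcardCompatible {A : Type} (δ : List A → List (Option A) → ℕ) : Prop :=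
  (∀ (L : ℕ) (x : Fin L → A) (y : Fin L → Option A),
    δ (List.ofFn x) (List.ofFn y) = ∑ j, δ [x j] [y j]) ∧
  ∀ e : A, δ [e] [none] = 0

/-- An instance: `k` strings of length `L` over `Σ ∪ {⋆}` with `Σ = Fin σ`, distance bounds
`lo i ≤ δ(y, s i) ≤ hi i`, a distance function, and the binary parameter `b`. -/
structure MultiStrings where
  k : ℕ
  σ : ℕ
  L : ℕ
  s : Fin k → Fin L → Option (Fin σ)
  lo : Fin k → ℕ
  hi : Fin k → ℕ
  δ : List (Fin σ) → List (Option (Fin σ)) → ℕ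
  b : Bool

namespace MultiStrings

variable (I : MultiStrings)

/-- The distance of an output string to the `i`-th input string. -/
def dist (y : Fin I.L → Fin I.σ) (i : Fin I.k) : ℕ :=
  I.δ (List.ofFn y) (List.ofFn (I.s i))

def Feasible (y : Fin I.L → Fin I.σ) : Prop :=
  ∀ i, I.lo i ≤ I.dist y i ∧ I.dist y i ≤ I.hi i

def objective (y : Fin I.L → Fin I.σ) : ℕ :=
  I.b.toNat * ∑ i, I.dist y i

def IsSolution (y : Fin I.L → Fin I.σ) : Prop :=
  I.Feasible y ∧ ∀ z, I.Feasible z → I.objective y ≤ I.objective z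

/-- `K = max {|Σ|, k, max_{e, f ∈ Σ} δ(e, f)}`. -/
def K : ℕ :=
  max (max I.σ I.k)
    (Finset.univ.sup fun p : Fin I.σ × Fin I.σ => I.δ [p.1] [some p.2])

/-! #### Succinct representation by multiplicities of column types -/

abbrev ColumnType : Type := Fin I.k → Option (Fin I.σ)

/-- The `j`-th column of the input. -/
def column (j : Fin I.L) : I.ColumnType := fun i => I.s i j

/-- Enumeration of all `(|Σ| + 1) ^ k` column types in base `|Σ| + 1`, with digit `0` for `⋆` and
`f + 1` for the letter `f`. -/
def columnIndex : I.ColumnType ≃ Fin ((I.σ + 1) ^ I.k) :=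
  (Equiv.arrowCongr (Equiv.refl _) (finSuccEquiv I.σ).symm).trans finFunctionFinEquiv

/-- The number of input columns of a given type. -/
def multiplicity (c : I.ColumnType) : ℕ :=
  (Finset.univ.filter fun j => I.column j = c).card

/-- The number of input columns of type `c` at which `y` has the letter `f`. -/
def solutionMultiplicity (y : Fin I.L → Fin I.σ) (c : I.ColumnType) (f : Fin I.σ) : ℕ :=
  (Finset.univ.filter fun j => I.column j = c ∧ y j = f).card

/-- The input of the machine: `k`, `|Σ|`, `L`, `b` in registers `0, …, 3`; arrays `0, …, 3` hold the
table of `δ` on `Σ × (Σ ∪ {⋆})`, the lower bounds, the upper bounds, and the multiplicities of the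
column types.  Everything else is zero. -/
def input : WordRAM.State where
  reg
    | 0 => I.k
    | 1 => I.σ
    | 2 => I.L
    | 3 => I.b.toNat
    | _ => 0
  arr
    | 0 => WordRAM.vecArray fun a : Fin (I.σ * (I.σ + 1)) =>
        let p := finProdFinEquiv.symm a
        (I.δ [p.1] [finSuccEquiv I.σ p.2] : ℤ)
    | 1 => WordRAM.vecArray fun i => (I.lo i : ℤ)
    | 2 => WordRAM.vecArray fun i => (I.hi i : ℤ)
    | 3 => WordRAM.vecArray fun a => (I.multiplicity (I.columnIndex.symm a) : ℤ)
    | _ => fun _ => 0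

/-- The final state contains a correct answer: either register `0` is `0` and no string is
feasible, or register `0` is `1` and array `4` holds the succinct representation of a solution. -/
def CorrectOutput (t : WordRAM.State) : Prop :=
  (t.reg 0 = 0 ∧ ∀ y, ¬ I.Feasible y) ∨
  (t.reg 0 = 1 ∧ ∃ y, I.IsSolution y ∧ ∀ (c : I.ColumnType) (f : Fin I.σ),
    t.arr 4 ((finProdFinEquiv (I.columnIndex c, f) : ℕ) : ℤ) = I.solutionMultiplicity y c f)

/-- A number `N` such that words of `O(log N) = O(k² log K + log L + log max_i (lo i, hi i))` bits
are provided to the machine. -/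
def magnitude : ℕ :=
  I.K ^ I.k ^ 2 + I.L + (Finset.univ.sup fun i => max (I.lo i) (I.hi i)) + 2

end MultiStrings

namespace WordRAM

/-! ### Program notation -/

/-! A string matters only through the numbers x(c, f) of positions with column type c and letter f.
The task is therefore an integer program in (K+1)^{O(k)} nonnegative unknowns ("options"): the sum
over each column type ("class") is prescribed, and k linear forms, the distances, have to lie in
given intervals. Further options with coordinates 0 and -1 absorb the intervals. Feasible strings
then correspond to the vectors with prescribed class sums m whose k coordinates all vanish
(`Raw.mem_balanced`, `MultiStrings.exists_balanced`, `MultiStrings.exists_string`).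

This program is solved by halving. A vector x with class sums m splits as a + b + u, where a and b
both have class sums ⌊m/2⌋ and differ by at most 1 in each entry, and u has the parities of m as
class sums (`exists_halves`). If there are O options, each with coordinates of absolute value at
most D, then the coordinates of a - b and of u are at most O·D. So if those of x are at most E =
2·O·D, the same holds for a and b (`window_eq`). Hence the vectors with sums ⌊m/h⌋ and coordinates
in [-E, E] arise from those with sums ⌊m/(2h)⌋: add that set to itself, add one option for each odd
class, and discard what leaves the window (`Data.ok_level`). For h larger than all multiplicities
the set is {0}; for h = 1 the answer is a cheapest vector with zero coordinates.

Cost is additive, so one cheapest vector for each tuple of coordinates is enough. The tuple is coded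
as one integer in base M = 8E + 1; this is injective on everything that occurs (`digits_unique`),
and the table has about 2·M^k entries, which is K^{O(k²)}. There are log(D·L) + O(1) levels.

The machine side rests on a small program logic. `Ok` yields the word bound and the time bound from
the program text alone, once every stored value is at most Q and every loop makes at most G
iterations. The time is then polynomial in G with a degree fixed by the program (`Program.time_le`).
`OkTimes` adds the single logarithmic factor of the loop over the levels. -/

instance : Add Expr := ⟨Expr.bin .add⟩
instance : Sub Expr := ⟨Expr.bin .sub⟩
instance : Mul Expr := ⟨Expr.bin .mul⟩
instance : Div Expr := ⟨Expr.bin .div⟩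
instance : Mod Expr := ⟨Expr.bin .mod⟩
instance (n : ℕ) : OfNat Expr n := ⟨Expr.lit n⟩

notation:60 p:61 ";;" q:60 => Program.seq p q

section Eval
variable (s : State) (a b : Expr)

@[simp] theorem Expr.eval_add : (a + b).eval s = a.eval s + b.eval s := rfl
@[simp] theorem Expr.eval_sub : (a - b).eval s = a.eval s - b.eval s := rfl
@[simp] theorem Expr.eval_mul : (a * b).eval s = a.eval s * b.eval s := rfl
@[simp] theorem Expr.eval_div : (a / b).eval s = a.eval s / b.eval s := rfl
@[simp] theorem Expr.eval_mod : (a % b).eval s = a.eval s % b.eval s := rfl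
@[simp] theorem Expr.eval_lt :
    (Expr.bin .lt a b).eval s = if a.eval s < b.eval s then 1 else 0 := rfl
@[simp] theorem Expr.eval_eq :
    (Expr.bin .eq a b).eval s = if a.eval s = b.eval s then 1 else 0 := rfl
@[simp] theorem Expr.eval_zero : (0 : Expr).eval s = 0 := rfl
@[simp] theorem Expr.eval_one : (1 : Expr).eval s = 1 := rfl
@[simp] theorem Expr.eval_two : (2 : Expr).eval s = 2 := rfl
@[simp] theorem Expr.eval_three : (3 : Expr).eval s = 3 := rfl
@[simp] theorem Expr.eval_eight : (8 : Expr).eval s = 8 := rfl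
@[simp] theorem Expr.eval_lit (n : ℤ) : (Expr.lit n).eval s = n := rfl
@[simp] theorem Expr.eval_reg (r : ℕ) : (Expr.reg r).eval s = s.reg r := rfl
@[simp] theorem Expr.eval_cell (r : ℕ) : (Expr.cell r a).eval s = s.arr r (a.eval s) := rfl

@[simp] theorem State.setReg_reg (r : ℕ) (v : ℤ) (r' : ℕ) :
    (s.setReg r v).reg r' = if r' = r then v else s.reg r' := by
  simp [State.setReg, Function.update_apply]
@[simp] theorem State.setReg_arr (r : ℕ) (v : ℤ) : (s.setReg r v).arr = s.arr := rfl
@[simp] theorem State.setCell_reg (r : ℕ) (z v : ℤ) : (s.setCell r z v).reg = s.reg := rfl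
@[simp] theorem State.setCell_arr (r : ℕ) (z v : ℤ) (r' : ℕ) :
    (s.setCell r z v).arr r' =
      if r' = r then Function.update (s.arr r) z v else s.arr r' := by
  simp only [State.setCell, Function.update_apply]

end Eval

/-! ### Boundedness of states and values -/

/-- Every value stored in the state has absolute value at most `Q`. -/
def State.Bdd (Q : ℕ) (s : State) : Prop :=
  (∀ r, |s.reg r| ≤ (Q : ℤ)) ∧ ∀ a z, |s.arr a z| ≤ (Q : ℤ)

theorem State.Bdd.setReg {Q : ℕ} {s : State} (hs : s.Bdd Q) (r : ℕ) {v : ℤ}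
    (hv : |v| ≤ (Q : ℤ)) : (s.setReg r v).Bdd Q := by
  refine ⟨fun r' => ?_, hs.2⟩
  rw [State.setReg_reg]
  split_ifs
  exacts [hv, hs.1 r']

theorem State.Bdd.setCell {Q : ℕ} {s : State} (hs : s.Bdd Q) (a : ℕ) (z : ℤ) {v : ℤ}
    (hv : |v| ≤ (Q : ℤ)) : (s.setCell a z v).Bdd Q := by
  refine ⟨hs.1, fun a' z' => ?_⟩
  rw [State.setCell_arr]
  split_ifs
  · rw [Function.update_apply]
    split_ifs
    exacts [hv, hs.2 a z']
  · exact hs.2 a' z'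

/-- All literals of the expression have absolute value at most `16`. -/
def Expr.smallLits : Expr → Bool
  | lit n => decide (n.natAbs ≤ 16)
  | reg _ => true
  | cell _ e => e.smallLits
  | bin _ e₁ e₂ => e₁.smallLits && e₂.smallLits

/-- For bounds that are at least 2, the sum of the bounds is at most their product. One
multiplicative bound therefore serves all operations, including division and remainder by zero. -/
theorem Op.abs_apply_le (o : Op) {x y : ℤ} {X Y : ℕ} (hX : 2 ≤ X) (hY : 2 ≤ Y)
    (hx : |x| ≤ (X : ℤ)) (hy : |y| ≤ (Y : ℤ)) : |o.apply x y| ≤ ((X * Y : ℕ) : ℤ) := by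
  have h1 : (X : ℤ) + Y ≤ ((X * Y : ℕ) : ℤ) := by push_cast; nlinarith
  have hX' : (2 : ℤ) ≤ X := by exact_mod_cast hX
  have hY' : (2 : ℤ) ≤ Y := by exact_mod_cast hY
  cases o with
  | add => exact (abs_add_le x y).trans (by linarith)
  | sub => exact (abs_sub x y).trans (by linarith)
  | mul =>
    show |x * y| ≤ _
    rw [abs_mul]; push_cast
    exact mul_le_mul hx hy (abs_nonneg _) (by positivity)
  | div => exact (Int.abs_ediv_le_abs x y).trans (by linarith)
  | mod =>
    show |x % y| ≤ _
    by_cases h : y = 0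
    · subst h; rw [Int.emod_zero]; linarith
    · rw [abs_of_nonneg (Int.emod_nonneg x h)]
      have := Int.emod_lt_abs x h
      linarith
  | lt => show |if x < y then (1 : ℤ) else 0| ≤ _; split_ifs <;> simp <;> nlinarith
  | eq => show |if x = y then (1 : ℤ) else 0| ≤ _; split_ifs <;> simp <;> nlinarith

theorem Expr.one_le_cost (e : Expr) : 1 ≤ e.cost := by
  cases e <;> simp [cost]

/-- Bounds multiply at each operation while `cost` adds, so the exponent of Q is the cost. A cell
read is bounded by Q whatever its address. Consequently only stored values need individual bounds;
intermediate values are at most a constant power of Q. -/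
theorem Expr.abs_eval_le {Q : ℕ} (hQ : 16 ≤ Q) {s : State} (hs : s.Bdd Q) (e : Expr)
    (he : e.smallLits) : |e.eval s| ≤ ((Q ^ e.cost : ℕ) : ℤ) := by
  induction e with
  | lit n =>
    have h : n.natAbs ≤ 16 := by simpa [smallLits] using he
    simp only [eval_lit, cost, pow_one, Int.abs_eq_natAbs]
    omega
  | reg r => simpa [cost] using hs.1 r
  | cell a e _ =>
    refine (hs.2 a _).trans ?_
    exact_mod_cast Nat.le_self_pow (by simp [cost]) Q
  | bin o a b iha ihb =>
    have h2 : ∀ e : Expr, 2 ≤ Q ^ e.cost := fun e =>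
      (show 2 ≤ Q by omega).trans (Nat.le_self_pow (by have := e.one_le_cost; omega) Q)
    rw [smallLits, Bool.and_eq_true] at he
    refine (o.abs_apply_le (h2 a) (h2 b) (iha he.1) (ihb he.2)).trans ?_
    rw [← pow_add]
    exact_mod_cast Nat.pow_le_pow_right (by omega) (by simp [cost])

theorem Expr.fits_of_bdd {Q : ℕ} (hQ : 16 ≤ Q) {s : State} (hs : s.Bdd Q) (e : Expr)
    (he : e.smallLits) {B : ℕ} (hB : Q ^ e.cost ≤ B) : e.Fits B s := by
  have key : ∀ e : Expr, e.smallLits → Q ^ e.cost ≤ B → |e.eval s| ≤ (B : ℤ) := fun e h h' =>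
    (e.abs_eval_le hQ hs h).trans (by exact_mod_cast h')
  induction e with
  | lit n => exact key _ he hB
  | reg r => exact key _ he hB
  | cell a e ih =>
    exact ⟨ih he ((Nat.pow_le_pow_right (by omega) (by simp [cost])).trans hB), key _ he hB⟩
  | bin o a b iha ihb =>
    have he' := he
    rw [smallLits, Bool.and_eq_true] at he'
    refine ⟨iha he'.1 ((Nat.pow_le_pow_right (by omega) ?_).trans hB),
      ihb he'.2 ((Nat.pow_le_pow_right (by omega) ?_).trans hB), key _ he hB⟩ <;>
    simp only [cost] <;> omega

/-! ### Syntactic data of a program -/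

namespace Program

/-- The registers a program may write to. -/
def regs : Program → List ℕ
  | skip => []
  | setReg r _ => [r]
  | setCell _ _ _ => []
  | seq p q => p.regs ++ q.regs
  | cond _ p q => p.regs ++ q.regs
  | loop _ p => p.regs

/-- The arrays a program may write to. -/
def arrs : Program → List ℕ
  | skip => []
  | setReg _ _ => []
  | setCell a _ _ => [a]
  | seq p q => p.arrs ++ q.arrs
  | cond _ p q => p.arrs ++ q.arrs
  | loop _ p => p.arrs

/-- The largest cost of an expression of the program. -/
def exprCost : Program → ℕ
  | skip => 0
  | setReg _ e => e.cost
  | setCell _ a e => max a.cost e.cost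
  | seq p q => max p.exprCost q.exprCost
  | cond e p q => max e.cost (max p.exprCost q.exprCost)
  | loop e p => max e.cost p.exprCost

/-- The running time of a program all of whose loops make at most `G` iterations. -/
def time (G : ℕ) : Program → ℕ
  | skip => 1
  | setReg _ e => e.cost + 1
  | setCell _ a e => a.cost + e.cost + 1
  | seq p q => p.time G + q.time G
  | cond e p q => e.cost + 1 + (p.time G + q.time G)
  | loop e p => (G + 1) * (e.cost + 1 + p.time G)

def size : Program → ℕ
  | skip => 1
  | setReg _ e => e.cost + 1
  | setCell _ a e => a.cost + e.cost + 1
  | seq p q => p.size + q.size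
  | cond e p q => e.cost + 1 + (p.size + q.size)
  | loop e p => e.cost + 1 + p.size

/-- The nesting depth of loops. -/
def depth : Program → ℕ
  | skip => 0
  | setReg _ _ => 0
  | setCell _ _ _ => 0
  | seq p q => max p.depth q.depth
  | cond _ p q => max p.depth q.depth
  | loop _ p => p.depth + 1

/-- Each level of loop nesting contributes one factor G + 1. For a fixed program `size` and `depth`
are constants, so a bound on the iterations gives a polynomial time bound. -/
theorem time_le (G : ℕ) (p : Program) : p.time G ≤ p.size * (G + 1) ^ p.depth := by
  have key : ∀ {a b : ℕ}, a ≤ b → (G + 1) ^ a ≤ (G + 1) ^ b :=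
    fun h => Nat.pow_le_pow_right (by omega) h
  induction p with
  | skip => simp [time, size, depth]
  | setReg r e => simp [time, size, depth]
  | setCell a e e' => simp [time, size, depth]
  | seq p q ihp ihq =>
    simp only [time, size, depth]
    rw [add_mul]
    exact add_le_add (ihp.trans (Nat.mul_le_mul_left _ (key (le_max_left _ _))))
      (ihq.trans (Nat.mul_le_mul_left _ (key (le_max_right _ _))))
  | cond e p q ihp ihq =>
    simp only [time, size, depth]
    rw [add_mul (e.cost + 1), add_mul p.size]
    refine add_le_add (Nat.le_mul_of_pos_right _ (by positivity)) (add_le_add ?_ ?_)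
    · exact ihp.trans (Nat.mul_le_mul_left _ (key (le_max_left _ _)))
    · exact ihq.trans (Nat.mul_le_mul_left _ (key (le_max_right _ _)))
  | loop e p ihp =>
    simp only [time, size, depth]
    rw [pow_succ', ← mul_assoc, mul_comm _ (G + 1), mul_assoc]
    refine Nat.mul_le_mul_left _ ?_
    rw [add_mul]
    exact add_le_add (Nat.le_mul_of_pos_right _ (by positivity)) ihp

end Program

/-! ### Monotonicity and frames -/

theorem Expr.Fits.mono {B B' : ℕ} (h : B ≤ B') {s : State} {e : Expr} (he : e.Fits B s) :
    e.Fits B' s := by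
  have h' : (B : ℤ) ≤ B' := by exact_mod_cast h
  induction e with
  | lit n => exact le_trans he h'
  | reg r => exact le_trans he h'
  | cell a e ih => exact ⟨ih he.1, he.2.trans h'⟩
  | bin o a b iha ihb => exact ⟨iha he.1, ihb he.2.1, he.2.2.trans h'⟩

theorem Runs.mono {B B' : ℕ} (h : B ≤ B') {p : Program} {s s' : State} {t : ℕ}
    (hr : Runs B p s t s') : Runs B' p s t s' := by
  induction hr with
  | skip s => exact .skip s
  | setReg s r e he => exact .setReg s r e (he.mono h)
  | setCell s a addr e ha he => exact .setCell s a addr e (ha.mono h) (he.mono h)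
  | seq _ _ ih ih' => exact .seq ih ih'
  | condTrue he h0 _ ih => exact .condTrue (he.mono h) h0 ih
  | condFalse he h0 _ ih => exact .condFalse (he.mono h) h0 ih
  | loopExit he h0 => exact .loopExit (he.mono h) h0
  | loopStep he h0 _ _ ih ih' => exact .loopStep (he.mono h) h0 ih ih'

/-- `s'` differs from `s` at most in the registers `rs` and the arrays `as`. -/
def Frame (rs as : List ℕ) (s s' : State) : Prop :=
  (∀ r, r ∉ rs → s'.reg r = s.reg r) ∧ ∀ a, a ∉ as → s'.arr a = s.arr a

theorem Frame.reg {rs as : List ℕ} {s s' : State} (h : Frame rs as s s') (r : ℕ)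
    (hr : rs.contains r = false := by rfl) : s'.reg r = s.reg r :=
  h.1 r (by simpa using hr)

theorem Frame.arr {rs as : List ℕ} {s s' : State} (h : Frame rs as s s') (a : ℕ)
    (ha : as.contains a = false := by rfl) : s'.arr a = s.arr a :=
  h.2 a (by simpa using ha)

theorem Frame.refl (rs as : List ℕ) (s : State) : Frame rs as s s :=
  ⟨fun _ _ => rfl, fun _ _ => rfl⟩

theorem Frame.trans {rs as : List ℕ} {s s' s'' : State} (h : Frame rs as s s')
    (h' : Frame rs as s' s'') : Frame rs as s s'' :=
  ⟨fun r hr => (h'.1 r hr).trans (h.1 r hr), fun a ha => (h'.2 a ha).trans (h.2 a ha)⟩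

theorem Frame.mono {rs as rs' as' : List ℕ} {s s' : State} (h : Frame rs as s s')
    (hr : rs ⊆ rs') (ha : as ⊆ as') : Frame rs' as' s s' :=
  ⟨fun r h' => h.1 r fun h'' => h' (hr h''), fun a h' => h.2 a fun h'' => h' (ha h'')⟩

theorem Frame.setReg (s : State) (r : ℕ) (v : ℤ) (rs as : List ℕ) (hr : r ∈ rs) :
    Frame rs as s (s.setReg r v) := by
  refine ⟨fun r' h => ?_, fun _ _ => rfl⟩
  rw [State.setReg_reg, if_neg]
  rintro rfl
  exact h hr

/-- What a program cannot change is read off its text. For concrete programs the side conditions of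
`Frame.reg` and `Frame.arr` are then closed by `rfl`, and loop invariants only have to mention what
really changes. -/
theorem Runs.frame {B : ℕ} {p : Program} {s s' : State} {t : ℕ} (hr : Runs B p s t s') :
    Frame p.regs p.arrs s s' := by
  induction hr with
  | skip s => exact .refl _ _ _
  | setReg s r e he => exact .setReg _ _ _ _ _ (by simp [Program.regs])
  | setCell s a addr e ha he =>
    refine ⟨fun _ _ => rfl, fun a' h => ?_⟩
    rw [State.setCell_arr, if_neg]
    simpa [Program.arrs] using h
  | seq _ _ ih ih' =>
    exact (ih.mono (List.subset_append_left _ _) (List.subset_append_left _ _)).trans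
      (ih'.mono (List.subset_append_right _ _) (List.subset_append_right _ _))
  | condTrue he h0 _ ih =>
    exact ih.mono (List.subset_append_left _ _) (List.subset_append_left _ _)
  | condFalse he h0 _ ih =>
    exact ih.mono (List.subset_append_right _ _) (List.subset_append_right _ _)
  | loopExit he h0 => exact .refl _ _ _
  | loopStep he h0 _ _ ih ih' => exact ih.trans ih'

/-! ### Total correctness with automatic word and time bounds -/

/-- Started in `s`, the program halts within the time that `G` loop iterations allow, computes only
values that are polynomial in `Q`, and ends in a state bounded by `Q` that satisfies `post`. -/
def Ok (Q G : ℕ) (p : Program) (s : State) (post : State → Prop) : Prop :=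
  ∃ t s', Runs (Q ^ p.exprCost) p s t s' ∧ t ≤ p.time G ∧ s'.Bdd Q ∧ post s'

namespace Ok

variable {Q G : ℕ} {p q : Program} {s : State} {post mid : State → Prop}

theorem frame (h : Ok Q G p s post) :
    Ok Q G p s fun s' => Frame p.regs p.arrs s s' ∧ post s' := by
  obtain ⟨t, s', hr, ht, hb, hp⟩ := h
  exact ⟨t, s', hr, ht, hb, hr.frame, hp⟩

theorem imp (h : Ok Q G p s mid) (h' : ∀ s', s'.Bdd Q → mid s' → post s') :
    Ok Q G p s post := by
  obtain ⟨t, s', hr, ht, hb, hp⟩ := h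
  exact ⟨t, s', hr, ht, hb, h' _ hb hp⟩

theorem skip (hs : s.Bdd Q) (h : post s) : Ok Q G .skip s post :=
  ⟨_, _, .skip s, le_rfl, hs, h⟩

theorem setReg (hQ : 16 ≤ Q) {r : ℕ} {e : Expr} (hs : s.Bdd Q)
    (hv : |e.eval s| ≤ (Q : ℤ)) (h : post (s.setReg r (e.eval s)))
    (hl : e.smallLits := by rfl) :
    Ok Q G (.setReg r e) s post :=
  ⟨_, _, .setReg s r e (e.fits_of_bdd hQ hs hl le_rfl), le_rfl, hs.setReg r hv, h⟩

theorem setCell (hQ : 16 ≤ Q) {a : ℕ} {d e : Expr} (hs : s.Bdd Q)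
    (hv : |e.eval s| ≤ (Q : ℤ)) (h : post (s.setCell a (d.eval s) (e.eval s)))
    (hd : d.smallLits := by rfl) (hl : e.smallLits := by rfl) : Ok Q G (.setCell a d e) s post :=
  ⟨_, _, .setCell s a d e
    (d.fits_of_bdd hQ hs hd (Nat.pow_le_pow_right (by omega) (le_max_left _ _)))
    (e.fits_of_bdd hQ hs hl (Nat.pow_le_pow_right (by omega) (le_max_right _ _))),
    le_rfl, hs.setCell a _ hv, h⟩

theorem seq (hQ : 16 ≤ Q) (hp : Ok Q G p s mid)
    (hq : ∀ s', s'.Bdd Q → Frame p.regs p.arrs s s' → mid s' → Ok Q G q s' post) :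
    Ok Q G (p ;; q) s post := by
  obtain ⟨t, s', hr, ht, hb, hm⟩ := hp
  obtain ⟨t', s'', hr', ht', hb', hm'⟩ := hq s' hb hr.frame hm
  exact ⟨t + t', s'', .seq (hr.mono (Nat.pow_le_pow_right (by omega) (le_max_left _ _)))
    (hr'.mono (Nat.pow_le_pow_right (by omega) (le_max_right _ _))), add_le_add ht ht', hb', hm'⟩

theorem setReg_seq (hQ : 16 ≤ Q) {r : ℕ} {e : Expr} (hs : s.Bdd Q) {v : ℤ}
    (he : e.eval s = v) (hv : |v| ≤ (Q : ℤ))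
    (h : (s.setReg r v).Bdd Q → Ok Q G q (s.setReg r v) post) (hl : e.smallLits := by rfl) :
    Ok Q G (.setReg r e ;; q) s post := by
  subst he
  refine seq hQ (mid := fun s' => s' = s.setReg r (e.eval s)) (setReg hQ hs hv rfl hl) ?_
  rintro s' hs' - rfl
  exact h hs'

theorem setCell_seq (hQ : 16 ≤ Q) {a : ℕ} {d e : Expr} (hs : s.Bdd Q) {z v : ℤ}
    (hd : d.eval s = z) (he : e.eval s = v) (hv : |v| ≤ (Q : ℤ))
    (h : (s.setCell a z v).Bdd Q → Ok Q G q (s.setCell a z v) post)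
    (hld : d.smallLits := by rfl) (hl : e.smallLits := by rfl) :
    Ok Q G (.setCell a d e ;; q) s post := by
  subst hd he
  refine seq hQ (mid := fun s' => s' = s.setCell a (d.eval s) (e.eval s))
    (setCell hQ hs hv rfl hld hl) ?_
  rintro s' hs' - rfl
  exact h hs'

theorem cond (hQ : 16 ≤ Q) {e : Expr} (hs : s.Bdd Q)
    (hp : e.eval s ≠ 0 → Ok Q G p s post) (hq : e.eval s = 0 → Ok Q G q s post)
    (hl : e.smallLits := by rfl) :
    Ok Q G (.cond e p q) s post := by
  have he : e.Fits (Q ^ (Program.cond e p q).exprCost) s :=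
    e.fits_of_bdd hQ hs hl (Nat.pow_le_pow_right (by omega) (le_max_left _ _))
  by_cases h : e.eval s = 0
  · obtain ⟨t, s', hr, ht, hb, hm⟩ := hq h
    refine ⟨_, s', .condFalse he h (hr.mono (Nat.pow_le_pow_right (by omega) ?_)), ?_, hb, hm⟩
    · simp [Program.exprCost]
    · simp only [Program.time]; omega
  · obtain ⟨t, s', hr, ht, hb, hm⟩ := hp h
    refine ⟨_, s', .condTrue he h (hr.mono (Nat.pow_le_pow_right (by omega) ?_)), ?_, hb, hm⟩
    · simp [Program.exprCost]
    · simp only [Program.time]; omega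

end Ok

/-- A loop whose invariant `inv` carries the number of remaining iterations. -/
theorem runs_loop {Q : ℕ} (hQ : 16 ≤ Q) {T : ℕ} {e : Expr} {p : Program} (hl : e.smallLits)
    (inv : ℕ → State → Prop)
    (hexit : ∀ s, inv 0 s → e.eval s = 0)
    (hstep : ∀ j s, s.Bdd Q → inv (j + 1) s → e.eval s ≠ 0 ∧
      ∃ t s', Runs (Q ^ p.exprCost) p s t s' ∧ t ≤ T ∧ s'.Bdd Q ∧ inv j s')
    (j : ℕ) (s : State) (hs : s.Bdd Q) (hi : inv j s) :
    ∃ t s', Runs (Q ^ (Program.loop e p).exprCost) (.loop e p) s t s' ∧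
      t ≤ (j + 1) * (e.cost + 1 + T) ∧ s'.Bdd Q ∧ inv 0 s' := by
  have he : ∀ s : State, s.Bdd Q → e.Fits (Q ^ (Program.loop e p).exprCost) s := fun s hs =>
    e.fits_of_bdd hQ hs hl (Nat.pow_le_pow_right (by omega) (le_max_left _ _))
  induction j generalizing s with
  | zero => exact ⟨_, s, .loopExit (he s hs) (hexit s hi), by simp, hs, hi⟩
  | succ j ih =>
    obtain ⟨h0, t, s', hr, ht, hb, hi'⟩ := hstep j s hs hi
    obtain ⟨t', s'', hr', ht', hb', hi''⟩ := ih s' hb hi'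
    refine ⟨_, s'', .loopStep (he s hs) h0
      (hr.mono (Nat.pow_le_pow_right (by omega) (le_max_right _ _))) hr', ?_, hb', hi''⟩
    rw [add_mul (j + 1)]
    omega

/-- `for r := a, …, (register rb) - 1 do p`. -/
def Program.forLoop (r : ℕ) (a : Expr) (rb : ℕ) (p : Program) : Program :=
  .setReg r a ;; .loop (.bin .lt (.reg r) (.reg rb)) (p ;; .setReg r (.reg r + 1))

/-- The remaining number of iterations is the distance of the counter from the bound, which is
stable because the body writes neither of the two registers. `hstab` is needed because the counter
is initialised and incremented outside the body. The frame relative to the initial state is carried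
along, so that a step may use facts from before the loop. -/
theorem Ok.forLoop {Q G : ℕ} {p : Program} {s : State} {post : State → Prop} (hQ : 16 ≤ Q)
    {r rb : ℕ} {a : Expr} (inv : ℤ → State → Prop) {A H : ℤ} (hs : s.Bdd Q)
    (hA : a.eval s = A) (hH : s.reg rb = H) (hAH : A ≤ H) (hG : H - A ≤ G)
    (hQA : |A| ≤ (Q : ℤ))
    (hstab : ∀ i s v, inv i s → inv i (s.setReg r v)) (h0 : inv A s)
    (hstep : ∀ i s', A ≤ i → i < H → s'.Bdd Q → s'.reg r = i →
      Frame (r :: p.regs) p.arrs s s' → inv i s' → Ok Q G p s' (inv (i + 1)))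
    (hpost : ∀ s', s'.Bdd Q → Frame (r :: p.regs) p.arrs s s' → inv H s' → post s')
    (hl : a.smallLits := by rfl) (hr : p.regs.contains r = false := by rfl)
    (hrb : p.regs.contains rb = false := by rfl) (hne : (rb == r) = false := by rfl) :
    Ok Q G (.forLoop r a rb p) s post := by
  rw [List.contains_eq_mem, decide_eq_false_iff_not] at hr hrb
  rw [beq_eq_false_iff_ne] at hne
  have hHQ : |H| ≤ (Q : ℤ) := hH ▸ hs.1 rb
  set body : Program := p ;; .setReg r (.reg r + 1) with hbody
  obtain ⟨t, s', hrun, ht, hb, hinv⟩ := runs_loop (Q := Q) hQ (T := body.time G)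
    (e := .bin .lt (.reg r) (.reg rb)) (p := body) rfl
    (fun j s' => (j : ℤ) ≤ H - A ∧ s'.reg r = H - j ∧ s'.reg rb = H ∧
      Frame (r :: p.regs) p.arrs s s' ∧ inv (H - j) s')
    (fun s' h => by
      simp only [Expr.eval_lt, Expr.eval_reg, h.2.1, h.2.2.1]; simp)
    (by
      rintro j s' hb ⟨hj, hreg, hregb, hf, hi⟩
      push_cast at hj hreg hi
      refine ⟨?_, ?_⟩
      · rw [Expr.eval_lt, Expr.eval_reg, Expr.eval_reg, hreg, hregb, if_pos (by omega)]
        exact one_ne_zero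
      · have h := hstep (H - (j + 1)) s' (by omega) (by omega) hb hreg hf hi
        have h' : Ok Q G body s' fun s'' => (j : ℤ) ≤ H - A ∧ s''.reg r = H - j ∧
            s''.reg rb = H ∧ Frame (r :: p.regs) p.arrs s s'' ∧ inv (H - j) s'' := by
          refine Ok.seq hQ h fun s'' hb'' hf'' hi'' => ?_
          have e1 : (Expr.reg r + 1).eval s'' = H - j := by
            rw [Expr.eval_add, Expr.eval_reg, hf''.1 r hr, hreg]
            show H - (j + 1) + 1 = H - (j : ℤ)
            ring
          refine Ok.setReg hQ hb'' ?_ ?_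
          · rw [e1, abs_le]
            rw [abs_le] at hQA hHQ
            constructor <;> omega
          · rw [e1]
            refine ⟨by omega, by simp, ?_, ?_, ?_⟩
            · rw [State.setReg_reg, if_neg hne, hf''.1 rb hrb, hregb]
            · exact (hf.trans (hf''.mono (List.subset_cons_self _ _) (List.Subset.refl _))).trans
                (Frame.setReg _ _ _ _ _ (by simp))
            · apply hstab
              convert hi'' using 1
              ring
        exact h')
    (H - A).toNat (s.setReg r A) (hs.setReg r hQA)
    (by
      have : ((H - A).toNat : ℤ) = H - A := Int.toNat_of_nonneg (by omega)
      rw [this]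
      refine ⟨le_rfl, by simp, by rw [State.setReg_reg, if_neg hne, hH],
        Frame.setReg _ _ _ _ _ (by simp), hstab _ _ _ ?_⟩
      convert h0 using 1; ring)
  have hf := hinv.2.2.2.1
  have hi : inv H s' := by simpa using hinv.2.2.2.2
  refine ⟨_, s', .seq (s' := s.setReg r A) (t := a.cost + 1) ?_
    (hrun.mono (Nat.pow_le_pow_right (by omega) (le_max_right _ _))), ?_, hb, hpost s' hb hf hi⟩
  · rw [← hA]
    exact .setReg s r a (a.fits_of_bdd hQ hs hl
      (Nat.pow_le_pow_right (by omega) (le_max_left _ _)))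
  · simp only [Program.forLoop, Program.time]
    refine add_le_add le_rfl (ht.trans (Nat.mul_le_mul (by omega) le_rfl))

end WordRAM

open Finset Pointwise

namespace WordRAM

/-! ### Tables of multiplicity vectors

A table is a pair of arrays: `val` holds, for each code `z`, one plus the least cost of a vector with
code `z` (or zero if there is none), and `sol` holds such a vector at the addresses `z * O + o`. -/

def code (O : ℕ) (g : ℕ → ℤ) (x : ℕ → ℕ) : ℤ := ∑ o ∈ range O, (x o : ℤ) * g o

def cost (O : ℕ) (w : ℕ → ℕ) (x : ℕ → ℕ) : ℕ := ∑ o ∈ range O, x o * w o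

theorem code_add (O : ℕ) (g : ℕ → ℤ) (x y : ℕ → ℕ) :
    code O g (x + y) = code O g x + code O g y := by
  simp [code, add_mul, sum_add_distrib]

theorem cost_add (O : ℕ) (w : ℕ → ℕ) (x y : ℕ → ℕ) :
    cost O w (x + y) = cost O w x + cost O w y := by
  simp [cost, add_mul, sum_add_distrib]

/-- The table `(val, sol)` represents the set `S`. -/
def Rep (O : ℕ) (g : ℕ → ℤ) (w : ℕ → ℕ) (R : ℕ) (val sol : ℤ → ℤ) (S : Set (ℕ → ℕ)) : Prop :=
  (∀ z, |z| ≤ (R : ℤ) → val z ≠ 0 → ∃ x ∈ S, code O g x = z ∧ (cost O w x : ℤ) + 1 = val z ∧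
    ∀ o < O, sol (z * O + (o : ℕ)) = x o) ∧
  ∀ x ∈ S, |code O g x| ≤ (R : ℤ) ∧ val (code O g x) ≠ 0 ∧
    val (code O g x) ≤ (cost O w x : ℤ) + 1

section Rep
variable {O : ℕ} {g : ℕ → ℤ} {w : ℕ → ℕ} {R : ℕ} {val sol val' sol' : ℤ → ℤ}
  {S S' : Set (ℕ → ℕ)}

theorem Rep.congr (h : Rep O g w R val sol S) (hval : ∀ z, |z| ≤ (R : ℤ) → val' z = val z)
    (hsol : ∀ z, |z| ≤ (R : ℤ) → ∀ o < O, sol' (z * O + (o : ℕ)) = sol (z * O + (o : ℕ))) :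
    Rep O g w R val' sol' S := by
  refine ⟨fun z hz hv => ?_, fun x hx => ?_⟩
  · rw [hval z hz] at hv ⊢
    obtain ⟨x, hx, h1, h2, h3⟩ := h.1 z hz hv
    exact ⟨x, hx, h1, h2, fun o ho => (hsol z hz o ho).trans (h3 o ho)⟩
  · obtain ⟨h1, h2⟩ := h.2 x hx
    rw [hval _ h1]
    exact ⟨h1, h2⟩

theorem Rep.empty (h : ∀ z, |z| ≤ (R : ℤ) → val z = 0) : Rep O g w R val sol ∅ :=
  ⟨fun z hz hv => absurd (h z hz) hv, fun _ hx => hx.elim⟩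

/-- The vectors of `S'` all have the code `z` and at least the cost of `x ∈ S'`. -/
def Dominates (O : ℕ) (g : ℕ → ℤ) (w : ℕ → ℕ) (S' : Set (ℕ → ℕ)) (x : ℕ → ℕ) : Prop :=
  x ∈ S' ∧ ∀ y ∈ S', code O g y = code O g x ∧ cost O w x ≤ cost O w y

/-- This and `Rep.union_of_lt` are the two outcomes of an insertion. A whole set of vectors with one
common code is absorbed by offering only its cheapest member x: either the table already has
something as cheap, or x replaces the entry. -/
theorem Rep.union_of_le (h : Rep O g w R val sol S) {x : ℕ → ℕ} (hx : Dominates O g w S' x)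
    (hR : |code O g x| ≤ (R : ℤ)) (h0 : val (code O g x) ≠ 0)
    (hle : val (code O g x) ≤ cost O w x + 1) : Rep O g w R val sol (S ∪ S') := by
  refine ⟨fun z hz hv => ?_, ?_⟩
  · obtain ⟨y, hy, h'⟩ := h.1 z hz hv
    exact ⟨y, Or.inl hy, h'⟩
  · rintro y (hy | hy)
    · exact h.2 y hy
    · obtain ⟨h1, h2⟩ := hx.2 y hy
      rw [h1]
      exact ⟨hR, h0, hle.trans (by exact_mod_cast Nat.succ_le_succ h2)⟩

theorem Rep.union_of_lt (h : Rep O g w R val sol S) {x : ℕ → ℕ} (hx : Dominates O g w S' x)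
    (hR : |code O g x| ≤ (R : ℤ))
    (hlt : val (code O g x) = 0 ∨ (cost O w x : ℤ) + 1 < val (code O g x))
    (hval : val' = Function.update val (code O g x) (cost O w x + 1))
    (hsol : ∀ o < O, sol' (code O g x * O + (o : ℕ)) = x o)
    (hsol' : ∀ z, z ≠ code O g x → ∀ o < O, sol' (z * O + (o : ℕ)) = sol (z * O + (o : ℕ))) :
    Rep O g w R val' sol' (S ∪ S') := by
  subst hval
  refine ⟨fun z hz hv => ?_, ?_⟩
  · by_cases hzx : z = code O g x
    · subst hzx
      exact ⟨x, Or.inr hx.1, rfl, by simp, hsol⟩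
    · rw [Function.update_of_ne hzx] at hv ⊢
      obtain ⟨y, hy, h1, h2, h3⟩ := h.1 z hz hv
      exact ⟨y, Or.inl hy, h1, h2, fun o ho => (hsol' z hzx o ho).trans (h3 o ho)⟩
  · rintro y (hy | hy)
    · obtain ⟨h1, h2, h3⟩ := h.2 y hy
      refine ⟨h1, ?_⟩
      by_cases hyx : code O g y = code O g x
      · rw [hyx, Function.update_self]
        rw [hyx] at h2 h3
        have := hlt.resolve_left h2
        exact ⟨by omega, by omega⟩
      · rw [Function.update_of_ne hyx]
        exact ⟨h2, h3⟩
    · obtain ⟨h1, h2⟩ := hx.2 y hy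
      rw [h1, Function.update_self]
      exact ⟨hR, by omega, by omega⟩

end Rep

/-! ### Table operations

Registers `6`, `9`, `10` hold the number `O` of options, the code bound `R`, and `R + 1`. -/

/-- Store the values of `e`, as register `34` runs through the options, in the row of the code in
register `rz`. -/
def storeRow (rz sc : ℕ) (e : Expr) : Program :=
  .forLoop 34 0 6 (.setCell sc (.reg rz * .reg 6 + .reg 34) e)

/-- Euclidean division recovers the row from the address also for negative codes z, which do occur;
arrays are indexed by all integers. -/
theorem row_address_injective {O : ℕ} {z z' : ℤ} {o o' : ℕ} (ho : o < O) (ho' : o' < O)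
    (h : z * O + (o : ℤ) = z' * O + (o' : ℤ)) : z = z' ∧ o = o' := by
  have hO : (O : ℤ) ≠ 0 := by omega
  have key : ∀ (z : ℤ) (o : ℕ), o < O → (z * O + (o : ℤ)) / O = z := fun z o ho => by
    rw [Int.add_comm, Int.add_mul_ediv_right _ _ hO,
      Int.ediv_eq_zero_of_lt (by omega) (by exact_mod_cast ho), zero_add]
  have h1 : z = z' := by rw [← key z o ho, ← key z' o' ho', h]
  subst h1
  exact ⟨rfl, by omega⟩

variable {Q G O R : ℕ} {g : ℕ → ℤ} {w : ℕ → ℕ} {s : State}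

theorem ok_storeRow (hQ : 16 ≤ Q) (hs : s.Bdd Q) (hO : s.reg 6 = O) (hOG : O ≤ G)
    {rz sc : ℕ} {e : Expr} (hrz : rz ≠ 34) {z : ℤ} (hz : s.reg rz = z) (hl : e.smallLits)
    (x : ℕ → ℤ) (hx : ∀ o < O, |x o| ≤ (Q : ℤ))
    (he : ∀ s' (o : ℕ), Frame [34] [sc] s s' → s'.reg 34 = o → o < O → e.eval s' = x o) :
    Ok Q G (storeRow rz sc e) s fun s' => (∀ o < O, s'.arr sc (z * O + (o : ℕ)) = x o) ∧
      ∀ z', z' ≠ z → ∀ o < O, s'.arr sc (z' * O + (o : ℕ)) = s.arr sc (z' * O + (o : ℕ)) := by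
  refine Ok.forLoop hQ (fun i s' => (∀ o < O, (o : ℤ) < i → s'.arr sc (z * O + (o : ℕ)) = x o) ∧
      ∀ z', z' ≠ z → ∀ o < O, s'.arr sc (z' * O + (o : ℕ)) = s.arr sc (z' * O + (o : ℕ)))
    (A := 0) hs rfl hO (by simp) (by simpa using hOG) (by simp) (fun _ _ _ h => h)
    ⟨fun o _ h => by omega, fun _ _ _ _ => rfl⟩ ?_ ?_
  · rintro i s' hi hiH hs' hreg hf ⟨h1, h2⟩
    lift i to ℕ using hi
    have hi : i < O := by exact_mod_cast hiH
    have hf' : Frame [34] [sc] s s' := hf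
    have hv := he s' i hf' hreg hi
    refine Ok.setCell hQ hs' (by rw [hv]; exact hx i hi) ?_ rfl hl
    have ha : (Expr.reg rz * Expr.reg 6 + Expr.reg 34).eval s' = z * O + (i : ℕ) := by
      simp only [Expr.eval_add, Expr.eval_mul, Expr.eval_reg, hreg, hf'.reg 6, hO]
      rw [hf'.1 rz (by simpa using hrz), hz]
    rw [hv, ha]
    refine ⟨fun o ho hoi => ?_, fun z' hz' o ho => ?_⟩
    · by_cases h : o = i
      · subst h; simp
      · rw [State.setCell_arr, if_pos rfl, Function.update_of_ne]
        · exact h1 o ho (by omega)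
        · exact fun h' => h (row_address_injective ho hi h').2
    · rw [State.setCell_arr, if_pos rfl, Function.update_of_ne]
      · exact h2 z' hz' o ho
      · exact fun h' => hz' (row_address_injective ho hi h').1
  · rintro s' - - ⟨h1, h2⟩
    exact ⟨fun o ho => h1 o ho (by exact_mod_cast ho), h2⟩

/-- Enter the vector given by `e`, with the code in register `32` and the value in register `33`,
into a table unless the table has one that is at least as good. -/
def insert (vc sc : ℕ) (e : Expr) : Program :=
  .cond (.bin .eq (.cell vc (.reg 32)) 0 + .bin .lt (.reg 33) (.cell vc (.reg 32)))
    (.setCell vc (.reg 32) (.reg 33) ;; storeRow 32 sc e) .skip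

theorem ok_insert (hQ : 16 ≤ Q) (hs : s.Bdd Q) (hO : s.reg 6 = O) (hOG : O ≤ G)
    {vc sc : ℕ} (hvs : vc ≠ sc) {e : Expr} (hl : e.smallLits) {S S' : Set (ℕ → ℕ)} {x : ℕ → ℕ}
    (hz : s.reg 32 = code O g x) (hR : |code O g x| ≤ (R : ℤ)) (hv : s.reg 33 = cost O w x + 1)
    (hx : ∀ o < O, x o ≤ Q)
    (he : ∀ s' (o : ℕ), Frame [34] [vc, sc] s s' → s'.reg 34 = o → o < O → e.eval s' = x o)
    (hrep : Rep O g w R (s.arr vc) (s.arr sc) S) (hdom : Dominates O g w S' x) :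
    Ok Q G (insert vc sc e) s fun s' => Rep O g w R (s'.arr vc) (s'.arr sc) (S ∪ S') := by
  -- The tested sum of two truth values is nonzero exactly if the entry is empty (value 0) or
  -- strictly more expensive than the new vector.
  refine Ok.cond hQ hs (fun h => ?_) fun h => ?_
  · have hlt : s.arr vc (code O g x) = 0 ∨ (cost O w x : ℤ) + 1 < s.arr vc (code O g x) := by
      by_contra hcon
      push Not at hcon
      refine h ?_
      simp [hz, hv, hcon.1, not_lt.2 hcon.2]
    refine Ok.seq hQ (mid := fun s' => s' = s.setCell vc (s.reg 32) (s.reg 33))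
      (Ok.setCell hQ hs (hs.1 33) rfl) ?_
    rintro s' hs' - rfl
    refine (ok_storeRow hQ hs' hO hOG (by norm_num) hz hl (fun o => (x o : ℤ)) (fun o ho => ?_)
      fun s' o hf ho hoO => ?_).frame.imp ?_
    · rw [Nat.abs_cast]; exact_mod_cast hx o ho
    · refine he s' o ⟨fun r hr => hf.1 r hr, fun a ha => ?_⟩ ho hoO
      simp only [List.mem_cons, List.not_mem_nil, or_false, not_or] at ha
      rw [hf.2 a (by simpa using ha.2), State.setCell_arr, if_neg ha.1]
    · rintro s' - ⟨hf, h1, h2⟩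
      have hval : s'.arr vc =
          Function.update (s.arr vc) (code O g x) ((cost O w x : ℤ) + 1) := by
        rw [hf.2 vc (by simpa [storeRow, Program.forLoop, Program.arrs] using hvs),
          State.setCell_arr, if_pos rfl, hz, hv]
      refine hrep.union_of_lt hdom hR hlt hval h1 fun z hz' o ho => ?_
      rw [h2 z hz' o ho, State.setCell_arr, if_neg hvs.symm]
  · simp only [Expr.eval_add, Expr.eval_eq, Expr.eval_lt, Expr.eval_cell, Expr.eval_reg, hz, hv,
      Expr.eval_zero] at h
    refine Ok.skip hs (hrep.union_of_le hdom hR ?_ ?_)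
    · intro h0; simp only [h0, if_true] at h; split_ifs at h <;> omega
    · by_contra hcon
      rw [if_pos (not_le.1 hcon)] at h; split_ifs at h <;> omega

/-- Clear the values of a table. -/
def clear (vc : ℕ) : Program :=
  .forLoop 30 (0 - .reg 9) 10 (.setCell vc (.reg 30) 0)

/-- The registers that the table operations rely on. -/
structure TableRegs (O R : ℕ) (s : State) : Prop where
  options : s.reg 6 = O
  bound : s.reg 9 = R
  succ_bound : s.reg 10 = R + 1

theorem TableRegs.of_frame {rs as : List ℕ} {s' : State} (h : TableRegs O R s)
    (hf : Frame rs as s s') (h6 : rs.contains 6 = false := by rfl)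
    (h9 : rs.contains 9 = false := by rfl) (h10 : rs.contains 10 = false := by rfl) :
    TableRegs O R s' :=
  ⟨(hf.reg 6 h6).trans h.options, (hf.reg 9 h9).trans h.bound,
    (hf.reg 10 h10).trans h.succ_bound⟩

/-- A loop over all codes. -/
theorem ok_codeLoop (hQ : 16 ≤ Q) (hs : s.Bdd Q) (ht : TableRegs O R s) (hRG : 2 * R + 1 ≤ G)
    {r : ℕ} {p : Program} {post : State → Prop} (inv : ℤ → State → Prop)
    (hstab : ∀ i s v, inv i s → inv i (s.setReg r v)) (h0 : inv (-R) s)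
    (hstep : ∀ z s', |z| ≤ (R : ℤ) → s'.Bdd Q → s'.reg r = z →
      Frame (r :: p.regs) p.arrs s s' → inv z s' → Ok Q G p s' (inv (z + 1)))
    (hpost : ∀ s', s'.Bdd Q → Frame (r :: p.regs) p.arrs s s' → inv (R + 1) s' → post s')
    (hr : p.regs.contains r = false := by rfl)
    (hrb : p.regs.contains 10 = false := by rfl) (hne : (10 == r) = false := by rfl) :
    Ok Q G (.forLoop r (0 - .reg 9) 10 p) s post := by
  have hRQ : |(-R : ℤ)| ≤ (Q : ℤ) := by rw [abs_neg, ← ht.bound]; exact hs.1 9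
  refine Ok.forLoop hQ inv (A := -R) (H := R + 1) hs (by simp [ht.bound]) ht.succ_bound (by omega)
    (by omega) hRQ hstab h0 ?_ hpost rfl hr hrb hne
  intro i s' h1 h2
  exact hstep i s' (abs_le.2 ⟨h1, by omega⟩)

theorem ok_clear (hQ : 16 ≤ Q) (hs : s.Bdd Q) (ht : TableRegs O R s) (hRG : 2 * R + 1 ≤ G)
    (vc sc : ℕ) : Ok Q G (clear vc) s fun s' => Rep O g w R (s'.arr vc) (s'.arr sc) ∅ := by
  refine ok_codeLoop hQ hs ht hRG (fun i s' => ∀ z, -(R : ℤ) ≤ z → z < i → s'.arr vc z = 0)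
    (fun _ _ _ h => h) (fun z h h' => by omega) ?_ ?_
  · intro i s' hi hs' hreg hf h
    refine Ok.setCell hQ hs' (by simp) fun z hz hz' => ?_
    simp only [State.setCell_arr, if_true, Expr.eval_reg, hreg, Function.update_apply]
    split_ifs with hzi
    · rfl
    · exact h z hz (by omega)
  · intro s' _ _ h
    exact .empty fun z hz => h z (abs_le.1 hz).1 (by have := (abs_le.1 hz).2; omega)

/-- Copy table `(12, 13)` to table `(8, 9)`. -/
def copyBack : Program :=
  .forLoop 30 (0 - .reg 9) 10 (.setCell 8 (.reg 30) (.cell 12 (.reg 30)) ;;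
    storeRow 30 9 (.cell 13 (.reg 30 * .reg 6 + .reg 34)))

theorem ok_copyBack (hQ : 16 ≤ Q) (hs : s.Bdd Q) (ht : TableRegs O R s) (hRG : 2 * R + 1 ≤ G)
    (hOG : O ≤ G) {S : Set (ℕ → ℕ)} (hrep : Rep O g w R (s.arr 12) (s.arr 13) S) :
    Ok Q G copyBack s fun s' => Rep O g w R (s'.arr 8) (s'.arr 9) S := by
  refine ok_codeLoop hQ hs ht hRG (fun i s' => ∀ z, -(R : ℤ) ≤ z → z < i →
      s'.arr 8 z = s.arr 12 z ∧
        ∀ o < O, s'.arr 9 (z * O + (o : ℕ)) = s.arr 13 (z * O + (o : ℕ)))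
    (fun _ _ _ h => h) (fun z h h' => by omega) ?_ ?_
  · intro i s' hi hs' hreg hf h
    refine Ok.seq hQ (mid := fun s'' => s'' = s'.setCell 8 i (s.arr 12 i))
      (Ok.setCell hQ hs' (hs'.2 _ _) ?_) ?_
    · simp [hreg, hf.arr 12]
    rintro s'' hs'' - rfl
    refine (ok_storeRow hQ hs'' ((hf.reg 6).trans ht.options) hOG (by norm_num)
      (show _ = i from hreg) rfl (fun o => s.arr 13 (i * O + (o : ℕ))) (fun o _ => hs.2 _ _)
      fun s3 o hf3 ho hoO => ?_).frame.imp ?_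
    · simp only [Expr.eval_cell, Expr.eval_add, Expr.eval_mul, Expr.eval_reg, ho, hf3.reg 30,
        hf3.reg 6, State.setCell_reg, hreg, hf.reg 6, ht.options, hf3.arr 13]
      simp [hf.arr 13]
    · rintro s3 - ⟨hf3, h1, h2⟩ z hz hz'
      have h8 : s3.arr 8 = Function.update (s'.arr 8) i (s.arr 12 i) := by
        rw [hf3.arr 8]; simp
      by_cases hzi : z = i
      · subst hzi
        exact ⟨by simp [h8], h1⟩
      · obtain ⟨h3, h4⟩ := h z hz (by omega)
        refine ⟨by rw [h8, Function.update_of_ne hzi, h3], fun o ho => ?_⟩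
        rw [h2 z hzi o ho, ← h4 o ho]
        simp
  · intro s' _ _ h
    have h' : ∀ z : ℤ, |z| ≤ (R : ℤ) → -(R : ℤ) ≤ z ∧ z < R + 1 := fun z hz => by
      rw [abs_le] at hz; omega
    exact hrep.congr (fun z hz => (h z (h' z hz).1 (h' z hz).2).1)
      fun z hz => (h z (h' z hz).1 (h' z hz).2).2

/-- Add the sets represented by the tables `(8, 9)` and `(vb, sb)` into table `(12, 13)`, then copy
the result to `(8, 9)`. -/
def convolve (vb sb : ℕ) : Program :=
  clear 12 ;;
  .forLoop 30 (0 - .reg 9) 10 (.forLoop 31 (0 - .reg 9) 10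
    (.cond (.cell 8 (.reg 30) * .cell vb (.reg 31))
      (.setReg 32 (.reg 30 + .reg 31) ;;
        .setReg 33 (.cell 8 (.reg 30) + .cell vb (.reg 31) - 1) ;;
        insert 12 13 (.cell 9 (.reg 30 * .reg 6 + .reg 34) +
          .cell sb (.reg 31 * .reg 6 + .reg 34)))
      .skip)) ;;
  copyBack

/-- The members of `S` with a code that satisfies `P`. -/
def withCode (O : ℕ) (g : ℕ → ℤ) (P : ℤ → Prop) (S : Set (ℕ → ℕ)) : Set (ℕ → ℕ) :=
  {x ∈ S | P (code O g x)}

/-- Codes and costs are additive, so for each pair of codes the sum of the two stored vectors is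
cheapest among all sums with these codes. The result is built in table (12, 13) because (8, 9) is
still being read; the second operand may be (8, 9) itself, which is how a set is added to itself. -/
theorem ok_convolve (hQ : 16 ≤ Q) (hs : s.Bdd Q) (ht : TableRegs O R s) (hRG : 2 * R + 1 ≤ G)
    (hOG : O ≤ G) {vb sb : ℕ} (hvb : vb ≠ 12 ∧ vb ≠ 13) (hsb : sb ≠ 12 ∧ sb ≠ 13)
    {S T : Set (ℕ → ℕ)} (hA : Rep O g w R (s.arr 8) (s.arr 9) S)
    (hB : Rep O g w R (s.arr vb) (s.arr sb) T)
    (hST : ∀ x ∈ S + T, |code O g x| ≤ (R : ℤ) ∧ cost O w x + 1 ≤ Q ∧ ∀ o < O, x o ≤ Q)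
    (hRQ : R ≤ Q) :
    Ok Q G (convolve vb sb) s fun s' => Rep O g w R (s'.arr 8) (s'.arr 9) (S + T) := by
  refine Ok.seq hQ (ok_clear (g := g) (w := w) hQ hs ht hRG 12 13) fun s0 hs0 hf0 hC0 => ?_
  have ht0 : TableRegs O R s0 := ht.of_frame hf0
  have hA0 : Rep O g w R (s0.arr 8) (s0.arr 9) S := by rwa [hf0.arr 8, hf0.arr 9]
  have hB0 : Rep O g w R (s0.arr vb) (s0.arr sb) T := by
    rwa [hf0.2 vb (by simpa [clear, Program.forLoop, Program.arrs] using hvb.1),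
      hf0.2 sb (by simpa [clear, Program.forLoop, Program.arrs] using hsb.1)]
  refine Ok.seq hQ (mid := fun s' => Rep O g w R (s'.arr 12) (s'.arr 13) (S + T)) ?_
    fun s1 hs1 hf1 hC1 => ok_copyBack hQ hs1 (ht0.of_frame hf1) hRG hOG hC1
  -- Invariant of the outer loop: all sums whose first summand has a code below i are represented.
  -- It starts with the empty set, since no code is below -R.
  refine ok_codeLoop hQ hs0 ht0 hRG
    (fun i s' => Rep O g w R (s'.arr 12) (s'.arr 13) (withCode O g (· < i) S + T))
    (fun _ _ _ h => h) ?_ ?_ ?_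
  · have : withCode O g (· < -(R : ℤ)) S = ∅ := by
      ext x
      simp only [withCode, Set.mem_ofPred_eq, Set.mem_empty_iff_false, iff_false, not_and, not_lt]
      exact fun hx => (abs_le.1 (hA.2 x hx).1).1
    simpa [this] using hC0
  · intro z1 s1 hz1 hs1 hr1 hf1 hC1
    -- Invariant of the inner loop: in addition, the sums with first code z1 and second code below
    -- i.
    refine ok_codeLoop hQ hs1 (ht0.of_frame hf1) hRG
      (fun i s' => Rep O g w R (s'.arr 12) (s'.arr 13)
        ((withCode O g (· < z1) S + T) ∪ (withCode O g (· = z1) S + withCode O g (· < i) T)))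
      (fun _ _ _ h => h) ?_ ?_ ?_
    · have : withCode O g (· < -(R : ℤ)) T = ∅ := by
        ext x
        simp only [withCode, Set.mem_ofPred_eq, Set.mem_empty_iff_false, iff_false, not_and, not_lt]
        exact fun hx => (abs_le.1 (hB.2 x hx).1).1
      simpa [this] using hC1
    · intro z2 s2 hz2 hs2 hr2 hf2 hC2
      have hr1' : s2.reg 30 = z1 := (hf2.reg 30).trans hr1
      have ht2 : TableRegs O R s2 := (ht0.of_frame hf1).of_frame hf2
      have e8 : s2.arr 8 = s0.arr 8 := (hf2.arr 8).trans (hf1.arr 8)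
      have e9 : s2.arr 9 = s0.arr 9 := (hf2.arr 9).trans (hf1.arr 9)
      have hmem : ∀ a : ℕ, a ≠ 12 ∧ a ≠ 13 → s2.arr a = s0.arr a := fun a ha => by
        have : a ∉ [12, 13] := by simpa using ha
        exact (hf2.2 a (by simpa [insert, storeRow, Program.forLoop, Program.arrs] using this)).trans
          (hf1.2 a (by simpa [insert, storeRow, Program.forLoop, Program.arrs] using this))
      have evb := hmem vb hvb
      have esb := hmem sb hsb
      have hsplit : withCode O g (· = z1) S + withCode O g (· < z2 + 1) T =
          (withCode O g (· = z1) S + withCode O g (· < z2) T) ∪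
          (withCode O g (· = z1) S + withCode O g (· = z2) T) := by
        rw [← Set.add_union]
        congr 1
        ext x
        simp only [withCode, Set.mem_ofPred_eq, Set.mem_union, Int.lt_add_one_iff, le_iff_lt_or_eq]
        tauto
      rw [hsplit, ← Set.union_assoc]
      refine Ok.cond hQ hs2 (fun h => ?_) fun h => ?_
      · simp only [Expr.eval_mul, Expr.eval_cell, Expr.eval_reg, hr1', hr2, e8, evb, ne_eq,
          mul_eq_zero, not_or] at h
        obtain ⟨x, hx, hcx, hvx, hsx⟩ := hA0.1 z1 hz1 h.1
        obtain ⟨y, hy, hcy, hvy, hsy⟩ := hB0.1 z2 hz2 h.2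
        obtain ⟨hxy1, hxy2, hxy3⟩ := hST (x + y) (Set.add_mem_add hx hy)
        have hcode : z1 + z2 = code O g (x + y) := by rw [code_add, hcx, hcy]
        have hcost : s0.arr 8 z1 + s0.arr vb z2 - 1 = (cost O w (x + y) : ℤ) + 1 := by
          rw [cost_add, ← hvx, ← hvy]; push_cast; ring
        -- The pair (z1, z2) contributes one code only, and the costs are minimised separately in
        -- the two summands.
        have hdom : Dominates O g w (withCode O g (· = z1) S + withCode O g (· = z2) T)
            (x + y) := by
          refine ⟨Set.add_mem_add ⟨hx, hcx⟩ ⟨hy, hcy⟩, ?_⟩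
          rintro _ ⟨x', ⟨hx', hcx'⟩, y', ⟨hy', hcy'⟩, rfl⟩
          refine ⟨by simp only [code_add]; rw [hcx', hcy', hcx, hcy], ?_⟩
          have h1 := (hA0.2 x' hx').2.2
          have h2 := (hB0.2 y' hy').2.2
          rw [hcx'] at h1
          rw [hcy'] at h2
          simp only [cost_add]
          omega
        refine Ok.seq hQ (mid := fun s' => s' = s2.setReg 32 (code O g (x + y)))
          (Ok.setReg hQ hs2 ?_ ?_) ?_
        · simp only [Expr.eval_add, Expr.eval_reg, hr1', hr2, hcode]
          exact hxy1.trans (by exact_mod_cast hRQ)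
        · simp only [Expr.eval_add, Expr.eval_reg, hr1', hr2, hcode]
        rintro s3 hs3 - rfl
        have hev : (Expr.cell 8 (.reg 30) + .cell vb (.reg 31) - 1).eval
            (s2.setReg 32 (code O g (x + y))) = (cost O w (x + y) : ℤ) + 1 := by
          simp [hr1', hr2, e8, evb, ← hcost]
        refine Ok.seq hQ
          (mid := fun s' => s' = (s2.setReg 32 (code O g (x + y))).setReg 33
            ((cost O w (x + y) : ℤ) + 1)) (Ok.setReg hQ hs3 ?_ ?_) ?_
        · rw [hev, abs_of_nonneg (by positivity)]
          exact_mod_cast hxy2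
        · rw [hev]
        rintro s4 hs4 - rfl
        refine ok_insert hQ hs4 (by simpa using ht2.options) hOG (by norm_num) rfl (by simp) hxy1
          (by simp) hxy3 (fun s' o hf ho hoO => ?_) hC2 hdom
        have h9 := hf.arr 9
        have hsb' := hf.2 sb (by simpa using hsb)
        have h30 := hf.reg 30
        have h31 := hf.reg 31
        have h6 := hf.reg 6
        simp only [State.setReg_reg, State.setReg_arr] at h9 hsb' h30 h31 h6
        norm_num at h30 h31 h6
        simp [h9, hsb', h30, h31, h6, ho, hr1', hr2, ht2.options, e9, esb, hsx o hoO, hsy o hoO]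
      · simp only [Expr.eval_mul, Expr.eval_cell, Expr.eval_reg, hr1', hr2, e8, evb,
          mul_eq_zero] at h
        -- A zero product of the two table values means that one summand has no vector with its
        -- code, so this pair contributes nothing.
        have : withCode O g (· = z1) S + withCode O g (· = z2) T = ∅ := by
          rw [Set.eq_empty_iff_forall_notMem]
          rintro _ ⟨x', ⟨hx', hcx'⟩, y', ⟨hy', hcy'⟩, rfl⟩
          rcases h with h | h
          · exact (hA0.2 x' hx').2.1 (hcx' ▸ h)
          · exact (hB0.2 y' hy').2.1 (hcy' ▸ h)
        rw [this, Set.union_empty]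
        exact Ok.skip hs2 hC2
    · intro s2 _ _ hC2
      have h1 : withCode O g (· < (R : ℤ) + 1) T = T := by
        ext x
        simp only [withCode, Set.mem_ofPred_eq, and_iff_left_iff_imp]
        exact fun hx => Int.lt_add_one_of_le (abs_le.1 (hB.2 x hx).1).2
      have h2 : withCode O g (· < z1 + 1) S =
          withCode O g (· < z1) S ∪ withCode O g (· = z1) S := by
        ext x
        simp only [withCode, Set.mem_ofPred_eq, Set.mem_union, Int.lt_add_one_iff, le_iff_lt_or_eq]
        tauto
      rw [h2, Set.union_add]
      rwa [h1] at hC2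
  · intro s1 _ _ hC1
    have h1 : withCode O g (· < (R : ℤ) + 1) S = S := by
      ext x
      simp only [withCode, Set.mem_ofPred_eq, and_iff_left_iff_imp]
      exact fun hx => Int.lt_add_one_of_le (abs_le.1 (hA.2 x hx).1).2
    rwa [h1] at hC1

end WordRAM

namespace WordRAM

/-! ### Multiplicity vectors with prescribed class sums -/

/-- The sum of `x` over the options of class `τ`. -/
def classSum (O : ℕ) (ty : ℕ → ℕ) (x : ℕ → ℕ) (τ : ℕ) : ℕ :=
  ∑ o ∈ range O, if ty o = τ then x o else 0

/-- The vectors supported on the options `o < O` with class sums `m`. -/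
def withSums (O : ℕ) (ty : ℕ → ℕ) (m : ℕ → ℕ) : Set (ℕ → ℕ) :=
  {x | (∀ o, O ≤ o → x o = 0) ∧ ∀ τ, classSum O ty x τ = m τ}

section Classes
variable {O : ℕ} {ty : ℕ → ℕ} {m m' : ℕ → ℕ} {x y : ℕ → ℕ}

theorem classSum_add (τ : ℕ) :
    classSum O ty (x + y) τ = classSum O ty x τ + classSum O ty y τ := by
  simp only [classSum, ← sum_add_distrib]
  refine sum_congr rfl fun o _ => ?_
  split_ifs <;> simp

theorem add_mem_withSums (hx : x ∈ withSums O ty m) (hy : y ∈ withSums O ty m') :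
    x + y ∈ withSums O ty (m + m') :=
  ⟨fun o ho => by simp [hx.1 o ho, hy.1 o ho],
    fun τ => by rw [classSum_add, hx.2, hy.2, Pi.add_apply]⟩

theorem le_of_mem_withSums (hx : x ∈ withSums O ty m) {o : ℕ} (ho : o < O) : x o ≤ m (ty o) := by
  rw [← hx.2]
  have := single_le_sum (f := fun o' => if ty o' = ty o then x o' else 0) (fun _ _ => Nat.zero_le _)
    (mem_range.2 ho)
  simpa [classSum] using this

theorem withSums_zero : withSums O ty 0 = {0} := by
  ext x
  constructor
  · intro hx
    funext o
    by_cases ho : o < O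
    · exact Nat.le_zero.1 (le_of_mem_withSums hx ho)
    · exact hx.1 o (not_lt.1 ho)
  · rintro rfl
    exact ⟨fun _ _ => rfl, fun τ => by simp [classSum]⟩

theorem single_mem_withSums {o : ℕ} (ho : o < O) :
    Pi.single o 1 ∈ withSums O ty (Pi.single (ty o) 1) := by
  refine ⟨fun o' ho' => Pi.single_eq_of_ne (by omega) 1, fun τ => ?_⟩
  rw [classSum, sum_eq_single_of_mem o (mem_range.2 ho) fun o' _ h => by
    simp [Pi.single_eq_of_ne h]]
  by_cases h : ty o = τ
  · subst h; simp
  · simp [h]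

theorem exists_pos_of_mem_withSums (hx : x ∈ withSums O ty m) {τ : ℕ} (hτ : 0 < m τ) :
    ∃ o < O, ty o = τ ∧ 0 < x o := by
  by_contra hcon
  push Not at hcon
  rw [← hx.2 τ] at hτ
  refine hτ.ne' (sum_eq_zero fun o ho => ?_)
  split_ifs with h
  · exact Nat.le_zero.1 (hcon o (mem_range.1 ho) h)
  · rfl

theorem sub_single_mem_withSums (hx : x ∈ withSums O ty m) {o : ℕ} (ho : o < O) (h0 : 0 < x o) :
    x = (x - Pi.single o 1) + Pi.single o 1 ∧
      x - Pi.single o 1 ∈ withSums O ty (m - Pi.single (ty o) 1) := by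
  have h : x = (x - Pi.single o 1) + Pi.single o 1 := by
    refine (tsub_add_cancel_of_le fun o' => ?_).symm
    by_cases h : o' = o
    · subst h; simpa using Nat.succ_le_of_lt h0
    · simp [Pi.single_eq_of_ne h]
  refine ⟨h, fun o' ho' => by simp [hx.1 o' ho'], fun τ => ?_⟩
  have h1 := hx.2 τ
  rw [h, classSum_add, (single_mem_withSums ho).2] at h1
  simp only [Pi.sub_apply]
  omega

/-- The class options as unit vectors. -/
def singles (O : ℕ) (ty : ℕ → ℕ) (τ : ℕ) : Set (ℕ → ℕ) :=
  {x | ∃ o < O, ty o = τ ∧ x = Pi.single o 1}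

/-- The parities of `m` on the classes below `t`. -/
def parities (m : ℕ → ℕ) (t : ℕ) : ℕ → ℕ := fun τ => if τ < t then m τ % 2 else 0

theorem parities_succ (m : ℕ → ℕ) (t : ℕ) :
    parities m (t + 1) = parities m t + Pi.single t (m t % 2) := by
  funext τ
  simp only [parities, Pi.add_apply]
  rcases lt_trichotomy τ t with h | h | h
  · simp [h, Nat.lt_succ_of_lt h, Pi.single_eq_of_ne h.ne]
  · subst h; simp
  · rw [if_neg (by omega), if_neg (by omega), Pi.single_eq_of_ne h.ne', add_zero]

/-- Class t has sum 1 on the left and sum 0 in the first summand on the right, so exactly one of its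
options is used and can be split off. The parity vectors can thus be added class by class, with one
convolution by unit vectors for each odd class. -/
theorem withSums_parities_succ {t : ℕ} (h : m t % 2 = 1) :
    withSums O ty (parities m (t + 1)) = withSums O ty (parities m t) + singles O ty t := by
  rw [parities_succ, h]
  ext x
  constructor
  · intro hx
    obtain ⟨o, ho, rfl, h0⟩ := exists_pos_of_mem_withSums hx (τ := t) (by simp)
    obtain ⟨h1, h2⟩ := sub_single_mem_withSums hx ho h0
    rw [h1]
    refine Set.add_mem_add ?_ ⟨o, ho, rfl, rfl⟩
    rwa [add_tsub_cancel_right] at h2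
  · rintro ⟨y, hy, _, ⟨o, ho, rfl, rfl⟩, rfl⟩
    exact add_mem_withSums hy (single_mem_withSums ho)

/-- Every vector splits into two almost equal halves and at most one option of each class. -/
theorem exists_halves (hx : x ∈ withSums O ty m) :
    ∃ a ∈ withSums O ty (fun τ => m τ / 2), ∃ b ∈ withSums O ty (fun τ => m τ / 2),
      ∃ u ∈ withSums O ty (fun τ => m τ % 2), x = a + b + u ∧ ∀ o, |(a o : ℤ) - b o| ≤ 1 := by
  classical
  -- Here `classSum o` is the partial sum of the class over the options before o. The functions h
  -- and c are the increments of the partial sums halved with rounding down and up. They telescope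
  -- to the class sums ⌊m/2⌋ and ⌈m/2⌉, they add up to x, and they differ by at most 1 in each
  -- entry.
  set h : ℕ → ℕ := fun o => (classSum o ty x (ty o) + x o) / 2 - classSum o ty x (ty o) / 2 with hh
  set c : ℕ → ℕ := fun o =>
    (classSum o ty x (ty o) + x o + 1) / 2 - (classSum o ty x (ty o) + 1) / 2 with hc
  have key : ∀ n τ, classSum n ty h τ = classSum n ty x τ / 2 ∧
      classSum n ty c τ = (classSum n ty x τ + 1) / 2 := by
    intro n τ
    induction n with
    | zero => simp [classSum]
    | succ n ih =>
      have e : ∀ y : ℕ → ℕ, classSum (n + 1) ty y τ =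
          classSum n ty y τ + if ty n = τ then y n else 0 := fun y => by
        rw [classSum, sum_range_succ]; rfl
      rw [e, e, e, ih.1, ih.2]
      split_ifs with hn
      · subst hn
        simp only [hh, hc]
        omega
      · simp
  have hxo : ∀ o, x o = h o + c o := fun o => by simp only [hh, hc]; omega
  have hho : ∀ o, O ≤ o → h o = 0 := fun o ho => by have := hxo o; have := hx.1 o ho; omega
  have hco : ∀ o, O ≤ o → c o = 0 := fun o ho => by have := hxo o; have := hx.1 o ho; omega
  have hsum : ∀ τ, classSum O ty h τ = m τ / 2 ∧ classSum O ty c τ = (m τ + 1) / 2 := fun τ => by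
    rw [← hx.2 τ]; exact key O τ
  -- In an odd class c has the larger sum, so some option has h < c. A unit is moved from c to u
  -- there, which leaves both halves with the sum ⌊m/2⌋.
  have hex : ∀ τ, m τ % 2 = 1 → ∃ o < O, ty o = τ ∧ h o < c o := by
    intro τ hτ
    by_contra hcon
    push Not at hcon
    have : classSum O ty c τ ≤ classSum O ty h τ := sum_le_sum fun o ho => by
      split_ifs with h'
      · exact hcon o (mem_range.1 ho) h'
      · exact le_rfl
    rw [(hsum τ).1, (hsum τ).2] at this
    omega
  choose! f hf using hex
  set u : ℕ → ℕ := fun o => if m (ty o) % 2 = 1 ∧ o = f (ty o) ∧ o < O then 1 else 0 with hu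
  have huc : ∀ o, u o = 1 → h o < c o := by
    intro o ho
    simp only [hu] at ho
    split_ifs at ho with h'
    obtain ⟨h1, h2, h3⟩ := h'
    have := (hf _ h1).2.2
    rwa [← h2] at this
  have hu1 : ∀ o, u o ≤ 1 := fun o => by simp only [hu]; split_ifs <;> simp
  have hule : u ≤ c := fun o => by
    have h1 := hu1 o
    show u o ≤ c o
    by_cases h0 : u o = 1
    · have := huc o h0; omega
    · omega
  have husum : u ∈ withSums O ty (fun τ => m τ % 2) := by
    refine ⟨fun o ho => by simp only [hu]; rw [if_neg]; omega, fun τ => ?_⟩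
    by_cases hτ : m τ % 2 = 1
    · obtain ⟨h1, h2, h3⟩ := hf τ hτ
      rw [classSum, sum_eq_single_of_mem (f τ) (mem_range.2 h1)]
      · simp [hu, h2, h1, hτ]
      · intro o _ ho
        split_ifs with h'
        · simp only [hu]
          rw [if_neg]
          rintro ⟨-, h4, -⟩
          exact ho (by rw [← h', ← h4])
        · rfl
    · rw [classSum, sum_eq_zero]
      · show 0 = m τ % 2
        omega
      · intro o _
        split_ifs with h'
        · simp only [hu]
          rw [if_neg]
          rintro ⟨h4, -⟩
          exact hτ (h' ▸ h4)
        · rfl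
  refine ⟨h, ⟨hho, fun τ => (hsum τ).1⟩, c - u, ⟨fun o ho => by simp [hco o ho], fun τ => ?_⟩, u,
    husum, ?_, fun o => ?_⟩
  · have h1 : classSum O ty c τ = classSum O ty (c - u) τ + classSum O ty u τ := by
      rw [← classSum_add, tsub_add_cancel_of_le hule]
    rw [(hsum τ).2, husum.2] at h1
    simp only at h1 ⊢
    omega
  · rw [add_assoc, tsub_add_cancel_of_le hule]
    funext o
    exact hxo o
  · have h1 := hu1 o
    have h2 := hule o
    simp only [Pi.sub_apply]
    have h3 : ((c o - u o : ℕ) : ℤ) = c o - u o := by push_cast [h2]; rfl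
    rw [h3, abs_le]
    -- The removed unit cannot spoil the balance: it is taken only where c = h + 1, and there the
    -- entries become equal.
    have h4 : c o ≤ h o + 1 ∧ h o ≤ c o + 1 := by simp only [hh, hc]; omega
    by_cases h0 : u o = 1
    · have := huc o h0; omega
    · omega

end Classes

/-! ### The doubling recursion -/

/-- Vectors with class sums `m` whose value in each of the `k` coordinates is at most `E`. -/
def window (O k E : ℕ) (ty : ℕ → ℕ) (v : ℕ → ℕ → ℤ) (m : ℕ → ℕ) : Set (ℕ → ℕ) :=
  {x ∈ withSums O ty m | ∀ i < k, |code O (v i) x| ≤ (E : ℤ)}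

theorem abs_sum_le {O : ℕ} {D : ℕ} {c : ℕ → ℤ} {f : ℕ → ℤ} (hc : ∀ o < O, |c o| ≤ 1)
    (hf : ∀ o < O, |f o| ≤ (D : ℤ)) : |∑ o ∈ range O, c o * f o| ≤ ((O * D : ℕ) : ℤ) := by
  refine (abs_sum_le_sum_abs _ _).trans ?_
  refine (sum_le_card_nsmul _ _ (D : ℤ) fun o ho => ?_).trans (by simp)
  rw [abs_mul]
  have h1 := hc o (mem_range.1 ho)
  have h2 := hf o (mem_range.1 ho)
  have := mul_le_mul h1 h2 (abs_nonneg _) zero_le_one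
  linarith

/-- Class sums at most 1 force all entries to be 0 or 1. -/
theorem abs_code_parity_le {O D : ℕ} {ty m : ℕ → ℕ} {f : ℕ → ℤ} {u : ℕ → ℕ}
    (hu : u ∈ withSums O ty m) (hm : ∀ τ, m τ ≤ 1) (hf : ∀ o < O, |f o| ≤ (D : ℤ)) :
    |code O f u| ≤ ((O * D : ℕ) : ℤ) := by
  refine abs_sum_le (fun o ho => ?_) hf
  rw [Nat.abs_cast]
  exact_mod_cast (le_of_mem_withSums hu ho).trans (hm _)

/-- The heart of the algorithm. With x = a + b + u from `exists_halves`, twice a is x - u + (a - b),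
whose coordinates are at most E + O·D + O·D ≤ 2E; similarly for b. So the same window works on every
level, and intermediate vectors outside it may be discarded without losing any x. -/
theorem window_eq {O k E D : ℕ} {ty : ℕ → ℕ} {v : ℕ → ℕ → ℤ} (m : ℕ → ℕ)
    (hv : ∀ i < k, ∀ o < O, |v i o| ≤ (D : ℤ)) (hE : 2 * (O * D) ≤ E) :
    window O k E ty v m =
      {x ∈ window O k E ty v (fun τ => m τ / 2) + window O k E ty v (fun τ => m τ / 2) +
        withSums O ty (fun τ => m τ % 2) | ∀ i < k, |code O (v i) x| ≤ (E : ℤ)} := by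
  ext x
  constructor
  · rintro ⟨hx, hxE⟩
    refine ⟨?_, hxE⟩
    obtain ⟨a, ha, b, hb, u, hu, rfl, hab⟩ := exists_halves hx
    have key : ∀ i < k, |code O (v i) a| ≤ (E : ℤ) ∧ |code O (v i) b| ≤ (E : ℤ) := by
      intro i hi
      have h1 : |code O (v i) a - code O (v i) b| ≤ ((O * D : ℕ) : ℤ) := by
        rw [code, code, ← sum_sub_distrib]
        simp_rw [← sub_mul]
        exact abs_sum_le (fun o _ => hab o) (hv i hi)
      have h2 := abs_code_parity_le hu (fun τ => by omega) (hv i hi)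
      have h3 := hxE i hi
      rw [code_add, code_add] at h3
      have h4 : (2 : ℤ) * ((O * D : ℕ) : ℤ) ≤ E := by exact_mod_cast hE
      rw [abs_le] at h1 h2 h3
      constructor <;> rw [abs_le] <;> constructor <;> linarith [h1.1, h1.2, h2.1, h2.2, h3.1, h3.2]
    exact Set.add_mem_add (Set.add_mem_add ⟨ha, fun i hi => (key i hi).1⟩
      ⟨hb, fun i hi => (key i hi).2⟩) hu
  · rintro ⟨⟨_, ⟨a, ha, b, hb, rfl⟩, u, hu, rfl⟩, hE'⟩
    refine ⟨?_, hE'⟩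
    have := add_mem_withSums (add_mem_withSums ha.1 hb.1) hu
    have hm : m = (fun τ => m τ / 2) + (fun τ => m τ / 2) + fun τ => m τ % 2 := by
      funext τ
      simp only [Pi.add_apply]
      omega
    rw [hm]
    exact this

/-! ### Codes -/

theorem code_eq_sum {O k M : ℕ} {v : ℕ → ℕ → ℤ} {g : ℕ → ℤ}
    (hg : ∀ o < O, g o = ∑ i ∈ range k, v i o * (M : ℤ) ^ i) (x : ℕ → ℕ) :
    code O g x = ∑ i ∈ range k, code O (v i) x * (M : ℤ) ^ i := by
  simp only [code, sum_mul]
  rw [sum_comm]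
  refine sum_congr rfl fun o ho => ?_
  rw [hg o (mem_range.1 ho), mul_sum]
  exact sum_congr rfl fun i _ => by ring

/-- The lowest digits are congruent modulo M and differ by at most 6E < M, so they agree; cancel
them and divide by M. -/
theorem digits_unique {M : ℤ} {E : ℤ} (hM : 6 * E < M) (k : ℕ) (u u' : ℕ → ℤ)
    (hu : ∀ i < k, |u i| ≤ 3 * E) (hu' : ∀ i < k, |u' i| ≤ 3 * E)
    (h : ∑ i ∈ range k, u i * M ^ i = ∑ i ∈ range k, u' i * M ^ i) : ∀ i < k, u i = u' i := by
  induction k generalizing u u' with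
  | zero => intro i hi; omega
  | succ k ih =>
    have split : ∀ u : ℕ → ℤ, ∑ i ∈ range (k + 1), u i * M ^ i =
        M * (∑ i ∈ range k, u (i + 1) * M ^ i) + u 0 := fun u => by
      rw [sum_range_succ', mul_sum]
      simp only [pow_zero, mul_one, pow_succ]
      congr 1
      exact sum_congr rfl fun i _ => by ring
    have h0 := hu 0 (by omega)
    have h0' := hu' 0 (by omega)
    rw [abs_le] at h0 h0'
    rw [split, split] at h
    have hM0 : M ≠ 0 := by omega
    have e0 : u 0 = u' 0 := by
      have hd : M ∣ u 0 - u' 0 :=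
        ⟨∑ i ∈ range k, u' (i + 1) * M ^ i - ∑ i ∈ range k, u (i + 1) * M ^ i, by
          rw [mul_sub]; omega⟩
      have := Int.eq_zero_of_abs_lt_dvd hd (by rw [abs_lt]; omega)
      omega
    intro i hi
    cases i with
    | zero => exact e0
    | succ i =>
      refine ih (fun i => u (i + 1)) (fun i => u' (i + 1)) (fun i hi => hu _ (by omega))
        (fun i hi => hu' _ (by omega)) ?_ i (by omega)
      rw [e0] at h
      exact mul_left_cancel₀ hM0 (add_right_cancel h)

/-- Geometric series with ratio M = 8E + 1, for which M - 1 = 8E. It bounds every number with digits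
up to 8E in absolute value by M^k. -/
theorem geom_bound (E k : ℕ) :
    8 * E * ∑ i ∈ range k, (8 * E + 1) ^ i + 1 = (8 * E + 1) ^ k := by
  induction k with
  | zero => simp
  | succ k ih => rw [sum_range_succ, pow_succ, ← ih]; ring

theorem abs_code_le {k E : ℕ} {u : ℕ → ℤ} (hu : ∀ i < k, |u i| ≤ 3 * (E : ℤ)) :
    |∑ i ∈ range k, u i * ((8 * E + 1 : ℕ) : ℤ) ^ i| ≤ (((8 * E + 1) ^ k : ℕ) : ℤ) := by
  calc |∑ i ∈ range k, u i * ((8 * E + 1 : ℕ) : ℤ) ^ i|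
      ≤ ∑ i ∈ range k, |u i * ((8 * E + 1 : ℕ) : ℤ) ^ i| := abs_sum_le_sum_abs _ _
    _ ≤ ∑ i ∈ range k, 3 * (E : ℤ) * ((8 * E + 1 : ℕ) : ℤ) ^ i := by
      refine sum_le_sum fun i hi => ?_
      rw [abs_mul, abs_of_nonneg (by positivity : (0 : ℤ) ≤ ((8 * E + 1 : ℕ) : ℤ) ^ i)]
      exact mul_le_mul_of_nonneg_right (hu i (mem_range.1 hi)) (by positivity)
    _ = ((3 * E * ∑ i ∈ range k, (8 * E + 1) ^ i : ℕ) : ℤ) := by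
      rw [← mul_sum]; push_cast; ring
    _ ≤ _ := by
      rw [← geom_bound]
      have : 3 * E * ∑ i ∈ range k, (8 * E + 1) ^ i ≤ 8 * E * ∑ i ∈ range k, (8 * E + 1) ^ i :=
        Nat.mul_le_mul_right _ (by omega)
      exact_mod_cast Nat.le_succ_of_le this

end WordRAM

namespace WordRAM

/-! ### One level of the doubling recursion on the machine -/

/-- An abstract instance: `O` options in `N` classes with multiplicities `m`; the option `o` has the
cost `w o` and the coordinates `v i o`, `i < k`, which are bounded by `D`. -/
structure Data where
  O : ℕ
  N : ℕ
  k : ℕ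
  D : ℕ
  v : ℕ → ℕ → ℤ
  w : ℕ → ℕ
  ty : ℕ → ℕ
  m : ℕ → ℕ

namespace Data

variable (d : Data)

/-- The smallest window half-width that `window_eq` allows. Two window vectors plus a parity vector
have coordinates up to 3E. The base 8E + 1 exceeds 6E, so codes of such vectors are unique, and
these codes have absolute value at most `R`. -/
def E : ℕ := 2 * (d.O * d.D)
def M : ℕ := 8 * d.E + 1
def R : ℕ := d.M ^ d.k
-- The number all of whose digits are E. Adding it to a code shifts the coordinates in [-E, E] to
-- the ordinary digits 0, …, 2E.
def offset : ℕ := d.E * ∑ i ∈ range d.k, d.M ^ i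
def g (o : ℕ) : ℤ := ∑ i ∈ range d.k, d.v i o * (d.M : ℤ) ^ i

abbrev Represents (s : State) (val sol : ℕ) (S : Set (ℕ → ℕ)) : Prop :=
  Rep d.O d.g d.w d.R (s.arr val) (s.arr sol) S

/-- The machine holds the instance. -/
structure Loaded (s : State) : Prop where
  table : TableRegs d.O d.R s
  reg_k : s.reg 0 = d.k
  reg_E : s.reg 7 = d.E
  reg_M : s.reg 8 = d.M
  reg_N : s.reg 11 = d.N
  reg_offset : s.reg 12 = d.offset
  mult : ∀ τ < d.N, s.arr 3 (τ : ℕ) = d.m τ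
  code : ∀ o < d.O, s.arr 5 (o : ℕ) = d.g o
  cost : ∀ o < d.O, s.arr 6 (o : ℕ) = d.w o
  ty : ∀ o < d.O, s.arr 7 (o : ℕ) = d.ty o

/-- The instance is well-formed, and small enough for the bounds `Q` on values and `G` on
iterations. -/
structure Fits (Q G : ℕ) : Prop where
  le_Q : 16 ≤ Q
  coord : ∀ i < d.k, ∀ o < d.O, |d.v i o| ≤ (d.D : ℤ)
  mult : ∀ τ, d.N ≤ τ → d.m τ = 0
  mult_le : ∀ τ, d.m τ ≤ Q
  cost_le : ∀ x : ℕ → ℕ, (∀ o < d.O, x o ≤ d.m (d.ty o)) → WordRAM.cost d.O d.w x + 1 ≤ Q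
  w_le : ∀ o < d.O, d.w o + 1 ≤ Q
  R_le : 2 * d.R ≤ Q
  le_G : 2 * d.R + 1 ≤ G
  O_le : d.O ≤ G
  N_le : d.N ≤ G
  k_le : d.k ≤ G

variable {d} {Q G : ℕ} {s : State}

theorem Loaded.of_frame {rs as : List ℕ} {s' : State} (h : d.Loaded s) (hf : Frame rs as s s')
    (h0 : rs.contains 0 = false := by rfl) (h6 : rs.contains 6 = false := by rfl)
    (h7 : rs.contains 7 = false := by rfl) (h8 : rs.contains 8 = false := by rfl)
    (h9 : rs.contains 9 = false := by rfl) (h10 : rs.contains 10 = false := by rfl)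
    (h11 : rs.contains 11 = false := by rfl) (h12 : rs.contains 12 = false := by rfl)
    (a3 : as.contains 3 = false := by rfl) (a5 : as.contains 5 = false := by rfl)
    (a6 : as.contains 6 = false := by rfl) (a7 : as.contains 7 = false := by rfl) :
    d.Loaded s' where
  table := h.table.of_frame hf h6 h9 h10
  reg_k := (hf.reg 0 h0).trans h.reg_k
  reg_E := (hf.reg 7 h7).trans h.reg_E
  reg_M := (hf.reg 8 h8).trans h.reg_M
  reg_N := (hf.reg 11 h11).trans h.reg_N
  reg_offset := (hf.reg 12 h12).trans h.reg_offset
  mult := by rw [hf.arr 3 a3]; exact h.mult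
  code := by rw [hf.arr 5 a5]; exact h.code
  cost := by rw [hf.arr 6 a6]; exact h.cost
  ty := by rw [hf.arr 7 a7]; exact h.ty

theorem code_g (x : ℕ → ℕ) :
    WordRAM.code d.O d.g x = ∑ i ∈ range d.k, WordRAM.code d.O (d.v i) x * (d.M : ℤ) ^ i :=
  code_eq_sum (fun _ _ => rfl) x

theorem abs_code_g_le {x : ℕ → ℕ} (hx : ∀ i < d.k, |WordRAM.code d.O (d.v i) x| ≤ 3 * (d.E : ℤ)) :
    |WordRAM.code d.O d.g x| ≤ (d.R : ℤ) := by
  rw [code_g]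
  exact abs_code_le hx

theorem code_single (f : ℕ → ℤ) {O o : ℕ} (ho : o < O) :
    WordRAM.code O f (Pi.single o 1) = f o := by
  rw [WordRAM.code, sum_eq_single_of_mem o (mem_range.2 ho) fun o' _ h => by
    simp [Pi.single_eq_of_ne h]]
  simp

theorem cost_single (f : ℕ → ℕ) {O o : ℕ} (ho : o < O) :
    WordRAM.cost O f (Pi.single o 1) = f o := by
  rw [WordRAM.cost, sum_eq_single_of_mem o (mem_range.2 ho) fun o' _ h => by
    simp [Pi.single_eq_of_ne h]]
  simp

/-- Represent the options of the class in register `35` in table `(10, 11)`. -/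
def fill : Program :=
  clear 10 ;;
  .forLoop 23 0 6 (.cond (.bin .eq (.cell 7 (.reg 23)) (.reg 35))
    (.setReg 32 (.cell 5 (.reg 23)) ;;
      .setReg 33 (.cell 6 (.reg 23) + 1) ;;
      -- The truth value of the equality is the entry of the unit vector of the option in register
      -- 23.
      insert 10 11 (.bin .eq (.reg 34) (.reg 23)))
    .skip)

theorem ok_fill (hd : d.Fits Q G) (hs : s.Bdd Q) (hl : d.Loaded s) {τ : ℕ} (hτ : s.reg 35 = τ) :
    Ok Q G fill s fun s' => d.Represents s' 10 11 (singles d.O d.ty τ) := by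
  have hQ := hd.le_Q
  refine Ok.seq hQ (ok_clear (g := d.g) (w := d.w) hQ hs hl.table hd.le_G 10 11)
    fun s0 hs0 hf0 h0 => ?_
  have hl0 : d.Loaded s0 := hl.of_frame hf0
  refine Ok.forLoop hQ (fun i s' => d.Represents s' 10 11
      {x | ∃ o < d.O, (o : ℤ) < i ∧ d.ty o = τ ∧ x = Pi.single o 1})
    (A := 0) hs0 rfl hl0.table.options (by simp) (by simpa using hd.O_le) (by simp)
    (fun _ _ _ h => h) ?_ ?_ ?_
  · convert h0 using 1
    ext x
    simp only [Set.mem_ofPred_eq, Set.mem_empty_iff_false, iff_false]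
    rintro ⟨o, -, h, -⟩
    omega
  · intro i s1 hi hiO hs1 hr1 hf1 h1
    lift i to ℕ using hi
    have hi : i < d.O := by exact_mod_cast hiO
    have hl1 : d.Loaded s1 := hl0.of_frame hf1
    have hτ1 : s1.reg 35 = τ := (hf1.reg 35).trans ((hf0.reg 35).trans hτ)
    refine Ok.cond hQ hs1 (fun h => ?_) fun h => ?_
    · have hty : d.ty i = τ := by
        simp only [Expr.eval_eq, Expr.eval_cell, Expr.eval_reg, hr1, hτ1, hl1.ty i hi] at h
        by_contra hne
        exact h (if_neg (by exact_mod_cast hne))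
      have hset : {x | ∃ o < d.O, (o : ℤ) < (i : ℤ) + 1 ∧ d.ty o = τ ∧ x = Pi.single o 1} =
          {x | ∃ o < d.O, (o : ℤ) < i ∧ d.ty o = τ ∧ x = Pi.single o 1} ∪
            {(Pi.single i 1 : ℕ → ℕ)} := by
        ext x
        simp only [Set.mem_ofPred_eq, Set.mem_union, Set.mem_singleton_iff]
        constructor
        · rintro ⟨o, ho, ho', h1, h2⟩
          by_cases hoi : o = i
          · subst hoi; exact Or.inr h2
          · exact Or.inl ⟨o, ho, by omega, h1, h2⟩
        · rintro (⟨o, ho, ho', h1, h2⟩ | h2)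
          · exact ⟨o, ho, by omega, h1, h2⟩
          · exact ⟨i, hi, by omega, hty, h2⟩
      rw [hset]
      refine Ok.seq hQ (mid := fun s' => s' = s1.setReg 32 (d.g i))
        (Ok.setReg hQ hs1 (hs1.2 _ _) ?_) ?_
      · simp [hr1, hl1.code i hi]
      rintro s2 hs2 - rfl
      refine Ok.seq hQ (mid := fun s' => s' = (s1.setReg 32 (d.g i)).setReg 33 (d.w i + 1))
        (Ok.setReg hQ hs2 ?_ ?_) ?_
      · simp only [Expr.eval_add, Expr.eval_cell, Expr.eval_reg, Expr.eval_one, State.setReg_reg,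
          State.setReg_arr]
        norm_num [hr1, hl1.cost i hi]
        rw [abs_of_nonneg (by positivity)]
        exact_mod_cast hd.w_le i hi
      · simp [hr1, hl1.cost i hi]
      rintro s3 hs3 - rfl
      have hcode : WordRAM.code d.O d.g (Pi.single i 1) = d.g i := code_single _ hi
      have hcost : WordRAM.cost d.O d.w (Pi.single i 1) = d.w i := cost_single _ hi
      refine ok_insert hQ hs3 (x := Pi.single i 1) hl1.table.options hd.O_le (by norm_num) rfl
        (by simp [hcode]) (abs_code_g_le fun j hj => ?_) (by simp [hcost]) (fun o _ => ?_)
        (fun s' o hf ho hoO => ?_) h1 ⟨rfl, ?_⟩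
      · rw [code_single _ hi]
        refine (hd.coord j hj i hi).trans ?_
        have : d.D ≤ 3 * d.E := by rw [E]; nlinarith
        exact_mod_cast this
      · by_cases h : o = i
        · subst h; rw [Pi.single_eq_same]; omega
        · simp [Pi.single_eq_of_ne h]
      · have h23 := hf.reg 23
        simp only [State.setReg_reg] at h23
        norm_num [hr1] at h23
        simp only [Expr.eval_eq, Expr.eval_reg, ho, h23, Pi.single_apply, Nat.cast_inj]
        split_ifs <;> simp
      · rintro _ rfl
        exact ⟨rfl, le_rfl⟩
    · have hty : d.ty i ≠ τ := by
        simp only [Expr.eval_eq, Expr.eval_cell, Expr.eval_reg, hr1, hτ1, hl1.ty i hi] at h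
        intro heq
        rw [heq, if_pos rfl] at h
        exact one_ne_zero h
      refine Ok.skip hs1 ?_
      convert h1 using 1
      ext x
      simp only [Set.mem_ofPred_eq]
      constructor
      · rintro ⟨o, ho, ho', h1, h2⟩
        refine ⟨o, ho, ?_, h1, h2⟩
        have : o ≠ i := fun h => hty (h ▸ h1)
        omega
      · rintro ⟨o, ho, ho', h1, h2⟩
        exact ⟨o, ho, by omega, h1, h2⟩
  · intro s1 _ _ h1
    convert h1 using 1
    ext x
    simp only [singles, Set.mem_ofPred_eq, Nat.cast_lt]
    constructor
    · rintro ⟨o, ho, h⟩; exact ⟨o, ho, ho, h⟩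
    · rintro ⟨o, ho, -, h⟩; exact ⟨o, ho, h⟩

/-- Set register `38` to `1` or `0` according to whether the digits of the number in register `37`
are all at most `2 * E`. -/
def checkDigits : Program :=
  .forLoop 36 0 0 (.cond (.bin .lt (2 * .reg 7) (.reg 37 % .reg 8)) (.setReg 38 0) .skip ;;
    .setReg 37 (.reg 37 / .reg 8))

/-- Digits are read by repeated division. While all shifted digits so far lie in [0, 2E] there is no
borrow, so the remainder is the true digit. The first bad digit lies in [-2E, -1] or in [2E + 1,
4E], and modulo M = 8E + 1 both ranges give remainders above 2E. -/
theorem ok_checkDigits (hd : d.Fits Q G) (hs : s.Bdd Q) (hl : d.Loaded s) {u : ℕ → ℤ}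
    (hu : ∀ i < d.k, |u i| ≤ 3 * (d.E : ℤ))
    (h37 : s.reg 37 = ∑ i ∈ range d.k, (u i + d.E) * (d.M : ℤ) ^ i) (h38 : s.reg 38 = 1) :
    Ok Q G checkDigits s fun s' => s'.reg 38 ≠ 0 ↔ ∀ i < d.k, |u i| ≤ (d.E : ℤ) := by
  have hQ := hd.le_Q
  -- The quotient in register 37 is controlled only as long as the flag is still set; after a
  -- failure it has no meaning and the flag stays 0.
  refine Ok.forLoop hQ (fun i s' =>
      (s'.reg 38 ≠ 0 ↔ ∀ j < d.k, (j : ℤ) < i → |u j| ≤ (d.E : ℤ)) ∧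
      (s'.reg 38 ≠ 0 → s'.reg 37 =
        ∑ j ∈ range (d.k - i.toNat), (u (j + i.toNat) + d.E) * (d.M : ℤ) ^ j))
    (A := 0) hs rfl hl.reg_k (by simp) (by simpa using hd.k_le) (by simp)
    (fun _ _ _ h => h) ?_ ?_ ?_
  · refine ⟨⟨fun _ j _ h => by omega, fun _ => by simp [h38]⟩, fun _ => by simp [h37]⟩
  · rintro i s1 hi hik hs1 hr1 hf1 ⟨h1, h2⟩
    lift i to ℕ using hi
    have hi : i < d.k := by exact_mod_cast hik
    have hE : s1.reg 7 = d.E := (hf1.reg 7).trans hl.reg_E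
    have hM : s1.reg 8 = d.M := (hf1.reg 8).trans hl.reg_M
    have hM' : (d.M : ℤ) = 8 * d.E + 1 := by rw [M]; push_cast; ring
    have hM0 : (d.M : ℤ) ≠ 0 := by omega
    set T : ℤ := ∑ j ∈ range (d.k - (i + 1)), (u (j + (i + 1)) + d.E) * (d.M : ℤ) ^ j with hT
    have hsplit : ∑ j ∈ range (d.k - i), (u (j + i) + d.E) * (d.M : ℤ) ^ j =
        (u i + d.E) + d.M * T := by
      rw [show d.k - i = d.k - (i + 1) + 1 by omega, sum_range_succ', hT, mul_sum, add_comm]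
      simp only [pow_zero, mul_one, zero_add, pow_succ]
      congr 1
      exact sum_congr rfl fun j _ => by rw [add_assoc, add_comm 1 i]; ring
    have hui := hu i hi
    rw [abs_le] at hui
    have hiff : (∀ j < d.k, (j : ℤ) < (i : ℤ) + 1 → |u j| ≤ (d.E : ℤ)) ↔
        (∀ j < d.k, (j : ℤ) < i → |u j| ≤ (d.E : ℤ)) ∧ |u i| ≤ (d.E : ℤ) := by
      constructor
      · exact fun h => ⟨fun j hj hji => h j hj (by omega), h i hi (by omega)⟩
      · rintro ⟨h, h'⟩ j hj hji
        by_cases hjeq : j = i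
        · rw [hjeq]; exact h'
        · exact h j hj (by omega)
    have hgood : |u i| ≤ (d.E : ℤ) → s1.reg 38 ≠ 0 →
        s1.reg 37 % d.M = u i + d.E ∧ s1.reg 37 / d.M = T := by
      intro hle h0
      rw [abs_le] at hle
      have h3 := h2 h0
      rw [Int.toNat_natCast, hsplit] at h3
      rw [h3]
      constructor
      · rw [Int.add_mul_emod_self_left, Int.emod_eq_of_lt (by omega) (by omega)]
      · rw [Int.add_mul_ediv_left _ _ hM0, Int.ediv_eq_zero_of_lt (by omega) (by omega), zero_add]
    have hbad : ¬ |u i| ≤ (d.E : ℤ) → s1.reg 38 ≠ 0 → 2 * (d.E : ℤ) < s1.reg 37 % d.M := by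
      intro hle h0
      rw [abs_le] at hle
      have h3 := h2 h0
      rw [Int.toNat_natCast, hsplit] at h3
      rw [h3, Int.add_mul_emod_self_left]
      by_cases hneg : u i + d.E < 0
      · rw [← Int.add_emod_right, Int.emod_eq_of_lt (by omega) (by omega)]
        omega
      · rw [Int.emod_eq_of_lt (by omega) (by omega)]
        omega
    refine Ok.seq hQ (mid := fun s' => (s'.reg 38 ≠ 0 ↔
        (∀ j < d.k, (j : ℤ) < i → |u j| ≤ (d.E : ℤ)) ∧ |u i| ≤ (d.E : ℤ)) ∧
        (s'.reg 38 ≠ 0 → s1.reg 38 ≠ 0)) ?_ ?_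
    · refine Ok.cond hQ hs1 (fun h => ?_) fun h => ?_
      · refine Ok.setReg hQ hs1 (by simp) ⟨?_, by simp⟩
        simp only [State.setReg_reg, if_true, Expr.eval_zero, ne_eq, not_true, false_iff, not_and]
        intro h3 hle
        have h4 := (hgood hle (h1.2 h3)).1
        simp only [Expr.eval_lt, Expr.eval_mul, Expr.eval_two, Expr.eval_mod, Expr.eval_reg, hE, hM,
          h4] at h
        rw [abs_le] at hle
        rw [if_neg (by omega)] at h
        exact h rfl
      · refine Ok.skip hs1 ⟨?_, id⟩
        rw [h1, iff_self_and]
        intro h3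
        by_contra hle
        have h4 := hbad hle (h1.2 h3)
        simp only [Expr.eval_lt, Expr.eval_mul, Expr.eval_two, Expr.eval_mod, Expr.eval_reg, hE,
          hM] at h
        rw [if_pos h4] at h
        exact one_ne_zero h
    · rintro s2 hs2 hf2 ⟨h3, h4⟩
      have e37 : s2.reg 37 = s1.reg 37 := hf2.reg 37
      have e8 : s2.reg 8 = s1.reg 8 := hf2.reg 8
      refine Ok.setReg hQ hs2 ?_ ⟨?_, fun h => ?_⟩
      · exact (Int.abs_ediv_le_abs _ _).trans (hs2.1 37)
      · rw [hiff, ← h3]; simp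
      · have h0 : s2.reg 38 ≠ 0 := by simpa using h
        have := (hgood (h3.1 h0).2 (h4 h0)).2
        simp only [State.setReg_reg, if_true, Expr.eval_div, Expr.eval_reg, e37, e8, hM, this, hT]
        norm_num
  · rintro s1 - - ⟨h1, -⟩
    rw [h1]
    exact ⟨fun h i hi => h i hi (by exact_mod_cast hi), fun h i hi _ => h i hi⟩

/-- Delete the entries of table `(8, 9)` with a coordinate that exceeds `E` in absolute value. -/
def filter : Program :=
  .forLoop 30 (0 - .reg 9) 10 (.cond (.cell 8 (.reg 30))
    (.setReg 37 (.reg 30 + .reg 12) ;; .setReg 38 1 ;; checkDigits ;;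
      .cond (.reg 38) .skip (.setCell 8 (.reg 30) 0))
    .skip)

theorem offset_le (d : Data) : d.offset ≤ d.R := by
  have h := geom_bound d.E d.k
  rw [← M] at h
  rw [R, ← h, offset]
  have : d.E * ∑ i ∈ range d.k, d.M ^ i ≤ 8 * d.E * ∑ i ∈ range d.k, d.M ^ i :=
    Nat.mul_le_mul_right _ (by omega)
  omega

/-- Membership in the window depends on the code alone, by `digits_unique`. Hence the test on the
code decides for all vectors that share an entry, and deleting or keeping the entry is correct for
all of them. -/
theorem ok_filter (hd : d.Fits Q G) (hs : s.Bdd Q) (hl : d.Loaded s) {S : Set (ℕ → ℕ)}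
    (hrep : d.Represents s 8 9 S)
    (hS : ∀ x ∈ S, ∀ i < d.k, |WordRAM.code d.O (d.v i) x| ≤ 3 * (d.E : ℤ)) :
    Ok Q G filter s fun s' => d.Represents s' 8 9
      {x ∈ S | ∀ i < d.k, |WordRAM.code d.O (d.v i) x| ≤ (d.E : ℤ)} := by
  have hQ := hd.le_Q
  set good : (ℕ → ℕ) → Prop := fun x => ∀ i < d.k, |WordRAM.code d.O (d.v i) x| ≤ (d.E : ℤ)
    with hgood
  have huniq : ∀ x ∈ S, ∀ y ∈ S, WordRAM.code d.O d.g x = WordRAM.code d.O d.g y →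
      (good x ↔ good y) := by
    intro x hx y hy hxy
    rw [code_g, code_g] at hxy
    have := digits_unique (M := d.M) (E := d.E) (by rw [M]; push_cast; omega) d.k _ _ (hS x hx)
      (hS y hy) hxy
    constructor
    · intro h i hi; rw [← this i hi]; exact h i hi
    · intro h i hi; rw [this i hi]; exact h i hi
  -- Entries below i are decided: kept ones are unchanged and good, and empty ones have no good
  -- vector. Entries from i on are untouched.
  refine ok_codeLoop hQ hs hl.table hd.le_G (fun i s' => ∀ z : ℤ, |z| ≤ (d.R : ℤ) →
      (z < i → s'.arr 8 z ≠ 0 → s.arr 8 z = s'.arr 8 z ∧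
        ∀ x ∈ S, WordRAM.code d.O d.g x = z → good x) ∧
      (z < i → s'.arr 8 z = 0 → ∀ x ∈ S, WordRAM.code d.O d.g x = z → ¬ good x) ∧
      (i ≤ z → s'.arr 8 z = s.arr 8 z))
    (fun _ _ _ h => h) (fun z hz => ?_) ?_ ?_
  · rw [abs_le] at hz
    exact ⟨fun h => by omega, fun h => by omega, fun _ => rfl⟩
  · intro z s1 hz hs1 hr1 hf1 h1
    have hl1 : d.Loaded s1 := hl.of_frame hf1
    have e8 : s1.arr 8 z = s.arr 8 z := (h1 z hz).2.2 le_rfl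
    refine Ok.cond hQ hs1 (fun h => ?_) fun h => ?_
    · simp only [Expr.eval_cell, Expr.eval_reg, hr1, e8] at h
      obtain ⟨x, hx, hcx, -⟩ := hrep.1 z hz h
      refine Ok.seq hQ (mid := fun s' => s' = s1.setReg 37 (z + d.offset))
        (Ok.setReg hQ hs1 ?_ ?_) ?_
      · simp only [Expr.eval_add, Expr.eval_reg, hr1, hl1.reg_offset]
        have h1 : (d.offset : ℤ) ≤ d.R := by exact_mod_cast d.offset_le
        have h2 : 2 * (d.R : ℤ) ≤ Q := by exact_mod_cast hd.R_le
        rw [abs_le] at hz ⊢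
        omega
      · simp [hr1, hl1.reg_offset]
      rintro s2 hs2 - rfl
      refine Ok.seq hQ (mid := fun s' => s' = (s1.setReg 37 (z + d.offset)).setReg 38 1)
        (Ok.setReg hQ hs2 ?_ (by simp)) ?_
      · simp only [Expr.eval_one, abs_one]; omega
      rintro s3 hs3 - rfl
      have hl3 : d.Loaded ((s1.setReg 37 (z + d.offset)).setReg 38 1) :=
        (hl1.of_frame (Frame.setReg s1 37 (z + d.offset) [37] [] (by simp))).of_frame
          (Frame.setReg _ 38 1 [38] [] (by simp))
      refine Ok.seq hQ (ok_checkDigits hd hs3 hl3 (hS x hx) ?_ (by simp)) ?_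
      · simp only [State.setReg_reg, if_true]
        norm_num
        rw [← hcx, code_g, offset]
        push_cast
        rw [mul_sum, ← sum_add_distrib]
        exact sum_congr rfl fun i _ => by ring
      intro s4 hs4 hf4 h4
      have e4 : s4.arr = s1.arr := by
        funext a
        exact hf4.2 a (by simp [checkDigits, Program.forLoop, Program.arrs])
      have r4 : s4.reg 30 = z := by rw [hf4.reg 30]; simpa using hr1
      refine Ok.cond hQ hs4 (fun h38 => ?_) fun h38 => ?_
      · refine Ok.skip hs4 fun z' hz' => ?_
        rw [e4]
        by_cases hzz : z' = z
        · subst hzz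
          refine ⟨fun _ _ => ⟨e8.symm, fun y hy hcy => ?_⟩, fun _ h0 => ?_, fun h => by omega⟩
          · exact (huniq x hx y hy (hcx.trans hcy.symm)).1 (h4.1 h38)
          · exact absurd (e8 ▸ h0) h
        · have := h1 z' hz'
          exact ⟨fun h => this.1 (by omega), fun h => this.2.1 (by omega),
            fun h => this.2.2 (by omega)⟩
      · refine Ok.setCell hQ hs4 (by simp) fun z' hz' => ?_
        simp only [State.setCell_arr, if_true, Expr.eval_reg, r4, Expr.eval_zero, e4,
          Function.update_apply]
        by_cases hzz : z' = z
        · subst hzz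
          simp only [if_true]
          refine ⟨fun _ h => absurd rfl h, fun _ _ y hy hcy hgy => ?_, fun h => by omega⟩
          exact (h4.2 ((huniq x hx y hy (hcx.trans hcy.symm)).2 hgy)) h38
        · have := h1 z' hz'
          rw [if_neg hzz]
          exact ⟨fun h => this.1 (by omega), fun h => this.2.1 (by omega),
            fun h => this.2.2 (by omega)⟩
    · simp only [Expr.eval_cell, Expr.eval_reg, hr1] at h
      refine Ok.skip hs1 fun z' hz' => ?_
      by_cases hzz : z' = z
      · subst hzz
        refine ⟨fun _ h0 => absurd h h0, fun _ _ y hy hcy => ?_, fun h => by omega⟩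
        have := (hrep.2 y hy).2.1
        rw [hcy, ← e8] at this
        exact absurd h this
      · have := h1 z' hz'
        exact ⟨fun h => this.1 (by omega), fun h => this.2.1 (by omega),
          fun h => this.2.2 (by omega)⟩
  · intro s1 _ hf1 h1
    have e9 : s1.arr 9 = s.arr 9 := hf1.arr 9
    refine ⟨fun z hz hv => ?_, ?_⟩
    · have hz' := (abs_le.1 hz).2
      obtain ⟨h2, h3⟩ := (h1 z hz).1 (by omega) hv
      obtain ⟨x, hx, h4, h5⟩ := hrep.1 z hz (h2 ▸ hv)
      refine ⟨x, ⟨hx, h3 x hx h4⟩, h4, ?_⟩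
      rw [← h2, e9]
      exact h5
    · rintro x ⟨hx, hg⟩
      obtain ⟨h2, h3, h4⟩ := hrep.2 x hx
      have hz' := (abs_le.1 h2).2
      have h5 : s1.arr 8 (WordRAM.code d.O d.g x) ≠ 0 := fun h0 =>
        (h1 _ h2).2.1 (by omega) h0 x hx rfl hg
      refine ⟨h2, h5, ?_⟩
      rw [← ((h1 _ h2).1 (by omega) h5).1]
      exact h4

/-- Halve register `16`, and pass from the multiplicities divided by its old value to those divided
by its new value. -/
def level : Program :=
  .setReg 16 (.reg 16 / 2) ;;
  convolve 8 9 ;;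
  .forLoop 35 0 11 (.cond (.cell 3 (.reg 35) / .reg 16 % 2) (fill ;; convolve 10 11) .skip) ;;
  filter

/-- The vectors represented by the table at the level `h`. -/
abbrev levelSet (d : Data) (h : ℕ) : Set (ℕ → ℕ) :=
  window d.O d.k d.E d.ty d.v fun τ => d.m τ / h

/-- Covers every intermediate set of one level, with t the number of classes whose parity has been
added. Coordinates are at most E + E + O·D ≤ 3E. Entries are at most 2⌊⌊m/h⌋/2⌋ plus the parity,
hence at most m, which bounds the cost. -/
theorem bounds_of_mem (hd : d.Fits Q G) {h t : ℕ} {x : ℕ → ℕ}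
    (hx : x ∈ d.levelSet (2 * h) + d.levelSet (2 * h) +
      withSums d.O d.ty (parities (fun τ => d.m τ / h) t)) :
    (∀ i < d.k, |WordRAM.code d.O (d.v i) x| ≤ 3 * (d.E : ℤ)) ∧
    |WordRAM.code d.O d.g x| ≤ (d.R : ℤ) ∧ WordRAM.cost d.O d.w x + 1 ≤ Q ∧
    ∀ o < d.O, x o ≤ Q := by
  obtain ⟨_, ⟨a, ha, b, hb, rfl⟩, u, hu, rfl⟩ := hx
  simp only
  have h1 : ∀ i < d.k, |WordRAM.code d.O (d.v i) (a + b + u)| ≤ 3 * (d.E : ℤ) := by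
    intro i hi
    have h1 := ha.2 i hi
    have h2 := hb.2 i hi
    have h3 := abs_code_parity_le hu (fun τ => by simp only [parities]; split_ifs <;> omega)
      (hd.coord i hi)
    have h4 : ((d.O * d.D : ℕ) : ℤ) ≤ d.E := by rw [E]; exact_mod_cast (by omega)
    rw [code_add, code_add]
    rw [abs_le] at *
    omega
  have h2 : ∀ o < d.O, (a + b + u) o ≤ d.m (d.ty o) := by
    intro o ho
    refine (le_of_mem_withSums (add_mem_withSums (add_mem_withSums ha.1 hb.1) hu) ho).trans ?_
    simp only [Pi.add_apply, parities]
    have h3 : d.m (d.ty o) / (2 * h) = d.m (d.ty o) / h / 2 := by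
      rw [mul_comm, Nat.div_div_eq_div_mul]
    have h4 : d.m (d.ty o) / h ≤ d.m (d.ty o) := Nat.div_le_self _ _
    rw [h3]
    split_ifs <;> omega
  exact ⟨h1, abs_code_g_le h1, hd.cost_le _ h2, fun o ho => (h2 o ho).trans (hd.mult_le _)⟩

theorem ok_level (hd : d.Fits Q G) (hs : s.Bdd Q) (hl : d.Loaded s) {h : ℕ}
    (h16 : s.reg 16 = 2 * h) (hrep : d.Represents s 8 9 (d.levelSet (2 * h))) :
    Ok Q G level s fun s' => s'.reg 16 = h ∧ d.Represents s' 8 9 (d.levelSet h) := by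
  have hQ := hd.le_Q
  have hRQ : d.R ≤ Q := by have := hd.R_le; omega
  -- Before any parity has been added the third summand is {0}; this is the invariant of the parity
  -- loop at 0.
  have h0 : d.levelSet (2 * h) + d.levelSet (2 * h) = d.levelSet (2 * h) + d.levelSet (2 * h) +
      withSums d.O d.ty (parities (fun τ => d.m τ / h) 0) := by
    have : parities (fun τ => d.m τ / h) 0 = 0 := by funext τ; simp [parities]
    rw [this, withSums_zero, Set.add_singleton]
    simp
  have hev : (Expr.reg 16 / 2).eval s = h := by
    simp only [Expr.eval_div, Expr.eval_reg, Expr.eval_two, h16]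
    omega
  refine Ok.seq hQ (mid := fun s' => s' = s.setReg 16 h) (Ok.setReg hQ hs ?_ ?_) ?_
  · rw [hev, Nat.abs_cast]
    have := hs.1 16
    rw [h16, abs_le] at this
    omega
  · rw [hev]
  rintro s0 hs0 hf0 rfl
  have hl0 : d.Loaded (s.setReg 16 h) := hl.of_frame hf0
  refine Ok.seq hQ (ok_convolve hQ hs0 hl0.table hd.le_G hd.O_le (by norm_num) (by norm_num)
    hrep hrep (fun x hx => (bounds_of_mem hd (t := 0) (h := h) (h0 ▸ hx)).2) hRQ) ?_
  intro s1 hs1 hf1 h1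
  have hl1 : d.Loaded s1 := hl0.of_frame hf1
  have r1 : s1.reg 16 = h := by rw [hf1.reg 16]; simp
  refine Ok.seq hQ (mid := fun s' => d.Represents s' 8 9 (d.levelSet (2 * h) +
    d.levelSet (2 * h) + withSums d.O d.ty (parities (fun τ => d.m τ / h) d.N))) ?_ ?_
  · refine Ok.forLoop hQ (fun i s' => d.Represents s' 8 9 (d.levelSet (2 * h) +
        d.levelSet (2 * h) + withSums d.O d.ty (parities (fun τ => d.m τ / h) i.toNat)))
      (A := 0) hs1 rfl hl1.reg_N (by simp) (by simpa using hd.N_le) (by simp)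
      (fun _ _ _ h => h) (h0 ▸ h1) ?_ ?_
    · intro i s2 hi hiN hs2 hr2 hf2 h2
      lift i to ℕ using hi
      have hi : i < d.N := by exact_mod_cast hiN
      have hl2 : d.Loaded s2 := hl1.of_frame hf2
      have r2 : s2.reg 16 = h := (hf2.reg 16).trans r1
      have heval : (Expr.cell 3 (.reg 35) / .reg 16 % 2).eval s2 = ((d.m i / h % 2 : ℕ) : ℤ) := by
        simp [hr2, hl2.mult i hi, r2]
      have hi1 : ((i : ℤ) + 1).toNat = i + 1 := by omega
      rw [hi1]
      rw [Int.toNat_natCast] at h2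
      refine Ok.cond hQ hs2 (fun hne => ?_) fun heq => ?_
      · rw [heval] at hne
        have hodd : d.m i / h % 2 = 1 := by
          have : d.m i / h % 2 ≠ 0 := by exact_mod_cast hne
          omega
        rw [withSums_parities_succ (m := fun τ => d.m τ / h) hodd, ← add_assoc]
        refine Ok.seq hQ (ok_fill hd hs2 hl2 hr2) ?_
        intro s3 hs3 hf3 h3
        have hl3 : d.Loaded s3 := hl2.of_frame hf3
        refine ok_convolve hQ hs3 hl3.table hd.le_G hd.O_le (by norm_num) (by norm_num)
          (by rw [hf3.arr 8, hf3.arr 9]; exact h2) h3 (fun x hx => ?_) hRQ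
        refine (bounds_of_mem hd (t := i + 1) (h := h) ?_).2
        rwa [withSums_parities_succ (m := fun τ => d.m τ / h) hodd, ← add_assoc]
      · rw [heval] at heq
        have heven : d.m i / h % 2 = 0 := by exact_mod_cast heq
        rw [parities_succ, heven, Pi.single_zero, add_zero]
        exact Ok.skip hs2 h2
    · intro s2 _ _ h2
      rwa [Int.toNat_natCast] at h2
  · intro s2 hs2 hf2 h2
    have hl2 : d.Loaded s2 := hl1.of_frame hf2
    refine (ok_filter hd hs2 hl2 h2 fun x hx => (bounds_of_mem hd hx).1).frame.imp ?_
    rintro s3 - ⟨hf3, h3⟩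
    refine ⟨(hf3.reg 16).trans ((hf2.reg 16).trans r1), ?_⟩
    -- The parities below N are all parities, because m vanishes from N on.
    have hpar : parities (fun τ => d.m τ / h) d.N = fun τ => d.m τ / h % 2 := by
      funext τ
      simp only [parities]
      split_ifs with hτ
      · rfl
      · rw [hd.mult τ (not_lt.1 hτ)]; simp
    have hdiv : (fun τ => d.m τ / (2 * h)) = fun τ => d.m τ / h / 2 := by
      funext τ
      rw [mul_comm, Nat.div_div_eq_div_mul]
    have := window_eq (ty := d.ty) (fun τ => d.m τ / h) hd.coord (le_refl d.E)
    rw [hpar] at h3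
    simp only [levelSet, hdiv] at h3 ⊢
    rw [this]
    exact h3

end Data

end WordRAM

namespace WordRAM

/-! ### Preprocessing -/

/-- The machine input in terms of natural numbers. -/
structure Raw where
  k : ℕ
  σ : ℕ
  L : ℕ
  b : ℕ
  tab : ℕ → ℕ
  lo : ℕ → ℕ
  hi : ℕ → ℕ
  mult : ℕ → ℕ

namespace Raw

variable (r : Raw)

/-- The number of column types. -/
def n : ℕ := (r.σ + 1) ^ r.k

/-- A bound on the distances of letters. -/
def D : ℕ := 1 + ∑ a ∈ range (r.σ * (r.σ + 1)), r.tab a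

/-- The distance of the letter `f` to the `i`-th entry of the column type `c`. -/
def entry (f c i : ℕ) : ℕ := r.tab (f * (r.σ + 1) + c / (r.σ + 1) ^ i % (r.σ + 1))

/-- The upper bounds, cut off at an upper bound on all distances. -/
def top (i : ℕ) : ℕ := min (r.hi i) (r.D * r.L)

/-- The instance with the options `c * σ + f` for the column types `c` and letters `f`, and three
further options for each input string: an unused and a used unit of slack, and a unit of the lower
bound. -/
def data : Data where
  O := r.n * r.σ + 3 * r.k
  N := r.n + 2 * r.k
  k := r.k
  D := r.D
  -- With -1 for used slack and for lower-bound units, coordinate i is the distance to string i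
  -- minus (lower bound + used slack).
  v i o := if o < r.n * r.σ then r.entry (o % r.σ) (o / r.σ) i else
    if (o - r.n * r.σ) / 3 = i ∧ (o - r.n * r.σ) % 3 ≠ 0 then -1 else 0
  w o := if o < r.n * r.σ then r.b * ∑ i ∈ range r.k, r.entry (o % r.σ) (o / r.σ) i else 0
  ty o := if o < r.n * r.σ then o / r.σ else
    r.n + 2 * ((o - r.n * r.σ) / 3) + if (o - r.n * r.σ) % 3 = 2 then 1 else 0
  -- Used and unused slack share a class with sum `top - lo`, so the used part is any number from 0
  -- to that difference. The lower-bound units form a class of their own. The truncated subtraction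
  -- is harmless since `lo ≤ top` is checked first.
  m τ := if τ < r.n then r.mult τ else if τ < r.n + 2 * r.k then
    if (τ - r.n) % 2 = 0 then r.top ((τ - r.n) / 2) - r.lo ((τ - r.n) / 2)
    else r.lo ((τ - r.n) / 2) else 0

/-- The machine is in its initial state. -/
structure Input (s : State) : Prop where
  reg_k : s.reg 0 = r.k
  reg_σ : s.reg 1 = r.σ
  reg_L : s.reg 2 = r.L
  reg_b : s.reg 3 = r.b
  tab : ∀ a : ℕ, s.arr 0 a = r.tab a
  lo : ∀ a : ℕ, s.arr 1 a = r.lo a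
  hi : ∀ a : ℕ, s.arr 2 a = r.hi a
  mult : ∀ a : ℕ, s.arr 3 a = r.mult a

theorem Input.of_frame {rs as : List ℕ} {s s' : State} {r : Raw} (h : r.Input s)
    (hf : Frame rs as s s')
    (h0 : rs.contains 0 = false := by rfl) (h1 : rs.contains 1 = false := by rfl)
    (h2 : rs.contains 2 = false := by rfl) (h3 : rs.contains 3 = false := by rfl)
    (a0 : as.contains 0 = false := by rfl) (a1 : as.contains 1 = false := by rfl)
    (a2 : as.contains 2 = false := by rfl) (a3 : as.contains 3 = false := by rfl) :
    r.Input s' where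
  reg_k := (hf.reg 0 h0).trans h.reg_k
  reg_σ := (hf.reg 1 h1).trans h.reg_σ
  reg_L := (hf.reg 2 h2).trans h.reg_L
  reg_b := (hf.reg 3 h3).trans h.reg_b
  tab := by rw [hf.arr 0 a0]; exact h.tab
  lo := by rw [hf.arr 1 a1]; exact h.lo
  hi := by rw [hf.arr 2 a2]; exact h.hi
  mult := by rw [hf.arr 3 a3]; exact h.mult

/-- The assumptions on the input and on the bound `Q`. -/
structure Good (Q : ℕ) : Prop where
  k_pos : 0 < r.k
  σ_pos : 0 < r.σ
  b_le : r.b ≤ 1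
  mult_le : ∀ c, r.mult c ≤ r.L
  le_Q : 16 ≤ Q
  R_le : 4 * r.data.R ≤ Q
  RL_le : 2 * (r.data.R * r.L) ≤ Q
  RRL_le : r.data.R * r.data.R * r.L + 1 ≤ Q

variable {r} {Q : ℕ}

/-- The summand 1 in `D` is there for this: it covers the coordinates -1 and gives O ≤ E and L ≤ D·L
even if all distances are zero. -/
theorem D_pos (r : Raw) : 0 < r.D := by rw [D]; omega

theorem Good.O_pos (hr : r.Good Q) : 0 < r.data.O := by
  have := hr.k_pos
  show 0 < r.n * r.σ + 3 * r.k
  omega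

theorem OD_le (r : Raw) : r.data.O * r.D ≤ r.data.E := by
  show _ ≤ 2 * (r.data.O * r.D); omega

theorem O_le_E (r : Raw) : r.data.O ≤ r.data.E :=
  (Nat.le_mul_of_pos_right _ r.D_pos).trans r.OD_le

theorem Good.M_le (hr : r.Good Q) : r.data.M ≤ r.data.R := Nat.le_self_pow hr.k_pos.ne' _

theorem Good.E_le (hr : r.Good Q) : 8 * r.data.E + 1 ≤ r.data.R := hr.M_le

theorem Good.O_le (hr : r.Good Q) : r.data.O ≤ r.data.R := by
  have := r.O_le_E; have := hr.E_le; omega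

theorem Good.nσ_le (hr : r.Good Q) : r.n * r.σ ≤ r.data.R :=
  (show r.n * r.σ ≤ r.n * r.σ + 3 * r.k by omega).trans hr.O_le

theorem Good.n_le (hr : r.Good Q) : r.n ≤ r.n * r.σ := Nat.le_mul_of_pos_right _ hr.σ_pos

theorem Good.k_le (hr : r.Good Q) : r.k ≤ r.data.R :=
  (show r.k ≤ r.n * r.σ + 3 * r.k by omega).trans hr.O_le

theorem Good.N_le (hr : r.Good Q) : r.data.N ≤ r.data.R := by
  refine le_trans ?_ hr.O_le
  show r.n + 2 * r.k ≤ r.n * r.σ + 3 * r.k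
  have := hr.n_le
  omega

theorem Good.table_le (hr : r.Good Q) : r.σ * (r.σ + 1) ≤ r.data.R := by
  refine le_trans ?_ hr.nσ_le
  rw [mul_comm]
  exact Nat.mul_le_mul_right _ (Nat.le_self_pow hr.k_pos.ne' _)

theorem Good.kD_le (hr : r.Good Q) : r.k * r.D ≤ r.data.R := by
  have h1 : r.k * r.D ≤ r.data.O * r.D := Nat.mul_le_mul_right _ (by
    show r.k ≤ r.n * r.σ + 3 * r.k; omega)
  have := r.OD_le; have := hr.E_le; omega

theorem Good.D_le (hr : r.Good Q) : r.D ≤ r.data.R :=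
  (Nat.le_mul_of_pos_left _ hr.k_pos).trans hr.kD_le

theorem pow_le {i : ℕ} (hi : i ≤ r.k) : r.data.M ^ i ≤ r.data.R :=
  Nat.pow_le_pow_right (by simp [Data.M]) hi

theorem Good.DL_le (hr : r.Good Q) : 2 * (r.D * r.L) ≤ Q :=
  (Nat.mul_le_mul_left 2 (Nat.mul_le_mul_right _ hr.D_le)).trans hr.RL_le

theorem entry_le {f c i : ℕ} (hf : f < r.σ) : r.entry f c i ≤ r.D := by
  have h1 : c / (r.σ + 1) ^ i % (r.σ + 1) < r.σ + 1 := Nat.mod_lt _ (by omega)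
  have h2 : f * (r.σ + 1) + c / (r.σ + 1) ^ i % (r.σ + 1) < r.σ * (r.σ + 1) := by nlinarith
  have := single_le_sum (f := r.tab) (fun _ _ => Nat.zero_le _) (mem_range.2 h2)
  rw [entry, D]
  omega

theorem Good.sum_entry_le (hr : r.Good Q) {f c i : ℕ} (hf : f < r.σ) (hi : i ≤ r.k) :
    ∑ j ∈ range i, r.entry f c j ≤ r.data.R := by
  refine le_trans ?_ hr.kD_le
  refine (sum_le_card_nsmul _ _ r.D fun j _ => entry_le hf).trans ?_
  rw [card_range, smul_eq_mul]
  exact Nat.mul_le_mul_right _ hi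

theorem Good.sum_entry_pow_le (hr : r.Good Q) {f c i : ℕ} (hf : f < r.σ) (hi : i ≤ r.k) :
    ∑ j ∈ range i, r.entry f c j * r.data.M ^ j ≤ r.data.R := by
  have h1 : ∑ j ∈ range i, r.entry f c j * r.data.M ^ j ≤
      ∑ j ∈ range i, 8 * r.data.E * r.data.M ^ j := by
    refine sum_le_sum fun j _ => Nat.mul_le_mul_right _ ?_
    have h2 : r.D ≤ r.data.O * r.D := Nat.le_mul_of_pos_left _ hr.O_pos
    have h3 := r.OD_le
    have h4 := entry_le (r := r) (c := c) (i := j) hf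
    omega
  refine h1.trans ?_
  rw [← mul_sum]
  have h2 := geom_bound r.data.E i
  rw [← Data.M] at h2
  have := pow_le hi
  omega

/-- The longest bounded loops run over the 2R + 1 codes from -R to R; the numbers of options,
classes and strings are all at most R. -/
theorem Good.fits (hr : r.Good Q) (hlo : ∀ i < r.k, r.lo i ≤ r.top i) : r.data.Fits Q (2 * r.data.R + 2) where
  le_Q := hr.le_Q
  coord i hi o ho := by
    show |ite _ _ _| ≤ (r.D : ℤ)
    have := r.D_pos
    split_ifs with h1 h2
    · rw [Nat.abs_cast]
      exact_mod_cast entry_le (Nat.mod_lt _ hr.σ_pos)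
    · simp only [abs_neg, abs_one]; omega
    · simp
  mult τ hτ := by
    have hτ : r.n + 2 * r.k ≤ τ := hτ
    show ite _ _ _ = 0
    rw [if_neg (by omega), if_neg (by omega)]
  mult_le τ := by
    have h1 := hr.DL_le
    have h2 : r.L ≤ r.D * r.L := Nat.le_mul_of_pos_left _ r.D_pos
    show ite _ _ _ ≤ Q
    split_ifs with h3 h4 h5
    · have := hr.mult_le τ; omega
    · have : r.top ((τ - r.n) / 2) ≤ r.D * r.L := min_le_right _ _
      omega
    · have : r.top ((τ - r.n) / 2) ≤ r.D * r.L := min_le_right _ _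
      have := hlo ((τ - r.n) / 2) (by omega)
      omega
    · omega
  -- At most R options, each used at most L times at a cost of at most R; the slack options are
  -- free.
  cost_le x hx := by
    refine le_trans (Nat.succ_le_succ ?_) hr.RRL_le
    have h1 : ∀ o ∈ range r.data.O, x o * r.data.w o ≤ r.L * r.data.R := by
      intro o ho
      by_cases h : o < r.n * r.σ
      · have h2 := hx o (mem_range.1 ho)
        have e1 : r.data.ty o = o / r.σ := if_pos h
        have e2 : r.data.m (o / r.σ) = r.mult (o / r.σ) :=
          if_pos ((Nat.div_lt_iff_lt_mul hr.σ_pos).2 h)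
        have e3 : r.data.w o = r.b * ∑ i ∈ range r.k, r.entry (o % r.σ) (o / r.σ) i := if_pos h
        rw [e1, e2] at h2
        rw [e3]
        refine Nat.mul_le_mul (h2.trans (hr.mult_le _)) ?_
        have := hr.sum_entry_le (c := o / r.σ) (Nat.mod_lt o hr.σ_pos) le_rfl
        have h5 := Nat.mul_le_mul hr.b_le this
        omega
      · have e3 : r.data.w o = 0 := if_neg h
        rw [e3]; simp
    refine (sum_le_card_nsmul _ _ _ h1).trans ?_
    rw [card_range, smul_eq_mul, mul_comm r.L, ← mul_assoc]
    exact Nat.mul_le_mul_right _ (Nat.mul_le_mul_right _ hr.O_le)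
  w_le o ho := by
    have hR := hr.R_le
    have := hr.E_le
    show ite _ _ _ + 1 ≤ Q
    split_ifs with h
    · have := hr.sum_entry_le (c := o / r.σ) (Nat.mod_lt o hr.σ_pos) le_rfl
      have h5 := Nat.mul_le_mul hr.b_le this
      omega
    · omega
  R_le := by have := hr.R_le; omega
  le_G := by omega
  O_le := by have := hr.O_le; omega
  N_le := by have := hr.N_le; omega
  k_le := by
    show r.k ≤ _
    have := hr.k_le; omega

theorem g_of_lt {o : ℕ} (ho : o < r.n * r.σ) :
    r.data.g o = ((∑ i ∈ range r.k, r.entry (o % r.σ) (o / r.σ) i * r.data.M ^ i : ℕ) : ℤ) := by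
  show ∑ i ∈ range r.k, (ite _ _ _) * _ = _
  push_cast
  exact sum_congr rfl fun i _ => by rw [if_pos ho]

theorem g_of_ge {q : ℕ} (hq : q < 3 * r.k) :
    r.data.g (r.n * r.σ + q) =
      ((if q % 3 = 0 then 1 else 0) - 1) * (r.data.M : ℤ) ^ (q / 3) := by
  show ∑ i ∈ range r.k, (ite _ _ _) * _ = _
  have h1 : ¬ r.n * r.σ + q < r.n * r.σ := by omega
  have h2 : r.n * r.σ + q - r.n * r.σ = q := by omega
  simp only [h1, if_false, h2]
  rw [sum_eq_single_of_mem (q / 3) (mem_range.2 (by omega))]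
  · split_ifs with h3 h4 h4
    · exact absurd h4 h3.2
    · ring
    · ring
    · exact absurd ⟨rfl, h4⟩ h3
  · intro i _ hi
    rw [if_neg fun h => hi h.1.symm, zero_mul]

end Raw

end WordRAM

/-! ### Programs that compute the parameters, options and multiplicities of the integer program -/

namespace WordRAM

namespace Raw

variable {r : Raw} {Q G : ℕ} {s : State}

/-- Compute the number of column types and the bound on the distances of letters. -/
def countTypes : Program :=
  .setReg 4 1 ;;
  .forLoop 20 0 0 (.setReg 4 (.reg 4 * (.reg 1 + 1))) ;;
  .setReg 18 (.reg 1 * (.reg 1 + 1)) ;;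
  .setReg 5 1 ;;
  .forLoop 20 0 18 (.setReg 5 (.reg 5 + .cell 0 (.reg 20)))

theorem ok_countTypes (hr : r.Good Q) (hs : s.Bdd Q) (hi : r.Input s) :
    Ok Q (2 * r.data.R + 2) countTypes s fun s' => s'.reg 4 = r.n ∧ s'.reg 5 = r.D := by
  have hQ := hr.le_Q
  have hR := hr.R_le
  refine Ok.setReg_seq hQ hs (v := 1) rfl (by simp; omega) fun hs1 => ?_
  have hi1 : r.Input (s.setReg 4 1) := hi.of_frame (Frame.setReg s 4 1 [4] [] (by simp))
  refine Ok.seq hQ (mid := fun s' => s'.reg 4 = r.n) ?_ ?_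
  · refine Ok.forLoop hQ (fun i s' => s'.reg 4 = (((r.σ + 1) ^ i.toNat : ℕ) : ℤ)) (A := 0) hs1 rfl
      hi1.reg_k (by simp) ?_ (by simp) (fun _ _ _ h => h) rfl ?_ ?_
    · have := hr.k_le; push_cast; omega
    · intro i s2 h0 hk hs2 hr2 hf2 h2
      lift i to ℕ using h0
      have hi2 : r.Input s2 := hi1.of_frame hf2
      have hik : i + 1 ≤ r.k := by omega
      have e : (Expr.reg 4 * (.reg 1 + 1)).eval s2 = (((r.σ + 1) ^ (i + 1) : ℕ) : ℤ) := by
        simp only [Int.toNat_natCast] at h2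
        simp [h2, hi2.reg_σ, pow_succ]
      refine Ok.setReg hQ hs2 ?_ ?_
      · rw [e, Nat.abs_cast]
        have h3 : (r.σ + 1) ^ (i + 1) ≤ r.n := Nat.pow_le_pow_right (by omega) hik
        have := hr.n_le; have := hr.nσ_le
        exact_mod_cast (by omega)
      · rw [e, show ((i : ℤ) + 1).toNat = i + 1 by omega]; simp
    · intro s2 _ _ h2
      simpa [n] using h2
  intro s2 hs2 hf2 h2
  have hi2 : r.Input s2 := hi1.of_frame hf2
  refine Ok.setReg_seq hQ hs2 (v := ((r.σ * (r.σ + 1) : ℕ) : ℤ)) (by simp [hi2.reg_σ]) ?_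
    fun hs3 => ?_
  · rw [Nat.abs_cast]
    have := hr.table_le
    exact_mod_cast (by omega)
  refine Ok.setReg_seq hQ hs3 (v := 1) rfl (by simp; omega) fun hs4 => ?_
  set s4 := (s2.setReg 18 ((r.σ * (r.σ + 1) : ℕ) : ℤ)).setReg 5 1 with e4
  have hi4 : r.Input s4 := (hi2.of_frame (Frame.setReg _ 18 _ [18] [] (by simp))).of_frame
    (Frame.setReg _ 5 1 [5] [] (by simp))
  refine Ok.forLoop hQ (fun i s' => s'.reg 5 = ((1 + ∑ a ∈ range i.toNat, r.tab a : ℕ) : ℤ))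
    (A := 0) (H := ((r.σ * (r.σ + 1) : ℕ) : ℤ)) hs4 rfl (by simp [e4]) (by omega) ?_ (by simp)
    (fun _ _ _ h => h) (by simp [e4]) ?_ ?_
  · have := hr.table_le; rw [sub_zero]; exact_mod_cast (by omega)
  · intro i s5 h0 hk hs5 hr5 hf5 h5
    lift i to ℕ using h0
    have hi5 : r.Input s5 := hi4.of_frame hf5
    have e : (Expr.reg 5 + .cell 0 (.reg 20)).eval s5 =
        ((1 + ∑ a ∈ range (i + 1), r.tab a : ℕ) : ℤ) := by
      simp only [Int.toNat_natCast] at h5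
      simp [h5, hr5, hi5.tab, sum_range_succ, add_assoc]
    refine Ok.setReg hQ hs5 ?_ ?_
    · rw [e, Nat.abs_cast]
      have h3 : ∑ a ∈ range (i + 1), r.tab a ≤ ∑ a ∈ range (r.σ * (r.σ + 1)), r.tab a :=
        sum_le_sum_of_subset (range_subset_range.2 (by exact_mod_cast hk))
      have h4 := hr.D_le
      rw [D] at h4
      exact_mod_cast (by omega)
    · rw [e, show ((i : ℤ) + 1).toNat = i + 1 by omega]; simp
  · intro s5 _ hf5 h5
    rw [Int.toNat_natCast] at h5
    refine ⟨?_, h5⟩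
    rw [hf5.reg 4]
    simp [e4, h2]

/-- Compute the parameters of the instance and the code bound. -/
def dimensions : Program :=
  .setReg 14 (.reg 4 * .reg 1) ;;
  .setReg 6 (.reg 14 + 3 * .reg 0) ;;
  .setReg 7 (2 * (.reg 6 * .reg 5)) ;;
  .setReg 8 (8 * .reg 7 + 1) ;;
  .setReg 11 (.reg 4 + 2 * .reg 0) ;;
  .setReg 13 (.reg 5 * .reg 2) ;;
  .setReg 9 1 ;;
  .setReg 12 0 ;;
  .forLoop 20 0 0 (.setReg 12 (.reg 12 + .reg 7 * .reg 9) ;; .setReg 9 (.reg 9 * .reg 8)) ;;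
  .setReg 10 (.reg 9 + 1)

/-- The values of the registers that hold the parameters. -/
structure Dims (r : Raw) (s : State) : Prop where
  n : s.reg 4 = r.n
  O : s.reg 6 = r.data.O
  E : s.reg 7 = r.data.E
  M : s.reg 8 = r.data.M
  R : s.reg 9 = r.data.R
  R1 : s.reg 10 = r.data.R + 1
  N : s.reg 11 = r.data.N
  offset : s.reg 12 = r.data.offset
  DL : s.reg 13 = (r.D * r.L : ℕ)
  nσ : s.reg 14 = (r.n * r.σ : ℕ)

theorem Dims.of_frame {rs as : List ℕ} {s' : State} (h : r.Dims s) (hf : Frame rs as s s')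
    (h4 : rs.contains 4 = false := by rfl) (h6 : rs.contains 6 = false := by rfl)
    (h7 : rs.contains 7 = false := by rfl) (h8 : rs.contains 8 = false := by rfl)
    (h9 : rs.contains 9 = false := by rfl) (h10 : rs.contains 10 = false := by rfl)
    (h11 : rs.contains 11 = false := by rfl) (h12 : rs.contains 12 = false := by rfl)
    (h13 : rs.contains 13 = false := by rfl) (h14 : rs.contains 14 = false := by rfl) :
    r.Dims s' where
  n := (hf.reg 4 h4).trans h.n
  O := (hf.reg 6 h6).trans h.O
  E := (hf.reg 7 h7).trans h.E
  M := (hf.reg 8 h8).trans h.M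
  R := (hf.reg 9 h9).trans h.R
  R1 := (hf.reg 10 h10).trans h.R1
  N := (hf.reg 11 h11).trans h.N
  offset := (hf.reg 12 h12).trans h.offset
  DL := (hf.reg 13 h13).trans h.DL
  nσ := (hf.reg 14 h14).trans h.nσ

theorem ok_dimensions (hr : r.Good Q) (hs : s.Bdd Q) (hi : r.Input s) (h4 : s.reg 4 = r.n)
    (h5 : s.reg 5 = r.D) : Ok Q (2 * r.data.R + 2) dimensions s r.Dims := by
  have hQ := hr.le_Q
  have hR := hr.R_le
  have hcast : ∀ a : ℕ, a ≤ 2 * r.data.R → |((a : ℕ) : ℤ)| ≤ (Q : ℤ) := fun a ha => by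
    rw [Nat.abs_cast]; exact_mod_cast (by omega)
  have hE := hr.E_le
  refine Ok.setReg_seq hQ hs (v := ((r.n * r.σ : ℕ) : ℤ)) (by simp [h4, hi.reg_σ])
    (hcast _ (by have := hr.nσ_le; omega)) fun hs1 => ?_
  refine Ok.setReg_seq hQ hs1 (v := r.data.O) (by simp [hi.reg_k, data])
    (hcast _ (by have := hr.O_le; omega)) fun hs2 => ?_
  refine Ok.setReg_seq hQ hs2 (v := r.data.E) (by simp [h5, Data.E, data])
    (hcast _ (by omega)) fun hs3 => ?_
  refine Ok.setReg_seq hQ hs3 (v := r.data.M) (by simp [Data.M])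
    (hcast _ (by have := hr.M_le; omega)) fun hs4 => ?_
  refine Ok.setReg_seq hQ hs4 (v := r.data.N) (by simp [h4, hi.reg_k, data])
    (hcast _ (by have := hr.N_le; omega)) fun hs5 => ?_
  refine Ok.setReg_seq hQ hs5 (v := ((r.D * r.L : ℕ) : ℤ)) (by simp [h5, hi.reg_L]) ?_
    fun hs6 => ?_
  · rw [Nat.abs_cast]; exact_mod_cast (by have := hr.DL_le; omega)
  refine Ok.setReg_seq hQ hs6 (v := 1) rfl (by simp; omega) fun hs7 => ?_
  refine Ok.setReg_seq hQ hs7 (v := 0) rfl (by simp) fun hs8 => ?_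
  set s8 := ((((((((s.setReg 14 ((r.n * r.σ : ℕ) : ℤ)).setReg 6 r.data.O).setReg 7
    r.data.E).setReg 8 r.data.M).setReg 11 r.data.N).setReg 13 ((r.D * r.L : ℕ) : ℤ)).setReg 9
    1).setReg 12 0) with e8
  have k8 : s8.reg 0 = r.k := by simp [e8, hi.reg_k]
  have hgeom : ∀ i ≤ r.k, r.data.E * ∑ j ∈ range i, r.data.M ^ j ≤ r.data.R := by
    intro i hi
    have h1 := geom_bound r.data.E i
    rw [← Data.M] at h1
    have h2 : r.data.E * ∑ j ∈ range i, r.data.M ^ j ≤ 8 * r.data.E * ∑ j ∈ range i, r.data.M ^ j :=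
      Nat.mul_le_mul_right _ (by omega)
    have := pow_le (r := r) hi
    omega
  refine Ok.seq hQ (mid := fun s' => s'.reg 9 = r.data.R ∧ s'.reg 12 = r.data.offset) ?_ ?_
  · refine Ok.forLoop hQ (fun i s' => s'.reg 9 = ((r.data.M ^ i.toNat : ℕ) : ℤ) ∧ s'.reg 12 =
        ((r.data.E * ∑ j ∈ range i.toNat, r.data.M ^ j : ℕ) : ℤ)) (A := 0) hs8 rfl k8 (by simp) ?_
      (by simp) (fun _ _ _ h => h) (by simp [e8]) ?_ ?_
    · have := hr.k_le; push_cast; omega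
    · rintro i s9 h0 hk hs9 hr9 hf9 ⟨h9, h12⟩
      lift i to ℕ using h0
      simp only [Int.toNat_natCast] at h9 h12
      have e7 : s9.reg 7 = r.data.E := by rw [hf9.reg 7]; simp [e8]
      have eM : s9.reg 8 = r.data.M := by rw [hf9.reg 8]; simp [e8]
      have hik : i + 1 ≤ r.k := by omega
      rw [show ((i : ℤ) + 1).toNat = i + 1 by omega]
      refine Ok.setReg_seq hQ hs9
        (v := ((r.data.E * ∑ j ∈ range (i + 1), r.data.M ^ j : ℕ) : ℤ)) ?_
        (hcast _ (by have := hgeom (i + 1) hik; omega)) fun hs10 => ?_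
      · simp [h12, e7, h9, sum_range_succ, mul_add]
      have e : (Expr.reg 9 * Expr.reg 8).eval
          (s9.setReg 12 ((r.data.E * ∑ j ∈ range (i + 1), r.data.M ^ j : ℕ) : ℤ)) =
          ((r.data.M ^ (i + 1) : ℕ) : ℤ) := by
        simp [h9, eM, pow_succ]
      refine Ok.setReg hQ hs10 ?_ ?_
      · rw [e]
        exact hcast _ (by have := pow_le (r := r) hik; omega)
      · rw [e]; simp
    · rintro s9 - - ⟨h9, h12⟩
      rw [Int.toNat_natCast] at h9 h12
      exact ⟨h9, h12⟩
  rintro s9 hs9 hf9 ⟨h9, h12⟩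
  have e : (Expr.reg 9 + 1).eval s9 = r.data.R + 1 := by simp [h9]
  refine Ok.setReg hQ hs9 ?_ ?_
  · rw [e]
    exact_mod_cast hcast (r.data.R + 1) (by omega)
  · rw [e]
    have f4 := hf9.reg 4
    have f6 := hf9.reg 6
    have f7 := hf9.reg 7
    have f8 := hf9.reg 8
    have f11 := hf9.reg 11
    have f13 := hf9.reg 13
    have f14 := hf9.reg 14
    constructor <;> simp [f4, f6, f7, f8, f11, f13, f14, h9, h12, e8, h4]

/-- Compute the code, the cost and the class of every option that belongs to a letter. -/
def letterOptions : Program :=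
  .forLoop 23 0 14 (
    .setReg 24 (.reg 23 / .reg 1) ;;
    .setReg 17 1 ;;
    .setReg 25 0 ;;
    .setReg 26 0 ;;
    .forLoop 20 0 0 (
      .setReg 27 (.cell 0 (.reg 23 % .reg 1 * (.reg 1 + 1) + .reg 24 % (.reg 1 + 1))) ;;
      .setReg 25 (.reg 25 + .reg 27 * .reg 17) ;;
      .setReg 26 (.reg 26 + .reg 27) ;;
      .setReg 24 (.reg 24 / (.reg 1 + 1)) ;;
      .setReg 17 (.reg 17 * .reg 8)) ;;
    .setCell 5 (.reg 23) (.reg 25) ;;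
    .setCell 6 (.reg 23) (.reg 3 * .reg 26) ;;
    .setCell 7 (.reg 23) (.reg 23 / .reg 1))

/-- The options below `i` are stored. -/
def Stored (r : Raw) (i : ℤ) (s : State) : Prop :=
  ∀ o : ℕ, (o : ℤ) < i → s.arr 5 o = r.data.g o ∧ s.arr 6 o = r.data.w o ∧ s.arr 7 o = r.data.ty o

theorem Stored.update {i : ℕ} {s' : State} (h : r.Stored i s)
    (h5 : s'.arr 5 = Function.update (s.arr 5) i (r.data.g i))
    (h6 : s'.arr 6 = Function.update (s.arr 6) i (r.data.w i))
    (h7 : s'.arr 7 = Function.update (s.arr 7) i (r.data.ty i)) : r.Stored (i + 1) s' := by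
  intro o ho
  by_cases hoi : o = i
  · subst hoi; simp [h5, h6, h7]
  · have hne : (o : ℤ) ≠ i := by exact_mod_cast hoi
    rw [h5, h6, h7, Function.update_of_ne hne, Function.update_of_ne hne, Function.update_of_ne hne]
    exact h o (by omega)

theorem ok_letterOptions (hr : r.Good Q) (hs : s.Bdd Q) (hi : r.Input s) (hd : r.Dims s) :
    Ok Q (2 * r.data.R + 2) letterOptions s (r.Stored (r.n * r.σ : ℕ)) := by
  have hQ := hr.le_Q
  have hR := hr.R_le
  have hcast : ∀ a : ℕ, a ≤ 2 * r.data.R → |((a : ℕ) : ℤ)| ≤ (Q : ℤ) := fun a ha => by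
    rw [Nat.abs_cast]; exact_mod_cast (by omega)
  have hE := hr.E_le
  refine Ok.forLoop hQ r.Stored (A := 0) hs rfl hd.nσ (by positivity) ?_ (by simp)
    (fun _ _ _ h => h) (fun o ho => by omega) ?_ fun s' _ _ h => h
  · have := hr.nσ_le; push_cast at *; omega
  intro o s1 h0 ho hs1 hr1 hf1 h1
  lift o to ℕ using h0
  have ho : o < r.n * r.σ := by exact_mod_cast ho
  have hi1 : r.Input s1 := hi.of_frame hf1
  have hd1 : r.Dims s1 := hd.of_frame hf1
  have hfσ : o % r.σ < r.σ := Nat.mod_lt _ hr.σ_pos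
  have hdiv : o / r.σ ≤ r.data.R := (Nat.div_le_self _ _).trans (ho.le.trans hr.nσ_le)
  refine Ok.setReg_seq hQ hs1 (v := ((o / r.σ : ℕ) : ℤ)) (by simp [hr1, hi1.reg_σ])
    (hcast _ (by omega)) fun hs2 => ?_
  refine Ok.setReg_seq hQ hs2 (v := 1) rfl (by simp; omega) fun hs3 => ?_
  refine Ok.setReg_seq hQ hs3 (v := 0) rfl (by simp) fun hs4 => ?_
  refine Ok.setReg_seq hQ hs4 (v := 0) rfl (by simp) fun hs5 => ?_
  set s5 := (((s1.setReg 24 ((o / r.σ : ℕ) : ℤ)).setReg 17 1).setReg 25 0).setReg 26 0 with e5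
  have hf5 : Frame [24, 17, 25, 26] [] s1 s5 :=
    ((Frame.setReg s1 24 ((o / r.σ : ℕ) : ℤ) [24, 17, 25, 26] [] (by simp)).trans
      (Frame.setReg _ 17 1 _ _ (by simp))).trans
      ((Frame.setReg _ 25 0 _ _ (by simp)).trans (Frame.setReg _ 26 0 _ _ (by simp)))
  have hi5 : r.Input s5 := hi1.of_frame hf5
  have hd5 : r.Dims s5 := hd1.of_frame hf5
  have r5 : s5.reg 23 = o := (hf5.reg 23).trans hr1
  refine Ok.seq hQ (mid := fun s' =>
    s'.reg 25 = ((∑ j ∈ range r.k, r.entry (o % r.σ) (o / r.σ) j * r.data.M ^ j : ℕ) : ℤ) ∧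
    s'.reg 26 = ((∑ j ∈ range r.k, r.entry (o % r.σ) (o / r.σ) j : ℕ) : ℤ)) ?_ ?_
  -- Register 24 holds the column type with its i lowest base-(σ + 1) digits stripped, register 17
  -- the power M^i; code and distance sum are accumulated up to coordinate i.
  · refine Ok.forLoop hQ (fun i s' =>
        s'.reg 24 = ((o / r.σ / (r.σ + 1) ^ i.toNat : ℕ) : ℤ) ∧
        s'.reg 17 = ((r.data.M ^ i.toNat : ℕ) : ℤ) ∧
        s'.reg 25 =
          ((∑ j ∈ range i.toNat, r.entry (o % r.σ) (o / r.σ) j * r.data.M ^ j : ℕ) : ℤ) ∧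
        s'.reg 26 = ((∑ j ∈ range i.toNat, r.entry (o % r.σ) (o / r.σ) j : ℕ) : ℤ))
      (A := 0) hs5 rfl hi5.reg_k (by simp) ?_ (by simp) (fun _ _ _ h => h) (by simp [e5]) ?_ ?_
    · have := hr.k_le; push_cast; omega
    · rintro i s6 h0 hk hs6 hr6 hf6 ⟨h24, h17, h25, h26⟩
      lift i to ℕ using h0
      simp only [Int.toNat_natCast] at h24 h17 h25 h26
      have hi6 : r.Input s6 := hi5.of_frame hf6
      have hd6 : r.Dims s6 := hd5.of_frame hf6
      have r6 : s6.reg 23 = o := (hf6.reg 23).trans r5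
      have hik : i + 1 ≤ r.k := by omega
      rw [show ((i : ℤ) + 1).toNat = i + 1 by omega]
      have hDle := hr.D_le
      have hent : r.entry (o % r.σ) (o / r.σ) i ≤ r.D := entry_le hfσ
      refine Ok.setReg_seq hQ hs6 (v := r.entry (o % r.σ) (o / r.σ) i) ?_
        (hcast _ (by omega)) fun hs7 => ?_
      · simp only [Expr.eval_cell, Expr.eval_add, Expr.eval_mul, Expr.eval_mod, Expr.eval_reg,
          Expr.eval_one, r6, hi6.reg_σ, h24]
        rw [entry, ← hi6.tab]
        push_cast
        rfl
      refine Ok.setReg_seq hQ hs7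
        (v := ((∑ j ∈ range (i + 1), r.entry (o % r.σ) (o / r.σ) j * r.data.M ^ j : ℕ) : ℤ)) ?_
        (hcast _ (by have := hr.sum_entry_pow_le (c := o / r.σ) hfσ hik; omega)) fun hs8 => ?_
      · simp [h25, h17, sum_range_succ]
      refine Ok.setReg_seq hQ hs8
        (v := ((∑ j ∈ range (i + 1), r.entry (o % r.σ) (o / r.σ) j : ℕ) : ℤ)) ?_
        (hcast _ (by have := hr.sum_entry_le (c := o / r.σ) hfσ hik; omega)) fun hs9 => ?_
      · simp [h26, sum_range_succ]
      refine Ok.setReg_seq hQ hs9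
        (v := ((o / r.σ / (r.σ + 1) ^ (i + 1) : ℕ) : ℤ)) ?_
        (hcast _ (by have := Nat.div_le_self (o / r.σ) ((r.σ + 1) ^ (i + 1)); omega)) fun hs10 => ?_
      · rw [pow_succ, ← Nat.div_div_eq_div_mul]
        simp [h24, hi6.reg_σ]
      have e : ∀ t : State, t.reg 17 = s6.reg 17 → t.reg 8 = s6.reg 8 →
          (Expr.reg 17 * Expr.reg 8).eval t = ((r.data.M ^ (i + 1) : ℕ) : ℤ) := fun t h1 h2 => by
        simp [h1, h2, h17, hd6.M, pow_succ]
      refine Ok.setReg hQ hs10 ?_ ?_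
      · rw [e _ (by simp) (by simp)]
        exact hcast _ (by have := pow_le (r := r) hik; omega)
      · rw [e _ (by simp) (by simp)]
        simp
    · rintro s6 - - ⟨-, -, h25, h26⟩
      exact ⟨by simpa using h25, by simpa using h26⟩
  rintro s6 hs6 hf6 ⟨h25, h26⟩
  have r6 : s6.reg 23 = o := (hf6.reg 23).trans r5
  have hi6 : r.Input s6 := hi5.of_frame hf6
  have a6 : s6.arr = s1.arr := by
    funext a
    rw [hf6.2 a (by simp [Program.forLoop, Program.arrs])]
    simp [e5]
  have hw : r.data.w o = r.b * ∑ j ∈ range r.k, r.entry (o % r.σ) (o / r.σ) j := if_pos ho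
  have hwle : r.data.w o ≤ r.data.R := by
    rw [hw]
    have := Nat.mul_le_mul hr.b_le (hr.sum_entry_le (c := o / r.σ) hfσ le_rfl)
    omega
  have hty : r.data.ty o = o / r.σ := if_pos ho
  refine Ok.setCell_seq hQ hs6 (z := o) (v := r.data.g o) (by simp [r6])
    (by rw [g_of_lt ho, ← h25]; rfl) ?_ fun hs7 => ?_
  · rw [g_of_lt ho]
    exact hcast _ (by have := hr.sum_entry_pow_le (c := o / r.σ) hfσ le_rfl; omega)
  refine Ok.setCell_seq hQ hs7 (z := o) (v := r.data.w o) (by simp [r6])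
    (by simp [hi6.reg_b, h26, hw]) (hcast _ (by omega)) fun hs8 => ?_
  have e7 : (Expr.reg 23 / Expr.reg 1).eval
      ((s6.setCell 5 o (r.data.g o)).setCell 6 o (r.data.w o)) = r.data.ty o := by
    simp [r6, hi6.reg_σ, hty]
  refine Ok.setCell hQ hs8 ?_ ?_
  · rw [e7, hty]; exact hcast _ (by omega)
  · rw [e7]
    refine Stored.update h1 ?_ ?_ ?_ <;> simp [a6, r6]

/-- Compute the code, the cost and the class of the other options. -/
def slackOptions : Program :=
  .setReg 17 1 ;;
  .forLoop 23 (.reg 14) 6 (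
    .setReg 27 (.reg 23 - .reg 14) ;;
    .setCell 5 (.reg 23) ((.bin .eq (.reg 27 % 3) 0 - 1) * .reg 17) ;;
    .setCell 6 (.reg 23) 0 ;;
    .setCell 7 (.reg 23) (.reg 4 + 2 * (.reg 27 / 3) + .bin .eq (.reg 27 % 3) 2) ;;
    .cond (.bin .eq (.reg 27 % 3) 2) (.setReg 17 (.reg 17 * .reg 8)) .skip)

/-- Three consecutive options belong to one input string, so the current power of M is multiplied by
M after every third option. -/
theorem ok_slackOptions (hr : r.Good Q) (hs : s.Bdd Q) (hd : r.Dims s)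
    (h : r.Stored (r.n * r.σ : ℕ) s) :
    Ok Q (2 * r.data.R + 2) slackOptions s (r.Stored r.data.O) := by
  have hQ := hr.le_Q
  have hR := hr.R_le
  have hcast : ∀ a : ℕ, a ≤ 2 * r.data.R → |((a : ℕ) : ℤ)| ≤ (Q : ℤ) := fun a ha => by
    rw [Nat.abs_cast]; exact_mod_cast (by omega)
  have hOle := hr.O_le
  have hO : r.data.O = r.n * r.σ + 3 * r.k := rfl
  refine Ok.setReg_seq hQ hs (v := 1) rfl (by simp; omega) fun hs0 => ?_
  have hd0 : r.Dims (s.setReg 17 1) := hd.of_frame (Frame.setReg s 17 1 [17] [] (by simp))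
  refine Ok.forLoop hQ (fun i s' => r.Stored i s' ∧
      s'.reg 17 = ((r.data.M ^ ((i.toNat - r.n * r.σ) / 3) : ℕ) : ℤ))
    (A := (r.n * r.σ : ℕ)) hs0 hd0.nσ hd0.O (by rw [hO]; push_cast; omega) ?_
    (hcast _ (by have := hr.nσ_le; omega)) (fun _ _ _ h => h) ⟨h, by simp⟩ ?_ fun s' _ _ h => h.1
  · push_cast; omega
  rintro o s1 h0 ho hs1 hr1 hf1 ⟨h1, h17⟩
  obtain ⟨q, rfl⟩ : ∃ q : ℕ, o = ((r.n * r.σ + q : ℕ) : ℤ) :=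
    ⟨(o - (r.n * r.σ : ℕ)).toNat, by push_cast at *; omega⟩
  have hq : q < 3 * r.k := by
    rw [hO] at ho
    have : r.n * r.σ + q < r.n * r.σ + 3 * r.k := by exact_mod_cast ho
    omega
  simp only [Int.toNat_natCast, Nat.add_sub_cancel_left] at h17
  have hd1 : r.Dims s1 := hd0.of_frame hf1
  have hsub : ((r.n * r.σ + q : ℕ) : ℤ) - ((r.n * r.σ : ℕ) : ℤ) = q := by push_cast; ring
  have hpow : r.data.M ^ (q / 3) ≤ r.data.R := pow_le (by omega)
  have hty : r.data.ty (r.n * r.σ + q) = r.n + 2 * (q / 3) + if q % 3 = 2 then 1 else 0 := by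
    show ite _ _ _ = _
    rw [if_neg (by omega), Nat.add_sub_cancel_left]
  have hw : r.data.w (r.n * r.σ + q) = 0 := if_neg (by omega)
  have hcond : ∀ a : ℕ, (((q : ℤ) % 3 = a) ↔ q % 3 = a) := fun a => by omega
  refine Ok.setReg_seq hQ hs1 (v := q) ?_ (hcast _ (by omega)) fun hs2 => ?_
  · simp only [Expr.eval_sub, Expr.eval_reg, hr1, hd1.nσ, hsub]
  refine Ok.setCell_seq hQ hs2 (z := ((r.n * r.σ + q : ℕ) : ℤ)) (v := r.data.g (r.n * r.σ + q))
    (by simpa using hr1) ?_ ?_ fun hs3 => ?_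
  · rw [g_of_ge hq]
    have := hcond 0
    simp only [Nat.cast_zero] at this
    simp [h17, this]
  · rw [g_of_ge hq, abs_mul]
    have h2 := hcast _ (show r.data.M ^ (q / 3) ≤ 2 * r.data.R by omega)
    push_cast at h2
    split_ifs
    · simp
    · simpa using h2
  refine Ok.setCell_seq hQ hs3 (z := ((r.n * r.σ + q : ℕ) : ℤ)) (v := r.data.w (r.n * r.σ + q))
    (by simpa using hr1) (by simp [hw]) (by simp [hw]) fun hs4 => ?_
  refine Ok.setCell_seq hQ hs4 (z := ((r.n * r.σ + q : ℕ) : ℤ)) (v := r.data.ty (r.n * r.σ + q))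
    (by simpa using hr1) ?_ (hcast _ ?_) fun hs5 => ?_
  · rw [hty]
    have := hcond 2
    simp only [Nat.cast_ofNat] at this
    simp [hd1.n, this]
  · have := (hr.N_le)
    have hN : r.data.N = r.n + 2 * r.k := rfl
    rw [hty]
    split_ifs <;> omega
  set s5 := (((s1.setReg 27 q).setCell 5 ((r.n * r.σ + q : ℕ) : ℤ) (r.data.g (r.n * r.σ + q))).setCell
    6 ((r.n * r.σ + q : ℕ) : ℤ) (r.data.w (r.n * r.σ + q))).setCell 7 ((r.n * r.σ + q : ℕ) : ℤ)
    (r.data.ty (r.n * r.σ + q)) with e5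
  have h5 : r.Stored ((r.n * r.σ + q : ℕ) + 1) s5 := by
    refine Stored.update h1 ?_ ?_ ?_ <;> simp [e5]
  have e27 : s5.reg 27 = q := by simp [e5]
  have e17 : s5.reg 17 = ((r.data.M ^ (q / 3) : ℕ) : ℤ) := by rw [← h17]; simp [e5]
  have e8 : s5.reg 8 = r.data.M := by rw [← hd1.M]; simp [e5]
  rw [show (((r.n * r.σ + q : ℕ) : ℤ) + 1).toNat - r.n * r.σ = q + 1 by omega]
  refine Ok.cond hQ hs5 (fun hc => ?_) fun hc => ?_
  · have hc' : q % 3 = 2 := by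
      by_contra hne
      refine hc ?_
      simp only [Expr.eval_eq, Expr.eval_mod, Expr.eval_reg, Expr.eval_three, Expr.eval_two, e27]
      exact if_neg fun h => hne (by omega)
    have e : (Expr.reg 17 * Expr.reg 8).eval s5 = ((r.data.M ^ ((q + 1) / 3) : ℕ) : ℤ) := by
      rw [show (q + 1) / 3 = q / 3 + 1 by omega]
      simp [e17, e8, pow_succ]
    refine Ok.setReg hQ hs5 ?_ ?_
    · rw [e]
      exact hcast _ (by have := pow_le (r := r) (i := (q + 1) / 3) (by omega); omega)
    · rw [e]
      exact ⟨h5, by simp⟩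
  · have hc' : q % 3 ≠ 2 := by
      intro hne
      simp only [Expr.eval_eq, Expr.eval_mod, Expr.eval_reg, Expr.eval_three, Expr.eval_two,
        e27] at hc
      rw [if_pos (by omega)] at hc
      exact one_ne_zero hc
    refine Ok.skip hs5 ⟨h5, ?_⟩
    rw [e17, show (q + 1) / 3 = q / 3 by omega]

/-- Compute the multiplicities of the other classes; register `15` becomes `0` if some lower bound
exceeds the upper bound. -/
def slackMultiplicities : Program :=
  .setReg 15 1 ;;
  .forLoop 20 0 0 (
    .setReg 28 (.cell 2 (.reg 20)) ;;
    .cond (.bin .lt (.reg 13) (.reg 28)) (.setReg 28 (.reg 13)) .skip ;;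
    .cond (.bin .lt (.reg 28) (.cell 1 (.reg 20))) (.setReg 15 0) .skip ;;
    .setCell 3 (.reg 4 + 2 * .reg 20) (.reg 28 - .cell 1 (.reg 20)) ;;
    .setCell 3 (.reg 4 + 2 * .reg 20 + 1) (.cell 1 (.reg 20)))

theorem ok_slackMultiplicities (hr : r.Good Q) (hs : s.Bdd Q) (hi : r.Input s) (hd : r.Dims s) :
    Ok Q (2 * r.data.R + 2) slackMultiplicities s fun s' =>
      (s'.reg 15 = 1 ∧ (∀ i < r.k, r.lo i ≤ r.top i) ∧
        ∀ τ < r.data.N, s'.arr 3 (τ : ℕ) = r.data.m τ) ∨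
      (s'.reg 15 = 0 ∧ ∃ i < r.k, r.top i < r.lo i) := by
  have hQ := hr.le_Q
  refine Ok.setReg_seq hQ hs (v := 1) rfl (by simp; omega) fun hs0 => ?_
  have hd0 : r.Dims (s.setReg 15 1) := hd.of_frame (Frame.setReg s 15 1 [15] [] (by simp))
  have hi0 : r.Input (s.setReg 15 1) := hi.of_frame (Frame.setReg s 15 1 [15] [] (by simp))
  -- Once some lower bound exceeds the cut-off upper bound, the flag stays 0 and nothing is claimed
  -- about the multiplicities, which may then be negative.
  refine Ok.forLoop hQ (fun i s' =>
      (s'.reg 15 = 1 ∧ (∀ j < r.k, (j : ℤ) < i → r.lo j ≤ r.top j) ∧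
        ∀ τ : ℕ, (τ : ℤ) < r.n + 2 * i → s'.arr 3 (τ : ℕ) = r.data.m τ) ∨
      (s'.reg 15 = 0 ∧ ∃ j < r.k, r.top j < r.lo j))
    (A := 0) hs0 rfl hi0.reg_k (by simp) ?_ (by simp) (fun _ _ _ h => h) ?_ ?_ ?_
  · have := hr.k_le; push_cast; omega
  · refine Or.inl ⟨by simp, fun j _ h => by omega, fun τ hτ => ?_⟩
    have h1 : τ < r.n := by omega
    have h2 : r.data.m τ = r.mult τ := if_pos h1
    rw [h2, hi0.mult]
  · rintro i s1 h0 hk hs1 hr1 hf1 h1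
    lift i to ℕ using h0
    have hik : i < r.k := by exact_mod_cast hk
    have hd1 : r.Dims s1 := hd0.of_frame hf1
    have elo : s1.arr 1 i = r.lo i := by rw [hf1.arr 1]; exact hi0.lo i
    have ehi : s1.arr 2 i = r.hi i := by rw [hf1.arr 2]; exact hi0.hi i
    refine Ok.setReg_seq hQ hs1 (v := r.hi i) (by simp [hr1, ehi]) (by rw [← ehi]; exact hs1.2 _ _)
      fun hs2 => ?_
    refine Ok.seq hQ (mid := fun s' => s'.reg 28 = r.top i) ?_ ?_
    · refine Ok.cond hQ hs2 (fun hc => ?_) fun hc => ?_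
      · refine Ok.setReg hQ hs2 (hs2.1 13) ?_
        have : r.D * r.L < r.hi i := by
          by_contra hn
          refine hc ?_
          simp only [Expr.eval_lt, Expr.eval_reg, State.setReg_reg]
          norm_num [hd1.DL]
          exact_mod_cast not_lt.1 hn
        simp [hd1.DL, top, min_eq_right this.le]
      · refine Ok.skip hs2 ?_
        have : r.hi i ≤ r.D * r.L := by
          by_contra hn
          simp only [Expr.eval_lt, Expr.eval_reg, State.setReg_reg] at hc
          norm_num [hd1.DL] at hc
          exact hn (by exact_mod_cast hc)
        simp [top, min_eq_left this]
    intro s3 hs3 hf3 h28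
    have hf13 : Frame [28] [] s1 s3 := (Frame.setReg s1 28 (r.hi i) [28] [] (by simp)).trans hf3
    have r3 : s3.reg 20 = i := (hf13.reg 20).trans hr1
    have a3 : s3.arr = s1.arr := by funext a; exact hf13.2 a (by simp)
    have r15 : s3.reg 15 = s1.reg 15 := hf13.reg 15
    have r4 : s3.reg 4 = r.n := (hf13.reg 4).trans hd1.n
    refine Ok.seq hQ (mid := fun s' => (s'.reg 15 = s1.reg 15 ∧ r.lo i ≤ r.top i) ∨
      (s'.reg 15 = 0 ∧ r.top i < r.lo i)) ?_ ?_
    · refine Ok.cond hQ hs3 (fun hc => ?_) fun hc => ?_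
      · refine Ok.setReg hQ hs3 (by simp) (Or.inr ⟨by simp, ?_⟩)
        by_contra hn
        refine hc ?_
        simp only [Expr.eval_lt, Expr.eval_cell, Expr.eval_reg, r3, h28, a3, elo]
        exact if_neg (by exact_mod_cast hn)
      · refine Ok.skip hs3 (Or.inl ⟨r15, ?_⟩)
        by_contra hn
        simp only [Expr.eval_lt, Expr.eval_cell, Expr.eval_reg, r3, h28, a3, elo] at hc
        rw [if_pos (by exact_mod_cast not_le.1 hn)] at hc
        exact one_ne_zero hc
    intro s4 hs4 hf4 h4
    have f20 : s4.reg 20 = i := (hf4.reg 20).trans r3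
    have f28 : s4.reg 28 = r.top i := (hf4.reg 28).trans h28
    have f4 : s4.reg 4 = r.n := (hf4.reg 4).trans r4
    have f3 : s4.arr = s1.arr := by
      funext a; rw [hf4.2 a (by simp [Program.arrs]), a3]
    have hloQ := hs1.2 1 i
    have hDL := hr.DL_le
    have htop : r.top i ≤ r.D * r.L := min_le_right _ _
    refine Ok.setCell_seq hQ hs4 (z := r.n + 2 * i) (v := r.top i - r.lo i)
      (by simp [f20, f4]) (by simp [f20, f28, f3, elo]) ?_ fun hs5 => ?_
    · rw [elo, abs_le] at hloQ
      rw [abs_le]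
      omega
    have e5 : (Expr.cell 1 (.reg 20)).eval (s4.setCell 3 (r.n + 2 * i) (r.top i - r.lo i)) =
        r.lo i := by simp [f20, f3, elo]
    have e5' : (Expr.reg 4 + 2 * .reg 20 + 1).eval
        (s4.setCell 3 (r.n + 2 * i) (r.top i - r.lo i)) = r.n + 2 * i + 1 := by simp [f20, f4]
    refine Ok.setCell hQ hs5 (by rw [e5, ← elo]; exact hloQ) ?_
    rw [e5, e5']
    simp only [State.setCell_reg]
    by_cases hle : r.lo i ≤ r.top i
    · have h15 : s4.reg 15 = s1.reg 15 := by
        rcases h4 with h4 | h4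
        · exact h4.1
        · omega
      rw [h15]
      refine h1.imp ?_ id
      rintro ⟨g1, g2, g3⟩
      refine ⟨g1, fun j hj hji => ?_, fun τ hτ => ?_⟩
      · by_cases hjeq : j = i
        · rw [hjeq]; exact hle
        · exact g2 j hj (by omega)
      · simp only [State.setCell_arr, if_true, f3]
        by_cases t1 : τ = r.n + 2 * i + 1
        · subst t1
          have hm : r.data.m (r.n + 2 * i + 1) = r.lo i := by
            show ite _ _ _ = _
            rw [if_neg (by omega), if_pos (by omega), if_neg (by omega)]
            congr 1
            omega
          rw [hm]
          push_cast
          rw [Function.update_self]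
        · rw [Function.update_of_ne (by omega)]
          by_cases t2 : τ = r.n + 2 * i
          · subst t2
            have hm : r.data.m (r.n + 2 * i) = r.top i - r.lo i := by
              show ite _ _ _ = _
              rw [if_neg (by omega), if_pos (by omega), if_pos (by omega),
                show (r.n + 2 * i - r.n) / 2 = i by omega]
            rw [hm, Nat.cast_sub hle]
            push_cast
            rw [Function.update_self]
          · rw [Function.update_of_ne (by omega)]
            exact g3 τ (by omega)
    · right
      rcases h4 with h4 | h4
      · exact absurd h4.2 hle
      · exact ⟨h4.1, i, hik, h4.2⟩
  · rintro s1 - - h1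
    refine h1.imp ?_ id
    rintro ⟨g1, g2, g3⟩
    refine ⟨g1, fun j hj => g2 j hj (by omega), fun τ hτ => g3 τ ?_⟩
    have : τ < r.n + 2 * r.k := hτ
    omega

/-- The complete preprocessing. -/
def prepare : Program :=
  countTypes ;; dimensions ;; letterOptions ;; slackOptions ;; slackMultiplicities

theorem ok_prepare (hr : r.Good Q) (hs : s.Bdd Q) (hi : r.Input s) :
    Ok Q (2 * r.data.R + 2) prepare s fun s' => r.Dims s' ∧
      ((s'.reg 15 = 1 ∧ (∀ i < r.k, r.lo i ≤ r.top i) ∧ r.data.Loaded s') ∨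
      (s'.reg 15 = 0 ∧ ∃ i < r.k, r.top i < r.lo i)) := by
  have hQ := hr.le_Q
  refine Ok.seq hQ (ok_countTypes hr hs hi) ?_
  rintro s1 hs1 hf1 ⟨h4, h5⟩
  have hi1 : r.Input s1 := hi.of_frame hf1
  refine Ok.seq hQ (ok_dimensions hr hs1 hi1 h4 h5) fun s2 hs2 hf2 hd2 => ?_
  have hi2 : r.Input s2 := hi1.of_frame hf2
  refine Ok.seq hQ (ok_letterOptions hr hs2 hi2 hd2) fun s3 hs3 hf3 h3 => ?_
  have hi3 : r.Input s3 := hi2.of_frame hf3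
  have hd3 : r.Dims s3 := hd2.of_frame hf3
  refine Ok.seq hQ (ok_slackOptions hr hs3 hd3 h3) fun s4 hs4 hf4 h4 => ?_
  have hi4 : r.Input s4 := hi3.of_frame hf4
  have hd4 : r.Dims s4 := hd3.of_frame hf4
  refine (ok_slackMultiplicities hr hs4 hi4 hd4).frame.imp ?_
  rintro s5 - ⟨hf5, h⟩
  have hd5 : r.Dims s5 := hd4.of_frame hf5
  refine ⟨hd5, h.imp ?_ id⟩
  rintro ⟨h15, hlo, hm⟩
  refine ⟨h15, hlo, ⟨⟨hd5.O, hd5.R, hd5.R1⟩, (hf5.reg 0).trans hi4.reg_k, hd5.E, hd5.M, hd5.N,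
    hd5.offset, hm, ?_, ?_, ?_⟩⟩
  · intro o ho; rw [hf5.arr 5]; exact (h4 o (by exact_mod_cast ho)).1
  · intro o ho; rw [hf5.arr 6]; exact (h4 o (by exact_mod_cast ho)).2.1
  · intro o ho; rw [hf5.arr 7]; exact (h4 o (by exact_mod_cast ho)).2.2

end Raw

end WordRAM

/-! ### The complete algorithm and its logarithmic loops -/

namespace WordRAM

/-- Like `Ok`, with the time bound multiplied by `J`. -/
def OkTimes (J Q G : ℕ) (p : Program) (s : State) (post : State → Prop) : Prop :=
  ∃ t s', Runs (Q ^ p.exprCost) p s t s' ∧ t ≤ J * p.time G ∧ s'.Bdd Q ∧ post s'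

section OkTimes
variable {J Q G : ℕ} {p q : Program} {s : State} {post mid : State → Prop}

theorem Ok.okTimes (hJ : 0 < J) (h : Ok Q G p s post) : OkTimes J Q G p s post := by
  obtain ⟨t, s', hr, ht, hb, hp⟩ := h
  exact ⟨t, s', hr, ht.trans (Nat.le_mul_of_pos_left _ hJ), hb, hp⟩

theorem OkTimes.seq (hQ : 16 ≤ Q) (hp : OkTimes J Q G p s mid)
    (hq : ∀ s', s'.Bdd Q → Frame p.regs p.arrs s s' → mid s' → OkTimes J Q G q s' post) :
    OkTimes J Q G (p ;; q) s post := by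
  obtain ⟨t, s', hr, ht, hb, hm⟩ := hp
  obtain ⟨t', s'', hr', ht', hb', hm'⟩ := hq s' hb hr.frame hm
  refine ⟨t + t', s'', .seq (hr.mono (Nat.pow_le_pow_right (by omega) (le_max_left _ _)))
    (hr'.mono (Nat.pow_le_pow_right (by omega) (le_max_right _ _))), ?_, hb', hm'⟩
  simp only [Program.time]
  rw [mul_add]
  exact add_le_add ht ht'

theorem OkTimes.cond (hQ : 16 ≤ Q) (hJ : 0 < J) {e : Expr} (hs : s.Bdd Q)
    (hp : e.eval s ≠ 0 → OkTimes J Q G p s post) (hq : e.eval s = 0 → OkTimes J Q G q s post)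
    (hl : e.smallLits := by rfl) : OkTimes J Q G (.cond e p q) s post := by
  have he : e.Fits (Q ^ (Program.cond e p q).exprCost) s :=
    e.fits_of_bdd hQ hs hl (Nat.pow_le_pow_right (by omega) (le_max_left _ _))
  have hc : e.cost + 1 ≤ J * (e.cost + 1) := Nat.le_mul_of_pos_left _ hJ
  by_cases h : e.eval s = 0
  · obtain ⟨t, s', hr, ht, hb, hm⟩ := hq h
    refine ⟨_, s', .condFalse he h (hr.mono (Nat.pow_le_pow_right (by omega) ?_)), ?_, hb, hm⟩
    · simp [Program.exprCost]
    · simp only [Program.time]; rw [mul_add, mul_add J (p.time G)]; omega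
  · obtain ⟨t, s', hr, ht, hb, hm⟩ := hp h
    refine ⟨_, s', .condTrue he h (hr.mono (Nat.pow_le_pow_right (by omega) ?_)), ?_, hb, hm⟩
    · simp [Program.exprCost]
    · simp only [Program.time]; rw [mul_add, mul_add J (p.time G)]; omega

/-- The body has to satisfy `Ok`, not `OkTimes`: loops with up to J - 1 iterations are never nested,
so the factor J appears only once. -/
theorem OkTimes.loop (hQ : 16 ≤ Q) {e : Expr} (inv : ℕ → State → Prop) {j : ℕ} (hj : j < J)
    (hs : s.Bdd Q) (hi : inv j s) (hexit : ∀ s, inv 0 s → e.eval s = 0)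
    (hstep : ∀ j s, s.Bdd Q → inv (j + 1) s → e.eval s ≠ 0 ∧ Ok Q G p s (inv j))
    (hl : e.smallLits := by rfl) : OkTimes J Q G (.loop e p) s (inv 0) := by
  obtain ⟨t, s', hr, ht, hb, hi'⟩ := runs_loop hQ (T := p.time G) hl inv hexit hstep j s hs hi
  refine ⟨t, s', hr, ht.trans ?_, hb, hi'⟩
  simp only [Program.time]
  exact Nat.mul_le_mul hj (Nat.le_mul_of_pos_left _ (by omega))

end OkTimes

namespace Raw

variable {r : Raw} {Q : ℕ} {s : State}

/-- Write the answer. -/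
def finish : Program :=
  .cond (.cell 8 0) (.forLoop 23 0 14 (.setCell 4 (.reg 23) (.cell 9 (.reg 23))) ;; .setReg 0 1)
    (.setReg 0 0)

/-- The complete algorithm. -/
def solve : Program :=
  prepare ;;
  .cond (.reg 15)
    (.setCell 8 0 1 ;;
      .setReg 16 1 ;;
      .loop (.bin .lt (.reg 16) (.reg 13 + 1)) (.setReg 16 (2 * .reg 16)) ;;
      .loop (.bin .lt 1 (.reg 16)) Data.level ;;
      finish)
    (.setReg 0 0)

/-- The balanced vectors with the right class sums: they correspond to the feasible strings. -/
def balanced (r : Raw) : Set (ℕ → ℕ) :=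
  {x ∈ withSums r.data.O r.data.ty r.data.m | ∀ i < r.k, code r.data.O (r.data.v i) x = 0}

/-- The final state holds an optimal balanced vector, or there is none. -/
def Answer (r : Raw) (s : State) : Prop :=
  (s.reg 0 = 0 ∧ ((∃ i < r.k, r.top i < r.lo i) ∨ r.balanced = ∅)) ∨
  (s.reg 0 = 1 ∧ (∀ i < r.k, r.lo i ≤ r.top i) ∧ ∃ x ∈ r.balanced,
    (∀ y ∈ r.balanced, cost r.data.O r.data.w x ≤ cost r.data.O r.data.w y) ∧
    ∀ o < r.n * r.σ, s.arr 4 (o : ℕ) = x o)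

/-- By uniqueness of digits, a vector of the window has code 0 only if all its coordinates vanish.
So the balanced vectors are exactly those behind the entry 0 of the last table. -/
theorem mem_balanced_iff {x : ℕ → ℕ} :
    x ∈ r.balanced ↔ x ∈ r.data.levelSet 1 ∧ code r.data.O r.data.g x = 0 := by
  have hm : (fun τ => r.data.m τ / 1) = r.data.m := by funext τ; exact Nat.div_one _
  simp only [Data.levelSet, hm]
  constructor
  · rintro ⟨h1, h2⟩
    refine ⟨⟨h1, fun i hi => by rw [h2 i hi]; simp⟩, ?_⟩
    rw [Data.code_g]
    exact sum_eq_zero fun i hi => by rw [h2 i (mem_range.1 hi), zero_mul]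
  · rintro ⟨⟨h1, h2⟩, h3⟩
    refine ⟨h1, digits_unique (M := r.data.M) (E := r.data.E) (by rw [Data.M]; push_cast; omega)
      r.k _ (fun _ => 0) (fun i hi => (h2 i hi).trans (by omega)) (by simp) ?_⟩
    rw [Data.code_g] at h3
    simp only [zero_mul, sum_const_zero]
    exact h3

theorem ok_finish (hr : r.Good Q) (hs : s.Bdd Q) (hd : r.Dims s)
    (hlo : ∀ i < r.k, r.lo i ≤ r.top i) (hrep : r.data.Represents s 8 9 (r.data.levelSet 1)) :
    Ok Q (2 * r.data.R + 2) finish s r.Answer := by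
  have hQ := hr.le_Q
  refine Ok.cond hQ hs (fun h => ?_) fun h => ?_
  · obtain ⟨x, hx, hcx, hvx, hsx⟩ := hrep.1 0 (by simp) h
    refine Ok.seq hQ (mid := fun s' => ∀ o < r.n * r.σ, s'.arr 4 (o : ℕ) = x o) ?_ ?_
    · refine Ok.forLoop hQ (fun i s' => ∀ o < r.n * r.σ, (o : ℤ) < i → s'.arr 4 (o : ℕ) = x o)
        (A := 0) hs rfl hd.nσ (by positivity) ?_ (by simp) (fun _ _ _ h => h)
        (fun o _ h => by omega) ?_ ?_
      · have := hr.nσ_le; rw [sub_zero]; exact_mod_cast (by omega)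
      · intro i s1 h0 hi hs1 hr1 hf1 h1
        refine Ok.setCell hQ hs1 (hs1.2 _ _) fun o ho hoi => ?_
        simp only [State.setCell_arr, if_true, Expr.eval_reg, Expr.eval_cell, hr1, hf1.arr 9,
          Function.update_apply]
        split_ifs with h2
        · rw [← h2, ← hsx o (ho.trans_le (Nat.le_add_right _ _))]
          simp
        · exact h1 o ho (by omega)
      · intro s1 _ _ h1 o ho
        exact h1 o ho (by exact_mod_cast ho)
    · intro s1 hs1 _ h1
      refine Ok.setReg hQ hs1 (by simp; omega) (Or.inr ⟨by simp, hlo, x, ?_, fun y hy => ?_, h1⟩)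
      · exact mem_balanced_iff.2 ⟨hx, hcx⟩
      · obtain ⟨hy1, hy2⟩ := mem_balanced_iff.1 hy
        have := (hrep.2 y hy1).2.2
        rw [hy2, ← hvx] at this
        omega
  · refine Ok.setReg hQ hs (by simp) (Or.inl ⟨by simp, Or.inr ?_⟩)
    rw [Set.eq_empty_iff_forall_notMem]
    intro y hy
    obtain ⟨hy1, hy2⟩ := mem_balanced_iff.1 hy
    have := (hrep.2 y hy1).2.1
    rw [hy2] at this
    exact this h

/-- Thanks to the cut-off in `top` the number of levels depends on D·L and not on the size of the
given bounds. -/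
theorem mult_le_DL (hr : r.Good Q) (hlo : ∀ i < r.k, r.lo i ≤ r.top i) (τ : ℕ) :
    r.data.m τ ≤ r.D * r.L := by
  have h2 : r.L ≤ r.D * r.L := Nat.le_mul_of_pos_left _ r.D_pos
  have h1 : ∀ i, r.top i ≤ r.D * r.L := fun i => min_le_right _ _
  show ite _ _ _ ≤ _
  split_ifs with h3 h4 h5
  · exact (hr.mult_le τ).trans h2
  · exact (Nat.sub_le _ _).trans (h1 _)
  · exact (hlo _ (by omega)).trans (h1 _)
  · omega

theorem ok_solve (hr : r.Good Q) (hs : s.Bdd Q) (hi : r.Input s) (h8 : s.arr 8 = fun _ => 0)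
    (h9 : s.arr 9 = fun _ => 0) :
    OkTimes (Nat.size (r.D * r.L) + 1) Q (2 * r.data.R + 2) solve s r.Answer := by
  have hQ := hr.le_Q
  set J := Nat.size (r.D * r.L) with hJ
  refine OkTimes.seq hQ ((ok_prepare hr hs hi).okTimes (by omega)) ?_
  rintro s1 hs1 hf1 ⟨hd1, h1⟩
  refine OkTimes.cond hQ (by omega) hs1 (fun hc => ?_) fun hc => ?_
  swap
  · rw [Expr.eval_reg] at hc
    refine Ok.okTimes (by omega) (Ok.setReg hQ hs1 (by simp) (Or.inl ⟨by simp, Or.inl ?_⟩))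
    rcases h1 with h1 | h1
    · omega
    · exact h1.2
  rw [Expr.eval_reg] at hc
  obtain ⟨hlo, hl1⟩ : (∀ i < r.k, r.lo i ≤ r.top i) ∧ r.data.Loaded s1 := by
    rcases h1 with h1 | h1
    · exact h1.2
    · exact absurd h1.1 hc
  have hfit := hr.fits hlo
  -- Since D·L < 2^J, all class sums on this level are 0 and only the zero vector remains. Its code
  -- is 0 and its value is cost + 1 = 1; its row is already zero in the initial memory.
  have hinit : r.data.Represents (s1.setCell 8 0 1) 8 9 (r.data.levelSet (2 ^ J)) := by
    have hm : (fun τ => r.data.m τ / 2 ^ J) = 0 := by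
      funext τ
      exact Nat.div_eq_of_lt ((mult_le_DL hr hlo τ).trans_lt (Nat.lt_size_self _))
    have hset : r.data.levelSet (2 ^ J) = {0} := by
      rw [Data.levelSet, hm]
      ext x
      rw [window, withSums_zero]
      constructor
      · exact fun h => h.1
      · rintro rfl
        exact ⟨rfl, fun i _ => by simp [code]⟩
    rw [hset]
    have e8 : (s1.setCell 8 0 1).arr 8 = Function.update (fun _ => 0) 0 1 := by
      simp [hf1.arr 8, h8]
    have e9 : (s1.setCell 8 0 1).arr 9 = fun _ => 0 := by
      simp [hf1.arr 9, h9]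
    rw [Data.Represents, e8, e9]
    refine ⟨fun z _ hv => ⟨0, rfl, ?_⟩, ?_⟩
    · have hz : z = 0 := by
        by_contra hz
        rw [Function.update_of_ne hz] at hv
        exact hv rfl
      subst hz
      simp [code, cost]
    · rintro _ rfl
      simp [code, cost]
  refine OkTimes.seq hQ (mid := fun s' => s' = s1.setCell 8 0 1)
    (Ok.okTimes (by omega) (Ok.setCell hQ hs1 (by simp; omega) rfl)) ?_
  rintro s2 hs2 hf2 rfl
  have hd2 : r.Dims (s1.setCell 8 0 1) := hd1.of_frame hf2
  have hl2 : r.data.Loaded (s1.setCell 8 0 1) := hl1.of_frame hf2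
  refine OkTimes.seq hQ (mid := fun s' => s' = (s1.setCell 8 0 1).setReg 16 1)
    (Ok.okTimes (by omega) (Ok.setReg hQ hs2 (by simp; omega) rfl)) ?_
  rintro s3 hs3 hf3 rfl
  have hd3 : r.Dims ((s1.setCell 8 0 1).setReg 16 1) := hd2.of_frame hf3
  have hl3 : r.data.Loaded ((s1.setCell 8 0 1).setReg 16 1) := hl2.of_frame hf3
  have hsize : ∀ i < J, 2 ^ i ≤ r.D * r.L := fun i hi => Nat.lt_size.1 hi
  -- Doubling finds the least power of two above D·L, which is 2^J with J the binary length of D·L;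
  -- the previous powers are at most D·L.
  refine OkTimes.seq hQ (OkTimes.loop hQ (fun j s' => j ≤ J ∧ s'.reg 16 = ((2 ^ (J - j) : ℕ) : ℤ) ∧
    s'.reg 13 = (r.D * r.L : ℕ)) (j := J) (by omega) hs3 ⟨le_rfl, by simp, hd3.DL⟩ ?_ ?_) ?_
  · rintro s4 ⟨-, h4, h5⟩
    have h6 : r.D * r.L < 2 ^ J := Nat.lt_size_self _
    simp only [Expr.eval_lt, Expr.eval_reg, Expr.eval_add, Expr.eval_one, h4, h5, Nat.sub_zero]
    exact if_neg (by exact_mod_cast (by omega : ¬ 2 ^ J < r.D * r.L + 1))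
  · rintro j s4 hs4 ⟨hj, h4, h5⟩
    have h6 := hsize (J - (j + 1)) (by omega)
    have e : (2 * Expr.reg 16).eval s4 = ((2 ^ (J - j) : ℕ) : ℤ) := by
      rw [show J - j = J - (j + 1) + 1 by omega, pow_succ']
      simp [h4]
    refine ⟨?_, Ok.setReg hQ hs4 ?_ ⟨by omega, by rw [e]; simp, by simpa using h5⟩⟩
    · simp only [Expr.eval_lt, Expr.eval_reg, Expr.eval_add, Expr.eval_one, h4, h5]
      rw [if_pos (by exact_mod_cast Nat.lt_succ_of_le h6)]
      exact one_ne_zero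
    · rw [e, Nat.abs_cast, show J - j = J - (j + 1) + 1 by omega, pow_succ']
      have := hr.DL_le
      exact_mod_cast (by omega : 2 * 2 ^ (J - (j + 1)) ≤ Q)
  rintro s4 hs4 hf4 ⟨-, h4, -⟩
  rw [Nat.sub_zero] at h4
  have hd4 : r.Dims s4 := hd3.of_frame hf4
  have hl4 : r.data.Loaded s4 := hl3.of_frame hf4
  have hrep4 : r.data.Represents s4 8 9 (r.data.levelSet (2 ^ J)) := by
    rw [Data.Represents, hf4.arr 8, hf4.arr 9]
    exact hinit
  refine OkTimes.seq hQ (OkTimes.loop hQ (fun j s' => s'.reg 16 = ((2 ^ j : ℕ) : ℤ) ∧ r.Dims s' ∧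
    r.data.Loaded s' ∧ r.data.Represents s' 8 9 (r.data.levelSet (2 ^ j))) (j := J) (by omega) hs4
    ⟨h4, hd4, hl4, hrep4⟩ ?_ ?_) ?_
  · rintro s5 ⟨h5, -⟩
    simp [h5]
  · rintro j s5 hs5 ⟨h5, hd5, hl5, hrep5⟩
    refine ⟨?_, ?_⟩
    · simp only [Expr.eval_lt, Expr.eval_reg, Expr.eval_one, h5]
      rw [if_pos (by exact_mod_cast Nat.one_lt_two_pow (by omega : j + 1 ≠ 0))]
      exact one_ne_zero
    · rw [pow_succ'] at h5 hrep5
      refine (Data.ok_level hfit hs5 hl5 (h := 2 ^ j) (by rw [h5]; push_cast; rfl)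
        hrep5).frame.imp ?_
      rintro s6 - ⟨hf6, h6, hrep6⟩
      exact ⟨h6, hd5.of_frame hf6, hl5.of_frame hf6, hrep6⟩
  rintro s5 hs5 - ⟨-, hd5, -, hrep5⟩
  exact (ok_finish hr hs5 hd5 hlo hrep5).okTimes (by omega)

end Raw

end WordRAM

/-! ### Balanced vectors as equations for the letter counts -/

namespace WordRAM

theorem sum_range_mul {α : Type*} [AddCommMonoid α] (F : ℕ → α) (n σ : ℕ) :
    ∑ o ∈ range (n * σ), F o = ∑ c ∈ range n, ∑ f ∈ range σ, F (c * σ + f) := by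
  induction n with
  | zero => simp
  | succ n ih => rw [sum_range_succ, ← ih, Nat.succ_mul, sum_range_add]

theorem vecArray_natCast {n : ℕ} (f : Fin n → ℕ) (a : ℤ) :
    vecArray (fun i => (f i : ℤ)) a =
      ((if h : 0 ≤ a ∧ a.toNat < n then f ⟨a.toNat, h.2⟩ else 0 : ℕ) : ℤ) := by
  rw [vecArray]
  split_ifs <;> simp

theorem vecArray_of_lt {n : ℕ} (f : Fin n → ℤ) {a : ℕ} (h : a < n) :
    vecArray f a = f ⟨a, h⟩ := by
  rw [vecArray, dif_pos ⟨by omega, by simpa using h⟩]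
  simp

namespace Raw

variable {r : Raw}

theorem sum_options {α : Type*} [AddCommMonoid α] (F : ℕ → α) :
    ∑ o ∈ range r.data.O, F o = ∑ c ∈ range r.n, ∑ f ∈ range r.σ, F (c * r.σ + f) +
      ∑ j ∈ range r.k, (F (r.n * r.σ + 3 * j) + F (r.n * r.σ + 3 * j + 1) +
        F (r.n * r.σ + 3 * j + 2)) := by
  show ∑ o ∈ range (r.n * r.σ + 3 * r.k), F o = _
  rw [sum_range_add, sum_range_mul, mul_comm 3, sum_range_mul]
  congr 1
  refine sum_congr rfl fun j _ => ?_
  rw [sum_range_succ, sum_range_succ, sum_range_one]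
  simp only [mul_comm j 3, add_assoc, add_zero]

theorem letter_lt {c f : ℕ} (hc : c < r.n) (hf : f < r.σ) : c * r.σ + f < r.n * r.σ := by
  nlinarith

theorem letter_div {c f : ℕ} (hf : f < r.σ) : (c * r.σ + f) / r.σ = c := by
  rw [mul_comm, Nat.mul_add_div (by omega), Nat.div_eq_of_lt hf, add_zero]

theorem letter_mod {c f : ℕ} (hf : f < r.σ) : (c * r.σ + f) % r.σ = f := by
  rw [mul_comm, Nat.mul_add_mod, Nat.mod_eq_of_lt hf]

theorem ty_letter {c f : ℕ} (hc : c < r.n) (hf : f < r.σ) : r.data.ty (c * r.σ + f) = c := by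
  show ite _ _ _ = c
  rw [if_pos (letter_lt hc hf), letter_div hf]

theorem ty_slack (q : ℕ) : r.data.ty (r.n * r.σ + q) =
    r.n + 2 * (q / 3) + if q % 3 = 2 then 1 else 0 := by
  show ite _ _ _ = _
  rw [if_neg (by omega), Nat.add_sub_cancel_left]

/-- The total distance to the `i`-th string of the letters counted by `x`. -/
def letterSum (r : Raw) (x : ℕ → ℕ) (i : ℕ) : ℕ :=
  ∑ c ∈ range r.n, ∑ f ∈ range r.σ, x (c * r.σ + f) * r.entry f c i

/-- Of the slack options only the last two of string i touch coordinate i, each with value -1. -/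
theorem code_coord (x : ℕ → ℕ) {i : ℕ} (hi : i < r.k) :
    code r.data.O (r.data.v i) x = (r.letterSum x i : ℤ) -
      (x (r.n * r.σ + 3 * i + 1) + x (r.n * r.σ + 3 * i + 2)) := by
  rw [code, sum_options, sub_eq_add_neg]
  congr 1
  · rw [letterSum]
    push_cast
    refine sum_congr rfl fun c hc => sum_congr rfl fun f hf => ?_
    rw [mem_range] at hc hf
    congr 1
    show ite _ _ _ = _
    rw [if_pos (letter_lt hc hf), letter_div hf, letter_mod hf]
  · have hv : ∀ q, r.data.v i (r.n * r.σ + q) = if q / 3 = i ∧ q % 3 ≠ 0 then -1 else 0 := by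
      intro q
      show ite _ _ _ = _
      rw [if_neg (by omega), Nat.add_sub_cancel_left]
    rw [sum_eq_single_of_mem i (mem_range.2 hi)]
    · rw [add_assoc _ _ 1, add_assoc _ _ 2, hv, hv, hv, if_neg (by omega), if_pos (by omega),
        if_pos (by omega)]
      ring
    · intro j _ hj
      rw [add_assoc _ _ 1, add_assoc _ _ 2, hv, hv, hv, if_neg (by omega), if_neg (by omega),
        if_neg (by omega)]
      ring

theorem cost_eq (x : ℕ → ℕ) :
    cost r.data.O r.data.w x = r.b * ∑ i ∈ range r.k, r.letterSum x i := by
  have hw : ∀ q, r.data.w (r.n * r.σ + q) = 0 := fun q => if_neg (by omega)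
  rw [cost, sum_options]
  simp only [add_assoc, hw, mul_zero, sum_const_zero, add_zero]
  have hs : ∑ i ∈ range r.k, r.letterSum x i = ∑ c ∈ range r.n, ∑ f ∈ range r.σ,
      x (c * r.σ + f) * ∑ i ∈ range r.k, r.entry f c i := by
    simp only [letterSum, mul_sum]
    rw [sum_comm]
    exact sum_congr rfl fun c _ => sum_comm
  rw [hs, mul_sum]
  refine sum_congr rfl fun c hc => ?_
  rw [mul_sum]
  refine sum_congr rfl fun f hf => ?_
  rw [mem_range] at hc hf
  have : r.data.w (c * r.σ + f) = r.b * ∑ i ∈ range r.k, r.entry f c i := by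
    show ite _ _ _ = _
    rw [if_pos (letter_lt hc hf), letter_div hf, letter_mod hf]
  rw [this]
  ring

theorem classSum_letter (x : ℕ → ℕ) {c : ℕ} (hc : c < r.n) :
    classSum r.data.O r.data.ty x c = ∑ f ∈ range r.σ, x (c * r.σ + f) := by
  rw [classSum, sum_options, sum_eq_single_of_mem c (mem_range.2 hc)]
  · rw [sum_eq_zero (s := range r.k), add_zero]
    · refine sum_congr rfl fun f hf => ?_
      rw [if_pos (ty_letter hc (mem_range.1 hf))]
    · intro j _
      rw [add_assoc _ _ 1, add_assoc _ _ 2, ty_slack, ty_slack, ty_slack, if_neg (by omega),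
        if_neg (by omega), if_neg (by omega)]
      rfl
  · intro c' hc' hne
    refine sum_eq_zero fun f hf => ?_
    rw [ty_letter (mem_range.1 hc') (mem_range.1 hf), if_neg hne]

theorem classSum_slack (x : ℕ → ℕ) (τ : ℕ) :
    classSum r.data.O r.data.ty x (r.n + τ) = if τ < 2 * r.k then
      if τ % 2 = 0 then x (r.n * r.σ + 3 * (τ / 2)) + x (r.n * r.σ + 3 * (τ / 2) + 1)
      else x (r.n * r.σ + 3 * (τ / 2) + 2) else 0 := by
  rw [classSum, sum_options, sum_eq_zero (s := range r.n), zero_add]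
  · have key : ∀ j, ((if r.data.ty (r.n * r.σ + 3 * j) = r.n + τ then x (r.n * r.σ + 3 * j) else 0) +
        (if r.data.ty (r.n * r.σ + 3 * j + 1) = r.n + τ then x (r.n * r.σ + 3 * j + 1) else 0) +
        (if r.data.ty (r.n * r.σ + 3 * j + 2) = r.n + τ then x (r.n * r.σ + 3 * j + 2) else 0)) =
        if j = τ / 2 then (if τ % 2 = 0 then x (r.n * r.σ + 3 * (τ / 2)) +
          x (r.n * r.σ + 3 * (τ / 2) + 1) else x (r.n * r.σ + 3 * (τ / 2) + 2)) else 0 := by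
      intro j
      rw [add_assoc _ (3 * j) 1, add_assoc _ (3 * j) 2, ty_slack, ty_slack, ty_slack]
      have e1 : (3 * j) / 3 = j ∧ (3 * j) % 3 = 0 := by omega
      have e2 : (3 * j + 1) / 3 = j ∧ (3 * j + 1) % 3 = 1 := by omega
      have e3 : (3 * j + 2) / 3 = j ∧ (3 * j + 2) % 3 = 2 := by omega
      simp only [e1, e2, e3]
      by_cases h1 : j = τ / 2
      · rw [if_pos h1]
        subst h1
        simp only [add_assoc]
        split_ifs <;> first | omega | contradiction
      · rw [if_neg h1]
        split_ifs <;> omega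
    simp only [key]
    rw [sum_ite_eq']
    simp only [mem_range]
    exact if_congr (by omega) rfl rfl
  · intro c hc
    refine sum_eq_zero fun f hf => ?_
    rw [ty_letter (mem_range.1 hc) (mem_range.1 hf), if_neg]
    have := mem_range.1 hc
    omega

theorem m_letter {c : ℕ} (hc : c < r.n) : r.data.m c = r.mult c := if_pos hc

theorem m_slack (τ : ℕ) : r.data.m (r.n + τ) = if τ < 2 * r.k then
    if τ % 2 = 0 then r.top (τ / 2) - r.lo (τ / 2) else r.lo (τ / 2) else 0 := by
  show ite _ _ _ = _
  rw [if_neg (by omega), Nat.add_sub_cancel_left]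
  exact if_congr (by omega) rfl rfl

/-- The slack entries exist precisely when the distance to string i lies between `lo i` and `top i`,
provided `lo i ≤ top i`. This form is what is compared with strings. -/
theorem mem_balanced {x : ℕ → ℕ} : x ∈ r.balanced ↔ (∀ o, r.data.O ≤ o → x o = 0) ∧
    (∀ c < r.n, ∑ f ∈ range r.σ, x (c * r.σ + f) = r.mult c) ∧
    ∀ i < r.k, x (r.n * r.σ + 3 * i) + x (r.n * r.σ + 3 * i + 1) = r.top i - r.lo i ∧
      x (r.n * r.σ + 3 * i + 2) = r.lo i ∧
      r.letterSum x i = x (r.n * r.σ + 3 * i + 1) + x (r.n * r.σ + 3 * i + 2) := by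
  constructor
  · rintro ⟨⟨h1, h2⟩, h3⟩
    refine ⟨h1, fun c hc => by rw [← classSum_letter x hc, h2, m_letter hc], fun i hi => ?_⟩
    have e1 := h2 (r.n + 2 * i)
    have e2 := h2 (r.n + (2 * i + 1))
    have e3 := h3 i hi
    rw [classSum_slack, m_slack, if_pos (by omega), if_pos (by omega), if_pos (by omega),
      if_pos (by omega), show 2 * i / 2 = i by omega] at e1
    rw [classSum_slack, m_slack, if_pos (by omega), if_neg (by omega), if_pos (by omega),
      if_neg (by omega), show (2 * i + 1) / 2 = i by omega] at e2
    rw [code_coord x hi] at e3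
    exact ⟨e1, e2, by omega⟩
  · rintro ⟨h1, h2, h3⟩
    refine ⟨⟨h1, fun τ => ?_⟩, fun i hi => ?_⟩
    · by_cases hτ : τ < r.n
      · rw [classSum_letter x hτ, m_letter hτ, h2 τ hτ]
      · obtain ⟨τ, rfl⟩ := Nat.exists_eq_add_of_le (not_lt.1 hτ)
        rw [classSum_slack, m_slack]
        split_ifs with t1 t2
        · exact (h3 _ (by omega)).1
        · exact (h3 _ (by omega)).2.1
        · rfl
    · rw [code_coord x hi, (h3 i hi).2.2]
      push_cast
      ring

end Raw

end WordRAM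

/-! ### Translation between strings and balanced vectors -/

namespace MultiStrings

open WordRAM

variable (I : MultiStrings)

/-- The input of the machine in terms of natural numbers. -/
def raw : Raw where
  k := I.k
  σ := I.σ
  L := I.L
  b := I.b.toNat
  tab a := (I.input.arr 0 a).toNat
  lo a := (I.input.arr 1 a).toNat
  hi a := (I.input.arr 2 a).toNat
  mult a := (I.input.arr 3 a).toNat

theorem input_arr_zero : I.input.arr 0 = vecArray fun a : Fin (I.σ * (I.σ + 1)) =>
    ((I.δ [(finProdFinEquiv.symm a).1] [finSuccEquiv I.σ (finProdFinEquiv.symm a).2] : ℕ) : ℤ) :=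
  rfl

theorem input_arr_one : I.input.arr 1 = vecArray fun i => (I.lo i : ℤ) := rfl

theorem input_arr_two : I.input.arr 2 = vecArray fun i => (I.hi i : ℤ) := rfl

theorem input_arr_three : I.input.arr 3 =
    vecArray fun a => (I.multiplicity (I.columnIndex.symm a) : ℤ) := rfl

theorem input_arr_nonneg (i : ℕ) (a : ℤ) : 0 ≤ I.input.arr i a := by
  have h : ∀ {n : ℕ} (f : Fin n → ℕ), 0 ≤ vecArray (fun i => (f i : ℤ)) a := fun f => by
    rw [vecArray_natCast]; exact Int.natCast_nonneg _
  match i with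
  | 0 => rw [input_arr_zero]; exact h _
  | 1 => rw [input_arr_one]; exact h _
  | 2 => rw [input_arr_two]; exact h _
  | 3 => rw [input_arr_three]; exact h fun c => I.multiplicity (I.columnIndex.symm c)
  | _ + 4 => exact le_rfl

theorem raw_input : I.raw.Input I.input where
  reg_k := rfl
  reg_σ := rfl
  reg_L := rfl
  reg_b := rfl
  tab a := (Int.toNat_of_nonneg (I.input_arr_nonneg 0 a)).symm
  lo a := (Int.toNat_of_nonneg (I.input_arr_nonneg 1 a)).symm
  hi a := (Int.toNat_of_nonneg (I.input_arr_nonneg 2 a)).symm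
  mult a := (Int.toNat_of_nonneg (I.input_arr_nonneg 3 a)).symm

theorem raw_lo (i : Fin I.k) : I.raw.lo i = I.lo i := by
  simp only [raw]
  rw [input_arr_one, vecArray_of_lt _ i.2]
  simp

theorem raw_hi (i : Fin I.k) : I.raw.hi i = I.hi i := by
  simp only [raw]
  rw [input_arr_two, vecArray_of_lt _ i.2]
  simp

theorem raw_mult (c : Fin ((I.σ + 1) ^ I.k)) :
    I.raw.mult c = I.multiplicity (I.columnIndex.symm c) := by
  simp only [raw]
  rw [input_arr_three, vecArray_of_lt _ c.2]
  simp

theorem raw_tab (f : Fin I.σ) (e : Fin (I.σ + 1)) :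
    I.raw.tab (f * (I.σ + 1) + e) = I.δ [f] [finSuccEquiv I.σ e] := by
  have h : (f : ℕ) * (I.σ + 1) + e = (finProdFinEquiv (f, e) : ℕ) := by
    show _ = (e : ℕ) + (I.σ + 1) * f
    ring
  simp only [raw]
  rw [input_arr_zero, h, vecArray_of_lt _ (finProdFinEquiv (f, e)).2]
  simp only [Fin.eta, Equiv.symm_apply_apply, Int.toNat_natCast]

theorem raw_entry (f : Fin I.σ) (c : Fin ((I.σ + 1) ^ I.k)) (i : Fin I.k) :
    I.raw.entry f c i = I.δ [f] [I.columnIndex.symm c i] :=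
  I.raw_tab f (finFunctionFinEquiv.symm c i)

theorem raw_mult_le (c : ℕ) : I.raw.mult c ≤ I.L := by
  by_cases hc : c < (I.σ + 1) ^ I.k
  · rw [I.raw_mult ⟨c, hc⟩, multiplicity]
    exact (card_filter_le _ _).trans (by simp)
  · have : I.raw.mult c = 0 := by
      simp only [raw]
      rw [input_arr_three, vecArray, dif_neg (by simpa using hc)]
      rfl
    omega

variable {I}

theorem dist_eq_sum (hδ : IsCharacterwiseWildcardCompatible I.δ) (y : Fin I.L → Fin I.σ)
    (i : Fin I.k) : I.dist y i = ∑ j, I.δ [y j] [I.column j i] :=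
  hδ.1 I.L y (I.s i)

/-- Group the positions j by the pair of the column type and the letter of y; the distance is
constant on each group. So distances depend only on the succinct representation. -/
theorem dist_eq (hδ : IsCharacterwiseWildcardCompatible I.δ) (y : Fin I.L → Fin I.σ)
    (i : Fin I.k) : I.dist y i =
      ∑ c, ∑ f, I.solutionMultiplicity y (I.columnIndex.symm c) f *
        I.δ [f] [I.columnIndex.symm c i] := by
  classical
  rw [dist_eq_sum hδ, Equiv.sum_comp I.columnIndex.symm
    (fun c => ∑ f, I.solutionMultiplicity y c f * I.δ [f] [c i]),
    ← Fintype.sum_prod_type' (fun c f => I.solutionMultiplicity y c f * I.δ [f] [c i]),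
    ← sum_fiberwise univ (fun j => (I.column j, y j))]
  refine sum_congr rfl fun p _ => ?_
  rw [sum_congr rfl (g := fun _ => I.δ [p.2] [p.1 i]) (fun j hj => ?_), sum_const, smul_eq_mul]
  · congr 1
    rw [solutionMultiplicity]
    congr 1
    ext j
    simp [Prod.ext_iff]
  · rw [mem_filter] at hj
    rw [← hj.2]

/-- This justifies cutting off the upper bounds at D·L: no feasible string is lost. -/
theorem dist_le (hδ : IsCharacterwiseWildcardCompatible I.δ) (y : Fin I.L → Fin I.σ)
    (i : Fin I.k) : I.dist y i ≤ I.raw.D * I.L := by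
  rw [dist_eq_sum hδ]
  refine (sum_le_card_nsmul _ _ I.raw.D fun j _ => ?_).trans (by simp [mul_comm])
  have := I.raw_entry (y j) (I.columnIndex (I.column j)) i
  rw [Equiv.symm_apply_apply] at this
  rw [← this]
  exact Raw.entry_le (y j).2

/-- The vector `x` counts the letters of `y` in the columns of each type. -/
def Counts (y : Fin I.L → Fin I.σ) (x : ℕ → ℕ) : Prop :=
  ∀ (c : Fin ((I.σ + 1) ^ I.k)) (f : Fin I.σ),
    x (c * I.σ + f) = I.solutionMultiplicity y (I.columnIndex.symm c) f

theorem Counts.letterSum (hδ : IsCharacterwiseWildcardCompatible I.δ) {y : Fin I.L → Fin I.σ}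
    {x : ℕ → ℕ} (h : Counts y x) (i : Fin I.k) : I.raw.letterSum x i = I.dist y i := by
  rw [dist_eq hδ, Raw.letterSum]
  show ∑ c ∈ range ((I.σ + 1) ^ I.k), ∑ f ∈ range I.σ, x (c * I.σ + f) * _ = _
  rw [sum_range]
  refine sum_congr rfl fun c _ => ?_
  rw [sum_range]
  refine sum_congr rfl fun f _ => ?_
  rw [h, raw_entry]

theorem Counts.cost (hδ : IsCharacterwiseWildcardCompatible I.δ) {y : Fin I.L → Fin I.σ}
    {x : ℕ → ℕ} (h : Counts y x) : WordRAM.cost I.raw.data.O I.raw.data.w x = I.objective y := by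
  rw [Raw.cost_eq, objective]
  show I.b.toNat * ∑ i ∈ range I.k, _ = _
  rw [sum_range]
  congr 1
  exact sum_congr rfl fun i _ => h.letterSum hδ i

theorem sum_solutionMultiplicity (y : Fin I.L → Fin I.σ) (c : I.ColumnType) :
    ∑ f, I.solutionMultiplicity y c f = I.multiplicity c := by
  classical
  rw [multiplicity, card_eq_sum_card_fiberwise (f := y) (t := univ) (fun _ _ => by simp)]
  refine sum_congr rfl fun f _ => ?_
  rw [solutionMultiplicity, filter_filter]

theorem exists_balanced (hδ : IsCharacterwiseWildcardCompatible I.δ) {y : Fin I.L → Fin I.σ}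
    (hy : I.Feasible y) : ∃ x ∈ I.raw.balanced, Counts y x := by
  classical
  set cnt : ℕ → ℕ → ℕ := fun c f => if h : c < (I.σ + 1) ^ I.k ∧ f < I.σ then
    I.solutionMultiplicity y (I.columnIndex.symm ⟨c, h.1⟩) ⟨f, h.2⟩ else 0 with hcnt
  set ds : ℕ → ℕ := fun i => if h : i < I.k then I.dist y ⟨i, h⟩ else 0 with hds
  set n := (I.σ + 1) ^ I.k with hn
  -- The slack entries are forced by the distances: `top - dist` unused, `dist - lo` used, and `lo`
  -- units of the lower bound.
  set x : ℕ → ℕ := fun o => if o < n * I.σ then cnt (o / I.σ) (o % I.σ) else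
    if (o - n * I.σ) / 3 < I.k then
      if (o - n * I.σ) % 3 = 0 then
        I.raw.top ((o - n * I.σ) / 3) - ds ((o - n * I.σ) / 3)
      else if (o - n * I.σ) % 3 = 1 then
        ds ((o - n * I.σ) / 3) - I.raw.lo ((o - n * I.σ) / 3)
      else I.raw.lo ((o - n * I.σ) / 3)
    else 0 with hx
  have hcounts : Counts y x := by
    intro c f
    have h1 : (c : ℕ) * I.σ + f < n * I.σ := Raw.letter_lt (r := I.raw) c.2 f.2
    have h2 : ((c : ℕ) * I.σ + f) / I.σ = c := Raw.letter_div (r := I.raw) f.2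
    have h3 : ((c : ℕ) * I.σ + f) % I.σ = f := Raw.letter_mod (r := I.raw) f.2
    simp only [hx, h1, if_true, h2, h3, hcnt]
    rw [dif_pos ⟨c.2, f.2⟩]
  refine ⟨x, Raw.mem_balanced.2 ⟨fun o ho => ?_, fun c hc => ?_, fun i hi => ?_⟩, hcounts⟩
  · have ho : n * I.σ + 3 * I.k ≤ o := ho
    simp only [hx]
    rw [if_neg (by omega), if_neg (by omega)]
  · have hc : c < (I.σ + 1) ^ I.k := hc
    rw [I.raw_mult ⟨c, hc⟩, ← sum_solutionMultiplicity y]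
    show ∑ f ∈ range I.σ, x (c * I.σ + f) = _
    rw [sum_range]
    exact sum_congr rfl fun f _ => hcounts ⟨c, hc⟩ f
  · have hi : i < I.k := hi
    have hdist : ds i = I.dist y ⟨i, hi⟩ := dif_pos hi
    have hlo : I.raw.lo i ≤ ds i := by
      rw [hdist, I.raw_lo ⟨i, hi⟩]; exact (hy _).1
    have htop : ds i ≤ I.raw.top i := by
      rw [hdist, Raw.top, I.raw_hi ⟨i, hi⟩]
      exact le_min (hy _).2 (dist_le hδ y _)
    have hq : ∀ a < 3, (n * I.σ + 3 * i + a - n * I.σ) / 3 = i ∧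
        (n * I.σ + 3 * i + a - n * I.σ) % 3 = a := fun a ha => by omega
    have e0 : x (n * I.σ + 3 * i) = I.raw.top i - ds i := by
      have := hq 0 (by omega)
      rw [add_zero] at this
      simp only [hx, this]
      rw [if_neg (by omega), if_pos hi, if_pos trivial]
    have e1 : x (n * I.σ + 3 * i + 1) = ds i - I.raw.lo i := by
      simp only [hx, hq 1 (by omega)]
      rw [if_neg (by omega), if_pos hi, if_neg (by omega), if_pos trivial]
    have e2 : x (n * I.σ + 3 * i + 2) = I.raw.lo i := by
      simp only [hx, hq 2 (by omega)]
      rw [if_neg (by omega), if_pos hi, if_neg (by omega), if_neg (by omega)]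
    show x (n * I.σ + 3 * i) + x (n * I.σ + 3 * i + 1) = _ ∧ x (n * I.σ + 3 * i + 2) = _ ∧
      _ = x (n * I.σ + 3 * i + 1) + x (n * I.σ + 3 * i + 2)
    rw [e0, e1, e2, hcounts.letterSum hδ ⟨i, hi⟩, ← hdist]
    omega

/-- A string with prescribed letter counts. -/
theorem exists_string {x : ℕ → ℕ} (hx : x ∈ I.raw.balanced) :
    ∃ y : Fin I.L → Fin I.σ, Counts y x := by
  classical
  -- The class sum of c is the number of columns of type c, so these columns can be matched with
  -- slots, x(c, f) of them labelled by each letter f. The string y reads off the label.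
  have hex : ∀ c : I.ColumnType, Nonempty ({j // I.column j = c} ≃
      Σ f : Fin I.σ, Fin (x (I.columnIndex c * I.σ + f))) := by
    intro c
    refine ⟨Fintype.equivOfCardEq ?_⟩
    rw [Fintype.card_sigma, Fintype.card_subtype]
    simp only [Fintype.card_fin]
    have h1 := (Raw.mem_balanced.1 hx).2.1 (I.columnIndex c) (I.columnIndex c).2
    rw [I.raw_mult, Equiv.symm_apply_apply, multiplicity] at h1
    rw [← h1]
    show ∑ f ∈ range I.σ, x (I.columnIndex c * I.σ + f) = _
    rw [sum_range]
  obtain ⟨e⟩ := Classical.nonempty_pi.2 hex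
  set y : Fin I.L → Fin I.σ := fun j => (e (I.column j) ⟨j, rfl⟩).1 with hy
  have hyj : ∀ c' j (h : I.column j = c'), y j = (e c' ⟨j, h⟩).1 := by
    rintro _ j rfl
    rfl
  refine ⟨y, fun c f => ?_⟩
  set c' := I.columnIndex.symm c with hc'
  have hc : I.columnIndex c' = c := by simp [hc']
  have hcard : I.solutionMultiplicity y c' f =
      Fintype.card {p : Σ f : Fin I.σ, Fin (x (I.columnIndex c' * I.σ + f)) // p.1 = f} := by
    rw [solutionMultiplicity, ← Fintype.card_subtype]
    refine Fintype.card_congr ⟨fun j => ⟨e c' ⟨j.1, j.2.1⟩, (hyj c' j.1 j.2.1).symm.trans j.2.2⟩,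
      fun p => ⟨((e c').symm p.1).1, ((e c').symm p.1).2, ?_⟩, fun j => ?_, fun p => ?_⟩
    · rw [hyj c' _ ((e c').symm p.1).2]
      simp [p.2]
    · simp
    · simp
  rw [hcard, Fintype.card_congr (Equiv.sigmaSubtype f), Fintype.card_fin, hc]

end MultiStrings

namespace MultiStrings

open WordRAM

variable {I : MultiStrings}

/-! ### Correctness of the answer -/

/-- A negative answer is right because every feasible string has distances between `lo` and `top`
and yields a balanced vector. Optimality carries over because the cost of a vector is the objective
of every string that it counts. -/
theorem correctOutput (hδ : IsCharacterwiseWildcardCompatible I.δ) {t : State}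
    (h : I.raw.Answer t) : I.CorrectOutput t := by
  rcases h with ⟨h0, h⟩ | ⟨h1, hlo, x, hx, hmin, hout⟩
  · refine Or.inl ⟨h0, fun y hy => ?_⟩
    rcases h with ⟨i, hi, hlt⟩ | h
    · have hi : i < I.k := hi
      have h1 := hy ⟨i, hi⟩
      have h2 := dist_le hδ y ⟨i, hi⟩
      rw [Raw.top, I.raw_lo ⟨i, hi⟩, I.raw_hi ⟨i, hi⟩] at hlt
      exact absurd (h1.1.trans (le_min h1.2 h2)) (not_le.2 hlt)
    · obtain ⟨x, hx, -⟩ := exists_balanced hδ hy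
      rw [h] at hx
      exact hx
  · obtain ⟨y, hy⟩ := exists_string hx
    refine Or.inr ⟨h1, y, ⟨fun i => ?_, fun z hz => ?_⟩, fun c f => ?_⟩
    · obtain ⟨e1, e2, e3⟩ := (Raw.mem_balanced.1 hx).2.2 i i.2
      have h2 := hlo i i.2
      have h3 : I.raw.top i ≤ I.raw.hi i := min_le_left _ _
      rw [hy.letterSum hδ] at e3
      rw [← I.raw_lo, ← I.raw_hi]
      omega
    · obtain ⟨x', hx', hz'⟩ := exists_balanced hδ hz
      rw [← hy.cost hδ, ← hz'.cost hδ]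
      exact hmin x' hx'
    · have h2 : (finProdFinEquiv (I.columnIndex c, f) : ℕ) = (I.columnIndex c : ℕ) * I.σ + f := by
        show (f : ℕ) + I.σ * (I.columnIndex c : ℕ) = _
        ring
      have h3 := hout _ (Raw.letter_lt (r := I.raw) (I.columnIndex c).2 f.2)
      have h4 := hy (I.columnIndex c) f
      rw [Equiv.symm_apply_apply] at h4
      rw [h2, ← h4]
      exact h3

/-! ### Bounds in terms of the parameters -/

/-- K only takes distances between letters into account; the wildcard entries are 0 by
compatibility. -/
theorem tab_le (hδ : IsCharacterwiseWildcardCompatible I.δ) (a : ℕ) : I.raw.tab a ≤ I.K := by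
  by_cases ha : a < I.σ * (I.σ + 1)
  · have : I.raw.tab a = I.δ [(finProdFinEquiv.symm ⟨a, ha⟩).1]
        [finSuccEquiv I.σ (finProdFinEquiv.symm ⟨a, ha⟩).2] := by
      simp only [raw]
      rw [input_arr_zero, vecArray_of_lt _ ha, Int.toNat_natCast]
    rw [this]
    generalize (finProdFinEquiv.symm ⟨a, ha⟩).1 = e
    generalize finSuccEquiv I.σ (finProdFinEquiv.symm ⟨a, ha⟩).2 = f
    cases f with
    | none => rw [hδ.2]; exact Nat.zero_le _
    | some f =>
      exact (le_sup (f := fun p : Fin I.σ × Fin I.σ => I.δ [p.1] [some p.2])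
        (mem_univ (e, f))).trans (le_max_right _ _)
  · have : I.raw.tab a = 0 := by
      simp only [raw]
      rw [input_arr_zero, vecArray, dif_neg (by simpa using ha)]
      rfl
    omega

theorem σ_le_K (I : MultiStrings) : I.σ ≤ I.K := (le_max_left _ _).trans (le_max_left _ _)

theorem k_le_K (I : MultiStrings) : I.k ≤ I.K := (le_max_right _ _).trans (le_max_left _ _)

/-- With P = K + 1 ≥ 2, constants are absorbed into powers of P: D ≤ P^3, O ≤ P^(k+3), E ≤ P^(k+7)
and M ≤ 16·P^(k+7) ≤ P^(k+11) ≤ P^(14k). The k-th power of M gives the exponent 14k². -/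
theorem R_le (hk : 0 < I.k) (hδ : IsCharacterwiseWildcardCompatible I.δ) :
    I.raw.data.R ≤ (I.K + 1) ^ (14 * I.k ^ 2) := by
  have hσ := I.σ_le_K
  have hk' := I.k_le_K
  set P := I.K + 1 with hP
  have hP2 : 2 ≤ P := by omega
  have hD : I.raw.D ≤ P ^ 3 := by
    have h1 : ∑ a ∈ range (I.σ * (I.σ + 1)), I.raw.tab a ≤ I.σ * (I.σ + 1) * I.K := by
      refine (sum_le_card_nsmul _ _ I.K fun a _ => tab_le hδ a).trans ?_
      simp
    have h2 : I.σ * (I.σ + 1) * I.K ≤ I.K * P * I.K :=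
      Nat.mul_le_mul_right _ (Nat.mul_le_mul hσ (by omega))
    have h3 : I.raw.D = 1 + ∑ a ∈ range (I.σ * (I.σ + 1)), I.raw.tab a := rfl
    have h4 : 1 + I.K * P * I.K ≤ P ^ 3 := by rw [hP]; ring_nf; nlinarith [I.K.zero_le]
    omega
  have hn : I.raw.n ≤ P ^ I.k := Nat.pow_le_pow_left (by show I.σ + 1 ≤ P; omega) _
  have hPk : P ≤ P ^ I.k := Nat.le_self_pow hk.ne' _
  have hO : I.raw.data.O ≤ P ^ (I.k + 3) := by
    have h1 : I.raw.data.O = I.raw.n * I.σ + 3 * I.k := rfl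
    have h2 : I.raw.n * I.σ ≤ P ^ I.k * P := Nat.mul_le_mul hn (by omega)
    have h3 : 3 * I.k ≤ P ^ I.k * (P + 1) := by
      calc 3 * I.k ≤ P * 3 := by omega
        _ ≤ P ^ I.k * (P + 1) := Nat.mul_le_mul hPk (by omega)
    have h4 : P ^ I.k * P + P ^ I.k * (P + 1) ≤ P ^ (I.k + 3) := by
      rw [pow_add, ← mul_add]
      refine Nat.mul_le_mul_left _ ?_
      have : P ^ 3 = P * P * P := by ring
      nlinarith
    omega
  have hE : I.raw.data.E ≤ P ^ (I.k + 7) := by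
    have h1 : I.raw.data.E = 2 * (I.raw.data.O * I.raw.D) := rfl
    rw [h1, show I.k + 7 = 1 + ((I.k + 3) + 3) by ring, pow_add P 1, pow_one, pow_add P (I.k + 3)]
    exact Nat.mul_le_mul hP2 (Nat.mul_le_mul hO hD)
  have hM : I.raw.data.M ≤ P ^ (14 * I.k) := by
    have h1 : I.raw.data.M = 8 * I.raw.data.E + 1 := rfl
    have h2 : 1 ≤ P ^ (I.k + 7) := Nat.one_le_pow _ _ (by omega)
    have h3 : P ^ (I.k + 11) = P ^ 4 * P ^ (I.k + 7) := by rw [← pow_add]; congr 1; ring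
    have h4 : 2 ^ 4 ≤ P ^ 4 := Nat.pow_le_pow_left hP2 4
    have h5 : P ^ (I.k + 11) ≤ P ^ (14 * I.k) := Nat.pow_le_pow_right (by omega) (by omega)
    have h6 : 16 * P ^ (I.k + 7) ≤ P ^ 4 * P ^ (I.k + 7) := Nat.mul_le_mul_right _ (by omega)
    omega
  calc I.raw.data.R = I.raw.data.M ^ I.k := rfl
    _ ≤ (P ^ (14 * I.k)) ^ I.k := Nat.pow_le_pow_left hM _
    _ = P ^ (14 * I.k ^ 2) := by rw [← pow_mul]; congr 1; ring

/-- If `K = 1` then `k = 1`, so that powers of `K + 1` reduce to powers of `K`. -/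
theorem succ_pow_le (hk : 0 < I.k) (a : ℕ) :
    (I.K + 1) ^ (a * I.k ^ 2) ≤ 2 ^ a * I.K ^ (2 * a * I.k ^ 2) := by
  have hk' := I.k_le_K
  by_cases hK : I.K = 1
  · have : I.k = 1 := by omega
    simp [hK, this]
  · have h1 : I.K + 1 ≤ I.K ^ 2 := by
      have : 2 ≤ I.K := by omega
      nlinarith
    calc (I.K + 1) ^ (a * I.k ^ 2) ≤ (I.K ^ 2) ^ (a * I.k ^ 2) := Nat.pow_le_pow_left h1 _
      _ = 1 * I.K ^ (2 * a * I.k ^ 2) := by rw [← pow_mul, one_mul, mul_assoc]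
      _ ≤ _ := Nat.mul_le_mul_right _ Nat.one_le_two_pow

/-- The bound on all values that the machine stores. -/
def wordBound (I : MultiStrings) : ℕ := 16 * (I.raw.data.R * I.raw.data.R) * I.magnitude

/-- R is at most 2^14 times the 28th power of K^(k²), hence the 42nd power of the magnitude. The
exponent is then 4 + 42 + 42 + 1, where 4 comes from the factor 16. -/
theorem wordBound_le (hk : 0 < I.k) (hδ : IsCharacterwiseWildcardCompatible I.δ) :
    I.wordBound ≤ I.magnitude ^ 89 := by
  have h2 : 2 ≤ I.magnitude := by rw [magnitude]; omega
  have hKm : I.K ^ I.k ^ 2 ≤ I.magnitude := by rw [magnitude]; omega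
  have hR : I.raw.data.R ≤ I.magnitude ^ 42 := by
    calc I.raw.data.R ≤ (I.K + 1) ^ (14 * I.k ^ 2) := R_le hk hδ
      _ ≤ 2 ^ 14 * I.K ^ (2 * 14 * I.k ^ 2) := succ_pow_le hk 14
      _ = 2 ^ 14 * (I.K ^ I.k ^ 2) ^ 28 := by rw [← pow_mul]; congr 2; ring
      _ ≤ I.magnitude ^ 14 * I.magnitude ^ 28 :=
        Nat.mul_le_mul (Nat.pow_le_pow_left h2 _) (Nat.pow_le_pow_left hKm _)
      _ = I.magnitude ^ 42 := by rw [← pow_add]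
  calc I.wordBound = 2 ^ 4 * (I.raw.data.R * I.raw.data.R) * I.magnitude := by
        rw [wordBound]
    _ ≤ I.magnitude ^ 4 * (I.magnitude ^ 42 * I.magnitude ^ 42) * I.magnitude :=
        Nat.mul_le_mul_right _ (Nat.mul_le_mul (Nat.pow_le_pow_left h2 _) (Nat.mul_le_mul hR hR))
    _ = I.magnitude ^ 89 := by ring

theorem raw_good (hk : 0 < I.k) (hσ : 0 < I.σ) : I.raw.Good I.wordBound := by
  have hR : 1 ≤ I.raw.data.R := Nat.one_le_pow _ _ (by simp [Data.M])
  have hm : I.L + 2 ≤ I.magnitude := by rw [magnitude]; omega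
  have h1 : I.raw.data.R ≤ I.raw.data.R * I.raw.data.R := Nat.le_mul_of_pos_left _ hR
  have h2 : I.raw.data.R * I.raw.data.R * (I.L + 2) ≤
      I.raw.data.R * I.raw.data.R * I.magnitude := Nat.mul_le_mul_left _ hm
  have h3 : I.wordBound = 16 * (I.raw.data.R * I.raw.data.R * I.magnitude) := by
    rw [wordBound]; ring
  have h4 : I.raw.data.R * I.L ≤ I.raw.data.R * I.raw.data.R * I.L := Nat.mul_le_mul_right _ h1
  rw [mul_add] at h2
  refine ⟨hk, hσ, Bool.toNat_le _, I.raw_mult_le, ?_, ?_, ?_, ?_⟩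
  · omega
  · omega
  · show 2 * (I.raw.data.R * I.L) ≤ _
    omega
  · show I.raw.data.R * I.raw.data.R * I.L + 1 ≤ _
    omega

theorem input_bdd (hk : 0 < I.k) (hσ : 0 < I.σ) : I.input.Bdd I.wordBound := by
  have hg := raw_good hk hσ
  have hR : 1 ≤ I.raw.data.R := Nat.one_le_pow _ _ (by simp [Data.M])
  have hmag : I.magnitude ≤ I.wordBound := by
    rw [wordBound]
    exact Nat.le_mul_of_pos_left _ (by positivity)
  have h4 := hg.R_le
  have hcast : ∀ a : ℕ, a ≤ I.wordBound → |(a : ℤ)| ≤ (I.wordBound : ℤ) := fun a ha => by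
    rw [Nat.abs_cast]; exact_mod_cast ha
  have hL : I.L ≤ I.wordBound := le_trans (by rw [magnitude]; omega) hmag
  have hσR : I.σ ≤ I.raw.data.R :=
    (Nat.le_mul_of_pos_right _ (by omega)).trans (show I.σ * (I.σ + 1) ≤ _ from hg.table_le)
  have hkR : I.k ≤ I.raw.data.R := hg.k_le
  have hsup : ∀ i, max (I.lo i) (I.hi i) ≤ I.magnitude := fun i => by
    have := le_sup (f := fun i => max (I.lo i) (I.hi i)) (mem_univ i)
    rw [magnitude]
    omega
  refine ⟨fun r => ?_, fun a z => ?_⟩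
  · match r with
    | 0 => exact hcast I.k (by omega)
    | 1 => exact hcast I.σ (by omega)
    | 2 => exact hcast I.L hL
    | 3 => exact hcast I.b.toNat (by have := Bool.toNat_le I.b; omega)
    | _ + 4 => exact hcast 0 (Nat.zero_le _)
  · have key : ∀ {n : ℕ} (f : Fin n → ℕ), (∀ i, f i ≤ I.wordBound) →
        |vecArray (fun i => (f i : ℤ)) z| ≤ (I.wordBound : ℤ) := by
      intro n f hf
      rw [vecArray_natCast]
      refine hcast _ ?_
      split_ifs
      · exact hf _
      · exact Nat.zero_le _
    match a with
    | 0 =>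
      rw [input_arr_zero]
      refine key _ fun a => ?_
      have h1 := I.raw_tab (finProdFinEquiv.symm a).1 (finProdFinEquiv.symm a).2
      rw [← h1]
      have h2 : I.raw.tab ((finProdFinEquiv.symm a).1 * (I.σ + 1) + (finProdFinEquiv.symm a).2) ≤
          ∑ a ∈ range (I.σ * (I.σ + 1)), I.raw.tab a := by
        refine single_le_sum (fun _ _ => Nat.zero_le _) (mem_range.2 ?_)
        have e1 := (finProdFinEquiv.symm a).1.2
        have e2 := (finProdFinEquiv.symm a).2.2
        nlinarith
      have h3 : I.raw.D = 1 + ∑ a ∈ range (I.σ * (I.σ + 1)), I.raw.tab a := rfl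
      have h5 := hg.D_le
      omega
    | 1 =>
      rw [input_arr_one]
      exact key _ fun i => (le_max_left _ _).trans ((hsup i).trans hmag)
    | 2 =>
      rw [input_arr_two]
      exact key _ fun i => (le_max_right _ _).trans ((hsup i).trans hmag)
    | 3 =>
      rw [input_arr_three]
      refine key (fun c => I.multiplicity (I.columnIndex.symm c)) fun c => ?_
      rw [← I.raw_mult]
      exact (I.raw_mult_le _).trans hL
    | _ + 4 => exact hcast 0 (Nat.zero_le _)

/-- The crude bound D < 2^D is enough: the number of levels only has to be K^{O(k²)} times log L,
and D is at most R. -/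
theorem size_le (I : MultiStrings) :
    Nat.size (I.raw.D * I.L) + 1 ≤ (I.raw.D + 2) * (Nat.log 2 I.L + 1) := by
  have h1 : Nat.size (I.raw.D * I.L) ≤ I.raw.D + (Nat.log 2 I.L + 1) := by
    rw [Nat.size_le, pow_add]
    have h2 : I.raw.D < 2 ^ I.raw.D := Nat.lt_two_pow_self
    have h3 : I.L < 2 ^ (Nat.log 2 I.L + 1) := Nat.lt_pow_succ_log_self (by norm_num) _
    exact Nat.mul_lt_mul'' h2 h3
  nlinarith

end MultiStrings

/-! ### The theorem -/

open MultiStrings WordRAM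

theorem mainTheorem2 :
    ∃ (p : WordRAM.Program) (c : ℕ), ∀ I : MultiStrings,
      0 < I.k → 0 < I.σ → IsCharacterwiseWildcardCompatible I.δ →
      ∃ (t : ℕ) (final : WordRAM.State),
        WordRAM.Runs (I.magnitude ^ c) p I.input t final ∧
        t ≤ c * I.K ^ (c * I.k ^ 2) * (Nat.log 2 I.L + 1) ∧
        I.CorrectOutput final := by
  set e := Raw.solve.depth + 1 with he
  -- One constant for three purposes. The summands are the exponent of the word size, the leading
  -- factor of the time and the coefficient of k² in its exponent. The 1 in e = depth + 1 pays for
  -- the factor D + 2 from the number of levels.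
  set c := 89 * Raw.solve.exprCost + Raw.solve.size * 2 ^ (17 * e) + 34 * e with hc
  refine ⟨Raw.solve, c, fun I hk hσ hδ => ?_⟩
  have hg := raw_good hk hσ
  obtain ⟨t, s', hrun, ht, -, hans⟩ :=
    Raw.ok_solve hg (input_bdd hk hσ) I.raw_input rfl rfl
  have hm : 2 ≤ I.magnitude := by rw [magnitude]; omega
  refine ⟨t, s', hrun.mono ?_, ht.trans ?_, correctOutput hδ hans⟩
  · calc I.wordBound ^ Raw.solve.exprCost ≤ (I.magnitude ^ 89) ^ Raw.solve.exprCost :=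
        Nat.pow_le_pow_left (wordBound_le hk hδ) _
      _ = I.magnitude ^ (89 * Raw.solve.exprCost) := by rw [← pow_mul]
      _ ≤ I.magnitude ^ c := Nat.pow_le_pow_right (by omega) (by rw [hc]; omega)
  · have hK : 1 ≤ I.K := by have := I.k_le_K; omega
    -- The exponent is 14 + 3: three further powers of K + 1 ≥ 2 give a factor of at least 8, which
    -- turns the bound on R into one on 2R + 3.
    have hG : 2 * I.raw.data.R + 2 + 1 ≤ (I.K + 1) ^ (17 * I.k ^ 2) := by
      have h1 := R_le hk hδ
      have h2 : 1 ≤ (I.K + 1) ^ (14 * I.k ^ 2) := Nat.one_le_pow _ _ (by omega)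
      have h3 : 2 ^ 3 ≤ (I.K + 1) ^ (3 * I.k ^ 2) :=
        (Nat.pow_le_pow_left (by omega) 3).trans (Nat.pow_le_pow_right (by omega) (by
          have := Nat.one_le_pow 2 I.k hk; omega))
      have h4 := Nat.mul_le_mul h3 h2
      have h5 : (I.K + 1) ^ (17 * I.k ^ 2) =
          (I.K + 1) ^ (3 * I.k ^ 2) * (I.K + 1) ^ (14 * I.k ^ 2) := by
        rw [← pow_add]; congr 1; ring
      have h6 := Nat.mul_le_mul_right ((I.K + 1) ^ (14 * I.k ^ 2)) h3
      omega
    have hD : I.raw.D + 2 ≤ 2 * I.raw.data.R + 2 + 1 := by have := hg.D_le; omega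
    calc (Nat.size (I.raw.D * I.L) + 1) * Raw.solve.time (2 * I.raw.data.R + 2)
        ≤ ((2 * I.raw.data.R + 2 + 1) * (Nat.log 2 I.L + 1)) *
          (Raw.solve.size * (2 * I.raw.data.R + 2 + 1) ^ Raw.solve.depth) :=
          Nat.mul_le_mul (I.size_le.trans (Nat.mul_le_mul_right _ hD)) (Program.time_le _ _)
      _ = Raw.solve.size * (2 * I.raw.data.R + 2 + 1) ^ e * (Nat.log 2 I.L + 1) := by
          rw [he, pow_succ]; ring
      _ ≤ Raw.solve.size * ((I.K + 1) ^ (17 * I.k ^ 2)) ^ e * (Nat.log 2 I.L + 1) :=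
          Nat.mul_le_mul_right _ (Nat.mul_le_mul_left _ (Nat.pow_le_pow_left hG _))
      _ = Raw.solve.size * (I.K + 1) ^ (17 * e * I.k ^ 2) * (Nat.log 2 I.L + 1) := by
          rw [← pow_mul]; congr 3; ring
      _ ≤ Raw.solve.size * (2 ^ (17 * e) * I.K ^ (2 * (17 * e) * I.k ^ 2)) *
          (Nat.log 2 I.L + 1) :=
          Nat.mul_le_mul_right _ (Nat.mul_le_mul_left _ (succ_pow_le hk _))
      _ = Raw.solve.size * 2 ^ (17 * e) * I.K ^ (2 * (17 * e) * I.k ^ 2) *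
          (Nat.log 2 I.L + 1) := by rw [← mul_assoc]
      _ ≤ c * I.K ^ (c * I.k ^ 2) * (Nat.log 2 I.L + 1) := by
          refine Nat.mul_le_mul_right _ (Nat.mul_le_mul (by rw [hc]; omega) ?_)
          refine Nat.pow_le_pow_right hK (Nat.mul_le_mul_right _ ?_)
          rw [hc]
          omega
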